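/- Let $M$ be a smooth Hausdorff manifold of dimension $n$ and $V\to M$ a smooth real vector bundle of finite rank. Let $\Gamma$ be a smooth linear connection on $V$ and $\Lambda$ a smooth linear connection on $TM$. Let $J^1V\to V$ be the first jet bundle, whose fibre $J^1_vV$ over $v\in V_x$ is the affine space of linear maps $A:T_xM\to T_vV$ with $T\pi\circ A=\mathrm{id}$. Let $P=(J^1V)^*$ be the phase space: its points over $x\in M$ are the pairs of a $v\in V_x$ and an affine map $f:J^1_vV\to\Lambda^nT^*_xM$. With the horizontal lift $\Gamma(v)\in J^1_vV$ as origin, $f(A)=q(A-\Gamma(v))+c$, with $q:\mathrm{Hom}(T_xM,V_x)\to\Lambda^nT_x^*M$ linear and $c=f(\Gamma(v))$. Hence $$P\cong V\oplus \mathrm{Hom}(\mathrm{Hom}(TM,V),\Lambda^nT^*M)\oplus\Lambda^nT^*M ,$$ and $P\to M$ becomes a smooth vector bundle, of which the total space $P$ is a manifold. 1. $\Gamma$ and $\Lambda$ induce a covariant derivative $\bar\nabla$ on $P\to M$: the direct sum of $\Gamma$ and of the connections that $\Gamma$ and $\Lambda$ induce on the other two summands. Let $X^h$ and $\beta^v$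 denote the horizontal and vertical lifts to $P$, with respect to $\bar\nabla$, of vector fields $X$ on $M$ and of sections $\beta$ of $P\to M$; let $K:T_pP\to P_x$ be the connection map, which vanishes on horizontal vectors and satisfies $K(b^v)=b$; and let $\bar R(X,Y)=[\bar\nabla_X,\bar\nabla_Y]-\bar\nabla_{[X,Y]}$. 2. There is a covariant derivative $D$ on $TP$ with $$D_{X^h}Y^h|_p=(\Lambda_XY)^h|_p-\tfrac12(\bar R(X,Y)p)^v|_p,\quad D_{X^h}\beta^v=(\bar\nabla_X\beta)^v,\quad D_{\beta^v}Y^h=0,\quad D_{\gamma^v}\beta^v=0$$ for all vector fields $X,Y$ on $M$ and sections $\beta,\gamma$ of $P$. Every such $D$ is smooth and flat along the fibres of $P\to M$: its curvature $R^D(\xi,\eta)$ vanishes whenever $\xi,\eta\in T_pP$ are vertical. For every $l$ it induces a dual covariant derivative $D^*$ on $\Lambda^lT^*P$. 3. For $p\in P$ over $x$ and a basis $(f_M)$ of $V_x\oplus \mathrm{Hom}(\mathrm{Hom}(T_xM,V_x),\Lambda^nT^*_xM)\subset P_x$, let $e_M\in T_pP$ be the vertical lift of $f_M$, and let $e^{*M}\in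 T^*_pP$ be the composition of $K$, the projection of $P_x$ onto this summand, and the coordinate function of $f_M$. There are linear maps $d^V:\Omega^l(P)\to\Omega^{l+1}(P)$, $l\ge 0$, on the smooth forms on $P$, with $$(d^V\alpha)_p=\sum_M e^{*M}\wedge (D^*_{e_M}\alpha)_p$$ for every $\alpha$, every $p$ and every choice of the basis $(f_M)$, so that $d^V$ is globally defined, and $$(d^V)^2=0 .$$ 4. The assertions of 3 also hold if $(f_M)$ is a basis of the whole fibre $P_x$, that is, if all vertical directions of $P\to M$ are included. -/

import Mathlib

open Bundle Set Topology
open scoped Manifold ContDiff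

noncomputable section
set_option linter.unusedSectionVars false
namespace PhaseSpace

section Alternating

variable {E F G : Type*} [NormedAddCommGroup E] [NormedSpace ℝ E] [FiniteDimensional ℝ E]
  [NormedAddCommGroup F] [NormedSpace ℝ F] [FiniteDimensional ℝ F]

instance finiteDimensional_alternating (l : ℕ) : FiniteDimensional ℝ (E [⋀^Fin l]→L[ℝ] F) :=
  Module.Finite.of_injective
    ({ toFun := fun f => f.toMultilinearMap, map_add' := fun _ _ => rfl,
       map_smul' := fun _ _ => rfl } :
        (E [⋀^Fin l]→L[ℝ] F) →ₗ[ℝ] MultilinearMap ℝ (fun _ : Fin l => E) F)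
    (fun f g h => by
      ext v
      exact congrArg (fun q : MultilinearMap ℝ (fun _ : Fin l => E) F => q v) h)

theorem contDiff_pullbackCLM (l : ℕ) {n : ℕ∞ω} :
    ContDiff ℝ n (fun g : E →L[ℝ] E =>
      (ContinuousAlternatingMap.compContinuousLinearMapCLM g :
        (E [⋀^Fin l]→L[ℝ] F) →L[ℝ] (E [⋀^Fin l]→L[ℝ] F))) := by
  rw [contDiff_clm_apply_iff]
  intro f
  let L : (E [⋀^Fin l]→L[ℝ] F) →L[ℝ] ContinuousMultilinearMap ℝ (fun _ : Fin l => E) F :=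
    ContinuousAlternatingMap.toContinuousMultilinearMapCLM ℝ
  have hL : Function.Injective L := ContinuousAlternatingMap.toContinuousMultilinearMap_injective
  obtain ⟨R, hR⟩ := L.toLinearMap.exists_leftInverse_of_injective (LinearMap.ker_eq_bot.2 hL)
  have : FiniteDimensional ℝ (ContinuousMultilinearMap ℝ (fun _ : Fin l => E) F) :=
    Module.Finite.of_injective
      ({ toFun := fun f => f.toMultilinearMap, map_add' := fun _ _ => rfl,
         map_smul' := fun _ _ => rfl } :
        ContinuousMultilinearMap ℝ (fun _ : Fin l => E) F →ₗ[ℝ]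
          MultilinearMap ℝ (fun _ : Fin l => E) F)
      (ContinuousMultilinearMap.toMultilinearMap_injective)
  let R' : ContinuousMultilinearMap ℝ (fun _ : Fin l => E) F →L[ℝ] (E [⋀^Fin l]→L[ℝ] F) :=
    LinearMap.toContinuousLinearMap R
  have key : (fun g : E →L[ℝ] E => f.compContinuousLinearMap g) =
      fun g => R' ((ContinuousMultilinearMap.compContinuousLinearMapContinuousMultilinear ℝ
        (fun _ : Fin l => E) (fun _ => E) F (fun _ => g)) f.toContinuousMultilinearMap) := by
    funext g
    exact (LinearMap.congr_fun hR (f.compContinuousLinearMap g)).symm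
  change ContDiff ℝ n (fun g : E →L[ℝ] E => f.compContinuousLinearMap g)
  rw [key]
  refine R'.contDiff.comp (ContDiff.clm_apply ?_ contDiff_const)
  exact (ContinuousMultilinearMap.contDiff _).comp (contDiff_pi.2 fun _ => contDiff_id)

theorem contDiff_pushforwardCLM (l : ℕ) {n : ℕ∞ω} :
    ContDiff ℝ n (fun g : F →L[ℝ] F =>
      (ContinuousLinearMap.compContinuousAlternatingMapCLM (ι := Fin l) ℝ E F F g :
        (E [⋀^Fin l]→L[ℝ] F) →L[ℝ] (E [⋀^Fin l]→L[ℝ] F))) := by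
  rw [contDiff_clm_apply_iff]
  intro f
  exact (LinearMap.toContinuousLinearMap
    ({ toFun := fun g => g.compContinuousAlternatingMap f
       map_add' := fun _ _ => by ext; rfl
       map_smul' := fun _ _ => by ext; rfl } :
      (F →L[ℝ] F) →ₗ[ℝ] (E [⋀^Fin l]→L[ℝ] F))).contDiff

variable {H : Type*} [TopologicalSpace H] {I : ModelWithCorners ℝ E H}
  {EB HB B : Type*} [NormedAddCommGroup EB] [NormedSpace ℝ EB] [TopologicalSpace HB]
  {IB : ModelWithCorners ℝ EB HB} [TopologicalSpace B] [ChartedSpace HB B]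
  {E₁ : B → Type*} [∀ x, AddCommGroup (E₁ x)] [∀ x, Module ℝ (E₁ x)]
  [TopologicalSpace (TotalSpace E E₁)] [∀ x, TopologicalSpace (E₁ x)]
  [FiberBundle E E₁] [VectorBundle ℝ E E₁]
  {E₂ : B → Type*} [∀ x, AddCommGroup (E₂ x)] [∀ x, Module ℝ (E₂ x)]
  [TopologicalSpace (TotalSpace F E₂)] [∀ x, TopologicalSpace (E₂ x)]
  [FiberBundle F E₂] [VectorBundle ℝ F E₂]
  [∀ x, IsTopologicalAddGroup (E₂ x)] [∀ x, ContinuousSMul ℝ (E₂ x)]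

set_option synthInstance.maxHeartbeats 200000 in
/-- The bundle of alternating maps between smooth vector bundles is smooth. -/
instance contMDiffVectorBundle_alternating (l : ℕ) {n : ℕ∞ω}
    [ContMDiffVectorBundle n E E₁ IB] [ContMDiffVectorBundle n F E₂ IB] :
    ContMDiffVectorBundle n (E [⋀^Fin l]→L[ℝ] F) (fun x => E₁ x [⋀^Fin l]→L[ℝ] E₂ x) IB := by
  have : (Bundle.ContinuousAlternatingMap.vectorPrebundle ℝ (Fin l) E E₁ F E₂).IsContMDiff
      IB n := by
    constructor
    rintro _ ⟨e₁, e₂, he₁, he₂, rfl⟩ _ ⟨e₁', e₂', he₁', he₂', rfl⟩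
    refine ⟨Pretrivialization.continuousAlternatingMapCoordChange ℝ (Fin l) e₁ e₁' e₂ e₂', ?_,
      Pretrivialization.continuousAlternatingMapCoordChange_apply⟩
    have h₁ := contMDiffOn_coordChangeL (IB := IB) (n := n) e₁' e₁
    have h₂ := contMDiffOn_coordChangeL (IB := IB) (n := n) e₂ e₂'
    have h₁' := (contDiff_pullbackCLM (E := E) (F := F) l (n := n)).contMDiff.comp_contMDiffOn h₁
    have h₂' := (contDiff_pushforwardCLM (E := E) (F := F) l (n := n)).contMDiff.comp_contMDiffOn h₂
    have := (h₂'.mono (t := e₁.baseSet ∩ e₂.baseSet ∩ (e₁'.baseSet ∩ e₂'.baseSet))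
      (by mfld_set_tac)).clm_comp (h₁'.mono (by mfld_set_tac))
    refine this.congr ?_
    intro b _
    ext f v
    rfl
  exact (Bundle.ContinuousAlternatingMap.vectorPrebundle ℝ (Fin l) E E₁ F E₂).contMDiffVectorBundle
    IB

end Alternating

section Lifts

variable {E : Type*} [NormedAddCommGroup E] [NormedSpace ℝ E]
  {M : Type*} [TopologicalSpace M] [ChartedSpace E M]
  {F : Type*} [NormedAddCommGroup F] [NormedSpace ℝ F]
  {V : M → Type*} [TopologicalSpace (TotalSpace F V)] [∀ x, AddCommGroup (V x)]
  [∀ x, Module ℝ (V x)] [∀ x, TopologicalSpace (V x)]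
  [∀ x, IsTopologicalAddGroup (V x)] [∀ x, ContinuousSMul ℝ (V x)]
  [FiberBundle F V] [VectorBundle ℝ F V]

/-- The vertical lift `V_x → T_v V` at a point `v` over `x`, written in the bundle chart at `v`. -/
def vertLift (v : TotalSpace F V) :
    V v.proj →L[ℝ] TangentSpace (𝓘(ℝ, E).prod 𝓘(ℝ, F)) v :=
  (ContinuousLinearMap.inr ℝ E F : F →L[ℝ] E × F) ∘L
    (trivializationAt F V v.proj).continuousLinearMapAt ℝ v.proj

/-- The inverse of `vertLift v` on vertical vectors. -/
def vertInv (v : TotalSpace F V) :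
    TangentSpace (𝓘(ℝ, E).prod 𝓘(ℝ, F)) v →L[ℝ] V v.proj :=
  (trivializationAt F V v.proj).symmL ℝ v.proj ∘L
    (ContinuousLinearMap.snd ℝ E F : E × F →L[ℝ] F)

/-- The tangent map of the bundle projection at `v`. -/
def projTangent (v : TotalSpace F V) :
    TangentSpace (𝓘(ℝ, E).prod 𝓘(ℝ, F)) v →L[ℝ] TangentSpace 𝓘(ℝ, E) v.proj :=
  mfderiv (𝓘(ℝ, E).prod 𝓘(ℝ, F)) 𝓘(ℝ, E) (π F V) v

theorem projTangent_eq_fst (v : TotalSpace F V) :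
    projTangent (E := E) v = (ContinuousLinearMap.fst ℝ E F : E × F →L[ℝ] E) := by
  have hd : MDifferentiableAt (𝓘(ℝ, E).prod 𝓘(ℝ, F)) 𝓘(ℝ, E) (π F V) v :=
    (contMDiffAt_proj V (n := 1)).mdifferentiableAt one_ne_zero
  rw [projTangent, hd.mfderiv]
  have hev : writtenInExtChartAt (𝓘(ℝ, E).prod 𝓘(ℝ, F)) 𝓘(ℝ, E) v (π F V) =ᶠ[
      𝓝 (extChartAt (𝓘(ℝ, E).prod 𝓘(ℝ, F)) v v)] (Prod.fst : E × F → E) := by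
    filter_upwards [extChartAt_target_mem_nhds (I := 𝓘(ℝ, E).prod 𝓘(ℝ, F)) v] with y hy
    rw [FiberBundle.extChartAt_target] at hy
    have h1 : y.1 ∈ (extChartAt 𝓘(ℝ, E) v.proj).target := hy.1.1
    have h2 : (extChartAt 𝓘(ℝ, E) v.proj).symm y.1 ∈
      (trivializationAt F V v.proj).baseSet := hy.1.2
    simp only [writtenInExtChartAt, Function.comp_apply, FiberBundle.extChartAt]
    change extChartAt 𝓘(ℝ, E) v.proj
      (((trivializationAt F V v.proj).toPartialEquiv.symm
        ((extChartAt 𝓘(ℝ, E) v.proj).symm y.1, y.2)).proj) = y.1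
    have h3 := (trivializationAt F V v.proj).proj_symm_apply'
      (b := (extChartAt 𝓘(ℝ, E) v.proj).symm y.1) (x := y.2) h2
    erw [h3]
    exact (extChartAt 𝓘(ℝ, E) v.proj).right_inv h1
  have hr : range (𝓘(ℝ, E).prod 𝓘(ℝ, F)) = univ := by
    simp [modelWithCorners_prod_coe]
  rw [hr, fderivWithin_univ, hev.fderiv_eq]
  exact fderiv_fst

/-- `vertLift v w` is the velocity of the curve `t ↦ v + t w` in the fibre. -/
theorem vertLift_eq_velocity (v : TotalSpace F V) (w : V v.proj) :
    vertLift (E := E) v w =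
      mfderiv 𝓘(ℝ, ℝ) (𝓘(ℝ, E).prod 𝓘(ℝ, F))
        (fun t : ℝ => (⟨v.proj, v.2 + t • w⟩ : TotalSpace F V)) 0 (1 : ℝ) := by
  set e := trivializationAt F V v.proj with he
  have hb : v.proj ∈ e.baseSet := FiberBundle.mem_baseSet_trivializationAt F V v.proj
  set c : ℝ → TotalSpace F V := fun t => ⟨v.proj, v.2 + t • w⟩ with hc
  have hec : ∀ t, (e (c t)).2 = e.continuousLinearMapAt ℝ v.proj v.2 +
      t • e.continuousLinearMapAt ℝ v.proj w := by
    intro t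
    have : (e (c t)).2 = e.continuousLinearMapAt ℝ v.proj (v.2 + t • w) := by
      rw [e.continuousLinearMapAt_apply ℝ, e.coe_linearMapAt_of_mem hb]
    rw [this, map_add, map_smul]
  have hd : MDifferentiableAt 𝓘(ℝ, ℝ) (𝓘(ℝ, E).prod 𝓘(ℝ, F)) c 0 := by
    rw [mdifferentiableAt_totalSpace]
    refine ⟨mdifferentiableAt_const, ?_⟩
    have : (fun t => (trivializationAt F V (c 0).proj (c t)).2) = fun t =>
      e.continuousLinearMapAt ℝ v.proj v.2 + t • e.continuousLinearMapAt ℝ v.proj w :=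
      funext hec
    rw [this]
    exact DifferentiableAt.mdifferentiableAt (by fun_prop)
  rw [hd.mfderiv]
  have hw : writtenInExtChartAt 𝓘(ℝ, ℝ) (𝓘(ℝ, E).prod 𝓘(ℝ, F)) 0 c = fun t : ℝ =>
      ((extChartAt 𝓘(ℝ, E) v.proj v.proj, e.continuousLinearMapAt ℝ v.proj v.2 +
        t • e.continuousLinearMapAt ℝ v.proj w) : E × F) := by
    funext t
    simp only [writtenInExtChartAt, Function.comp_apply, FiberBundle.extChartAt]
    have h1 : (e (c t)).1 = v.proj := e.coe_fst' hb
    refine Prod.ext ?_ (hec t)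
    exact congrArg (extChartAt 𝓘(ℝ, E) v.proj) h1
  rw [hw]
  have hder : HasFDerivAt (fun t : ℝ =>
      ((extChartAt 𝓘(ℝ, E) v.proj v.proj, e.continuousLinearMapAt ℝ v.proj v.2 +
        t • e.continuousLinearMapAt ℝ v.proj w) : E × F))
      ((0 : ℝ →L[ℝ] E).prod ((ContinuousLinearMap.id ℝ ℝ).smulRight
        (e.continuousLinearMapAt ℝ v.proj w))) (extChartAt 𝓘(ℝ, ℝ) (0 : ℝ) 0) :=
    (hasFDerivAt_const _ _).prodMk (((hasFDerivAt_id _).smul_const _).const_add _)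
  have hr : range 𝓘(ℝ, ℝ) = univ := by simp
  rw [hr, fderivWithin_univ, hder.fderiv]
  refine Prod.ext rfl ?_
  exact (one_smul ℝ _).symm

theorem vertInv_vertLift (v : TotalSpace F V) (w : V v.proj) :
    vertInv (E := E) v (vertLift v w) = w := by
  change (trivializationAt F V v.proj).symmL ℝ v.proj
    ((trivializationAt F V v.proj).continuousLinearMapAt ℝ v.proj w) = w
  exact (trivializationAt F V v.proj).symmL_continuousLinearMapAt
    (FiberBundle.mem_baseSet_trivializationAt F V v.proj) w

theorem vertLift_vertInv (v : TotalSpace F V) (ξ : TangentSpace (𝓘(ℝ, E).prod 𝓘(ℝ, F)) v)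
    (h : projTangent v ξ = 0) : vertLift v (vertInv v ξ) = ξ := by
  rw [projTangent_eq_fst] at h
  have h' : (show E × F from ξ).1 = 0 := h
  have h2 : (trivializationAt F V v.proj).continuousLinearMapAt ℝ v.proj
      ((trivializationAt F V v.proj).symmL ℝ v.proj (show E × F from ξ).2) =
        (show E × F from ξ).2 :=
    (trivializationAt F V v.proj).continuousLinearMapAt_symmL
      (FiberBundle.mem_baseSet_trivializationAt F V v.proj) _
  exact Prod.ext h'.symm h2

theorem projTangent_vertLift (v : TotalSpace F V) (w : V v.proj) :
    projTangent (E := E) v (vertLift v w) = 0 := by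
  rw [projTangent_eq_fst]; rfl

/-- The horizontal lift of `u ∈ T_x M` to `T_v V`: for a section `s` with `s(x) = v` it is
`Ts(u) - (∇_u s)^v`. -/
def horLift (Γ : CovariantDerivative 𝓘(ℝ, E) F V) (v : TotalSpace F V) :
    TangentSpace 𝓘(ℝ, E) v.proj →L[ℝ] TangentSpace (𝓘(ℝ, E).prod 𝓘(ℝ, F)) v :=
  let Ts : E →L[ℝ] E × F := mfderiv 𝓘(ℝ, E) (𝓘(ℝ, E).prod 𝓘(ℝ, F))
    (fun y => (⟨y, FiberBundle.extend F v.2 y⟩ : TotalSpace F V)) v.proj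
  let N : E →L[ℝ] E × F := vertLift v ∘L Γ (FiberBundle.extend F v.2) v.proj
  Ts - N

theorem projTangent_comp_horLift [IsManifold 𝓘(ℝ, E) 1 M] [ContMDiffVectorBundle 1 F V 𝓘(ℝ, E)]
    (Γ : CovariantDerivative 𝓘(ℝ, E) F V) (v : TotalSpace F V) :
    projTangent v ∘L horLift Γ v = ContinuousLinearMap.id ℝ _ := by
  have hs : MDifferentiableAt 𝓘(ℝ, E) (𝓘(ℝ, E).prod 𝓘(ℝ, F))
      (fun y => (⟨y, FiberBundle.extend F v.2 y⟩ : TotalSpace F V)) v.proj :=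
    FiberBundle.mdifferentiableAt_extend 𝓘(ℝ, E) F v.2
  have hv : (⟨v.proj, FiberBundle.extend F v.2 v.proj⟩ : TotalSpace F V) = v := by
    simp
  have hπ : MDifferentiableAt (𝓘(ℝ, E).prod 𝓘(ℝ, F)) 𝓘(ℝ, E) (π F V)
      (⟨v.proj, FiberBundle.extend F v.2 v.proj⟩ : TotalSpace F V) :=
    (contMDiffAt_proj V (n := 1)).mdifferentiableAt one_ne_zero
  have h1 := mfderiv_comp v.proj hπ hs
  have h2 : (π F V ∘ fun y => (⟨y, FiberBundle.extend F v.2 y⟩ : TotalSpace F V)) = id := rfl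
  rw [h2, mfderiv_id] at h1
  have h3 := projTangent_eq_fst (E := E)
    (⟨v.proj, FiberBundle.extend F v.2 v.proj⟩ : TotalSpace F V)
  rw [projTangent] at h3
  rw [h3] at h1
  rw [projTangent_eq_fst]
  ext u
  have h4 : u = _ := congrArg (fun A : E →L[ℝ] E => A u) h1
  change (_ : E) - 0 = u
  rw [sub_zero]
  exact h4.symm

/-- The fibre `J¹_v V` of the first jet bundle over `v ∈ V_x`, an affine space: all linear maps
`A : T_x M → T_v V` with `Tπ ∘ A = id`. -/
def jetSpace (v : TotalSpace F V) :
    AffineSubspace ℝ (TangentSpace 𝓘(ℝ, E) v.proj →L[ℝ]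
      TangentSpace (𝓘(ℝ, E).prod 𝓘(ℝ, F)) v) where
  carrier := {A | projTangent v ∘L A = ContinuousLinearMap.id ℝ _}
  smul_vsub_vadd_mem' := by
    intro c A B C hA hB hC
    simp only [mem_ofPred_eq, vsub_eq_sub, vadd_eq_add, ContinuousLinearMap.comp_add,
      ContinuousLinearMap.comp_smul, ContinuousLinearMap.comp_sub] at *
    rw [hA, hB, hC, sub_self, smul_zero, zero_add]

instance (v : TotalSpace F V) : Nonempty (jetSpace (E := E) v) :=
  ⟨⟨(ContinuousLinearMap.inl ℝ E F : E →L[ℝ] E × F), by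
    change projTangent v ∘L _ = _
    rw [projTangent_eq_fst]; rfl⟩⟩

instance (v : TotalSpace F V) : AddTorsor (jetSpace (E := E) v).direction (jetSpace (E := E) v) :=
  AffineSubspace.toAddTorsor _

theorem mem_jetSpace_direction (v : TotalSpace F V)
    (B : TangentSpace 𝓘(ℝ, E) v.proj →L[ℝ] TangentSpace (𝓘(ℝ, E).prod 𝓘(ℝ, F)) v) :
    B ∈ (jetSpace v).direction ↔ projTangent v ∘L B = 0 := by
  obtain ⟨A, hA⟩ := (inferInstance : Nonempty (jetSpace (E := E) v))
  rw [← AffineSubspace.vadd_mem_iff_mem_direction B hA]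
  have hA' : projTangent v ∘L A = ContinuousLinearMap.id ℝ _ := hA
  change projTangent v ∘L (B + A) = _ ↔ _
  rw [ContinuousLinearMap.comp_add, hA', add_eq_right]

/-- The linear isomorphism `Hom(T_x M, V_x) → Hom(T_x M, ker Tπ)` onto the vector space of
translations of `J¹_v V`. -/
def jetTranslation (v : TotalSpace F V) :
    (TangentSpace 𝓘(ℝ, E) v.proj →L[ℝ] V v.proj) ≃ₗ[ℝ] (jetSpace (E := E) v).direction where
  toFun J := ⟨vertLift v ∘L J, by
    rw [mem_jetSpace_direction]
    ext u
    exact projTangent_vertLift v (J u)⟩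
  map_add' J J' := Subtype.ext (ContinuousLinearMap.comp_add _ _ _)
  map_smul' c J := Subtype.ext (ContinuousLinearMap.comp_smul _ _ _)
  invFun B := vertInv v ∘L (B : TangentSpace 𝓘(ℝ, E) v.proj →L[ℝ]
      TangentSpace (𝓘(ℝ, E).prod 𝓘(ℝ, F)) v)
  left_inv J := by
    ext u
    exact vertInv_vertLift v (J u)
  right_inv B := by
    have hB := (mem_jetSpace_direction v _).1 B.2
    refine Subtype.ext (ContinuousLinearMap.ext fun u => ?_)
    exact vertLift_vertInv v _ (congrArg (fun A => A u) hB)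

end Lifts

section Transport

/-- A copy of the family `W`, to be given the vector bundle structure of `E₁` along `e`. -/
def Transported {B : Type*} {W E₁ : B → Type*} (_ : ∀ x, W x ≃ E₁ x) : B → Type _ := W

variable {B : Type*} [TopologicalSpace B] {F₁ : Type*} [NormedAddCommGroup F₁] [NormedSpace ℝ F₁]
  {W E₁ : B → Type*} (e : ∀ x, W x ≃ E₁ x)

/-- The fibrewise identification, now as a map from the transported family. -/
def Transported.equiv (x : B) : Transported e x ≃ E₁ x := e x

instance [∀ x, AddCommGroup (E₁ x)] (x : B) : AddCommGroup (Transported e x) :=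
  (Transported.equiv e x).addCommGroup

instance [∀ x, AddCommGroup (E₁ x)] [∀ x, Module ℝ (E₁ x)] (x : B) :
    Module ℝ (Transported e x) :=
  (Transported.equiv e x).module ℝ

instance [∀ x, TopologicalSpace (E₁ x)] (x : B) : TopologicalSpace (Transported e x) :=
  TopologicalSpace.induced (Transported.equiv e x) inferInstance

/-- The fibrewise identification as a continuous linear equivalence. -/
def Transported.equivL [∀ x, AddCommGroup (E₁ x)] [∀ x, Module ℝ (E₁ x)]
    [∀ x, TopologicalSpace (E₁ x)] (x : B) : Transported e x ≃L[ℝ] E₁ x where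
  toLinearEquiv := (Transported.equiv e x).linearEquiv ℝ
  continuous_toFun := continuous_induced_dom
  continuous_invFun := by
    refine continuous_induced_rng.2 ?_
    have : ⇑(Transported.equiv e x) ∘
        ((Transported.equiv e x).linearEquiv ℝ).symm = id := by
      funext y
      exact (Transported.equiv e x).apply_symm_apply y
    exact this ▸ continuous_id

instance [∀ x, AddCommGroup (E₁ x)] [∀ x, TopologicalSpace (E₁ x)]
    [∀ x, IsTopologicalAddGroup (E₁ x)] (x : B) : IsTopologicalAddGroup (Transported e x) :=
  topologicalAddGroup_induced ((Transported.equiv e x).addEquiv)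

instance [∀ x, AddCommGroup (E₁ x)] [∀ x, Module ℝ (E₁ x)] [∀ x, TopologicalSpace (E₁ x)]
    [∀ x, ContinuousSMul ℝ (E₁ x)] (x : B) : ContinuousSMul ℝ (Transported e x) :=
  continuousSMul_induced ((Transported.equiv e x).linearEquiv ℝ).toLinearMap

variable [∀ x, AddCommGroup (E₁ x)] [∀ x, Module ℝ (E₁ x)] [∀ x, TopologicalSpace (E₁ x)]
  [TopologicalSpace (TotalSpace F₁ E₁)]

/-- The bijection of total spaces. -/
def Transported.totalEquiv (F₁ : Type*) :
    TotalSpace F₁ (Transported e) ≃ TotalSpace F₁ E₁ where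
  toFun p := ⟨p.1, Transported.equiv e p.1 p.2⟩
  invFun p := ⟨p.1, (Transported.equiv e p.1).symm p.2⟩
  left_inv p := by simp
  right_inv p := by simp

instance : TopologicalSpace (TotalSpace F₁ (Transported e)) :=
  TopologicalSpace.induced (Transported.totalEquiv e F₁) inferInstance

/-- The homeomorphism of total spaces. -/
def Transported.totalHomeo : TotalSpace F₁ (Transported e) ≃ₜ TotalSpace F₁ E₁ :=
  (Transported.totalEquiv e F₁).toHomeomorphOfIsInducing ⟨rfl⟩

/-- A trivialization of `E₁` gives one of the transported bundle. -/
def Transported.triv (t : Trivialization F₁ (π F₁ E₁)) :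
    Trivialization F₁ (π F₁ (Transported e)) :=
  t.compHomeomorph (Transported.totalHomeo e)

variable [FiberBundle F₁ E₁]

instance : FiberBundle F₁ (Transported e) where
  totalSpaceMk_isInducing' b := by
    refine (Transported.totalHomeo e (F₁ := F₁)).isInducing.of_comp_iff.1 ?_
    exact (FiberBundle.totalSpaceMk_isInducing F₁ E₁ b).comp ⟨rfl⟩
  trivializationAtlas' := {t | ∃ t' : Trivialization F₁ (π F₁ E₁),
    MemTrivializationAtlas t' ∧ t = Transported.triv e t'}
  trivializationAt' b := Transported.triv e (trivializationAt F₁ E₁ b)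
  mem_baseSet_trivializationAt' b := FiberBundle.mem_baseSet_trivializationAt F₁ E₁ b
  trivialization_mem_atlas' b := ⟨trivializationAt F₁ E₁ b, inferInstance, rfl⟩

theorem Transported.triv_isLinear (t : Trivialization F₁ (π F₁ E₁)) [t.IsLinear ℝ] :
    (Transported.triv e t).IsLinear ℝ where
  linear b hb :=
    { map_add := fun x y => by
        change (t ⟨b, Transported.equivL e b (x + y)⟩).2 = _
        rw [map_add]
        exact (t.linear ℝ (b := b) hb).map_add _ _
      map_smul := fun c x => by
        change (t ⟨b, Transported.equivL e b (c • x)⟩).2 = _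
        rw [map_smul]
        exact (t.linear ℝ (b := b) hb).map_smul c _ }

theorem Transported.coordChangeL_eq (t t' : Trivialization F₁ (π F₁ E₁))
    [t.IsLinear ℝ] [t'.IsLinear ℝ] [(Transported.triv e t).IsLinear ℝ]
    [(Transported.triv e t').IsLinear ℝ] {b : B} (hb : b ∈ t.baseSet ∩ t'.baseSet) :
    ((Transported.triv e t).coordChangeL ℝ (Transported.triv e t') b : F₁ →L[ℝ] F₁) =
      (t.coordChangeL ℝ t' b : F₁ →L[ℝ] F₁) := by
  ext v
  have h1 := t.coordChangeL_apply' t' (R := ℝ) hb v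
  have h2 := (Transported.triv e t).coordChangeL_apply' (Transported.triv e t') (R := ℝ) hb v
  refine Eq.trans h2 (Eq.trans ?_ h1.symm)
  change (t' (Transported.totalHomeo e
    ((Transported.totalHomeo e).symm (t.toOpenPartialHomeomorph.symm (b, v))))).2 = _
  rw [Homeomorph.apply_symm_apply]

instance [VectorBundle ℝ F₁ E₁] : VectorBundle ℝ F₁ (Transported e) where
  trivialization_linear' := by
    rintro _ ⟨t, ht, rfl⟩
    exact Transported.triv_isLinear e t
  continuousOn_coordChange' := by
    rintro _ _ ⟨t, ht, rfl⟩ ⟨t', ht', rfl⟩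
    have := Transported.triv_isLinear e t
    have := Transported.triv_isLinear e t'
    exact (continuousOn_coordChange ℝ t t').congr fun b hb =>
      Transported.coordChangeL_eq e t t' hb

instance {EB HB : Type*} [NormedAddCommGroup EB] [NormedSpace ℝ EB] [TopologicalSpace HB]
    {IB : ModelWithCorners ℝ EB HB} [ChartedSpace HB B] {n : ℕ∞ω} [VectorBundle ℝ F₁ E₁]
    [ContMDiffVectorBundle n F₁ E₁ IB] : ContMDiffVectorBundle n F₁ (Transported e) IB where
  contMDiffOn_coordChangeL := by
    rintro _ _ ⟨t, ht, rfl⟩ ⟨t', ht', rfl⟩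
    have := Transported.triv_isLinear e t
    have := Transported.triv_isLinear e t'
    exact (contMDiffOn_coordChangeL (IB := IB) t t').congr fun b hb =>
      Transported.coordChangeL_eq e t t' hb

end Transport

section PhaseSpace

variable {E : Type*} [NormedAddCommGroup E] [NormedSpace ℝ E] [FiniteDimensional ℝ E]
  {M : Type*} [TopologicalSpace M] [ChartedSpace E M] [IsManifold 𝓘(ℝ, E) ∞ M]
  {F : Type*} [NormedAddCommGroup F] [NormedSpace ℝ F] [FiniteDimensional ℝ F]
  {V : M → Type*} [TopologicalSpace (TotalSpace F V)] [∀ x, AddCommGroup (V x)]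
  [∀ x, Module ℝ (V x)] [∀ x, TopologicalSpace (V x)] [∀ x, IsTopologicalAddGroup (V x)]
  [∀ x, ContinuousSMul ℝ (V x)] [FiberBundle F V] [VectorBundle ℝ F V]
  [ContMDiffVectorBundle ∞ F V 𝓘(ℝ, E)]

/-- `Λⁿ T*_x M`, where `n = dim M`. -/
abbrev VolForm (E : Type*) [NormedAddCommGroup E] [NormedSpace ℝ E]
    {M : Type*} [TopologicalSpace M] [ChartedSpace E M] (x : M) : Type _ :=
  TangentSpace 𝓘(ℝ, E) x [⋀^Fin (Module.finrank ℝ E)]→L[ℝ] Trivial M ℝ x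

/-- The affine maps `J¹_v V → Λⁿ T*_x M`, for `v ∈ V_x`. -/
abbrev AffineJetDual (E : Type*) [NormedAddCommGroup E] [NormedSpace ℝ E]
    {M : Type*} [TopologicalSpace M] [ChartedSpace E M]
    {F : Type*} [NormedAddCommGroup F] [NormedSpace ℝ F]
    {V : M → Type*} [TopologicalSpace (TotalSpace F V)] [∀ x, AddCommGroup (V x)]
    [∀ x, Module ℝ (V x)] [∀ x, TopologicalSpace (V x)] [∀ x, IsTopologicalAddGroup (V x)]
    [∀ x, ContinuousSMul ℝ (V x)] [FiberBundle F V] [VectorBundle ℝ F V]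
    (v : TotalSpace F V) : Type _ :=
  jetSpace (E := E) v →ᵃ[ℝ] VolForm E v.proj

/-- The set underlying the fibre over `x ∈ M` of the affine dual of the first jet bundle: a point
`v ∈ V_x` and an affine map `J¹_v V → Λⁿ T*_x M`. -/
def AffineDual (E : Type*) [NormedAddCommGroup E] [NormedSpace ℝ E]
    {M : Type*} [TopologicalSpace M] [ChartedSpace E M]
    (F : Type*) [NormedAddCommGroup F] [NormedSpace ℝ F]
    (V : M → Type*) [TopologicalSpace (TotalSpace F V)] [∀ x, AddCommGroup (V x)]
    [∀ x, Module ℝ (V x)] [∀ x, TopologicalSpace (V x)] [∀ x, IsTopologicalAddGroup (V x)]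
    [∀ x, ContinuousSMul ℝ (V x)] [FiberBundle F V] [VectorBundle ℝ F V] (x : M) : Type _ :=
  Σ v : V x, AffineJetDual E (⟨x, v⟩ : TotalSpace F V)

/-- The fibres of the vector bundle `V ⊕ ((V ⊗ T*M)* ⊗ Λⁿ T*M) ⊕ Λⁿ T*M`. -/
def SplitDual (E : Type*) [NormedAddCommGroup E] [NormedSpace ℝ E]
    {M : Type*} [TopologicalSpace M] [ChartedSpace E M]
    (V : M → Type*) [∀ x, AddCommGroup (V x)]
    [∀ x, Module ℝ (V x)] [∀ x, TopologicalSpace (V x)] [∀ x, IsTopologicalAddGroup (V x)]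
    [∀ x, ContinuousSMul ℝ (V x)] (x : M) : Type _ :=
  V x × (((TangentSpace 𝓘(ℝ, E) x →L[ℝ] V x) →L[ℝ] VolForm E x) × VolForm E x)

/-- The model fibre of `SplitDual`. -/
def SplitModel (E F : Type*) [NormedAddCommGroup E] [NormedSpace ℝ E]
    [NormedAddCommGroup F] [NormedSpace ℝ F] : Type _ :=
  F × (((E →L[ℝ] F) →L[ℝ] (E [⋀^Fin (Module.finrank ℝ E)]→L[ℝ] ℝ)) ×
    (E [⋀^Fin (Module.finrank ℝ E)]→L[ℝ] ℝ))

instance : NormedAddCommGroup (SplitModel E F) :=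
  inferInstanceAs (NormedAddCommGroup (F × (((E →L[ℝ] F) →L[ℝ]
    (E [⋀^Fin (Module.finrank ℝ E)]→L[ℝ] ℝ)) × (E [⋀^Fin (Module.finrank ℝ E)]→L[ℝ] ℝ))))

instance : NormedSpace ℝ (SplitModel E F) :=
  inferInstanceAs (NormedSpace ℝ (F × (((E →L[ℝ] F) →L[ℝ]
    (E [⋀^Fin (Module.finrank ℝ E)]→L[ℝ] ℝ)) × (E [⋀^Fin (Module.finrank ℝ E)]→L[ℝ] ℝ))))

instance (x : M) : AddCommGroup (SplitDual E V x) :=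
  inferInstanceAs (AddCommGroup
    (V x × (((TangentSpace 𝓘(ℝ, E) x →L[ℝ] V x) →L[ℝ] VolForm E x) × VolForm E x)))

instance (x : M) : Module ℝ (SplitDual E V x) :=
  inferInstanceAs (Module ℝ
    (V x × (((TangentSpace 𝓘(ℝ, E) x →L[ℝ] V x) →L[ℝ] VolForm E x) × VolForm E x)))

instance (x : M) : TopologicalSpace (SplitDual E V x) :=
  inferInstanceAs (TopologicalSpace
    (V x × (((TangentSpace 𝓘(ℝ, E) x →L[ℝ] V x) →L[ℝ] VolForm E x) × VolForm E x)))

instance (x : M) : IsTopologicalAddGroup (SplitDual E V x) :=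
  inferInstanceAs (IsTopologicalAddGroup
    (V x × (((TangentSpace 𝓘(ℝ, E) x →L[ℝ] V x) →L[ℝ] VolForm E x) × VolForm E x)))

instance (x : M) : ContinuousSMul ℝ (SplitDual E V x) :=
  inferInstanceAs (ContinuousSMul ℝ
    (V x × (((TangentSpace 𝓘(ℝ, E) x →L[ℝ] V x) →L[ℝ] VolForm E x) × VolForm E x)))

set_option synthInstance.maxHeartbeats 400000 in
set_option maxHeartbeats 1000000 in
instance : TopologicalSpace (TotalSpace (SplitModel E F) (SplitDual E V)) :=
  inferInstanceAs (TopologicalSpace (TotalSpace (F × (((E →L[ℝ] F) →L[ℝ]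
    (E [⋀^Fin (Module.finrank ℝ E)]→L[ℝ] ℝ)) × (E [⋀^Fin (Module.finrank ℝ E)]→L[ℝ] ℝ)))
    (fun x : M => V x × (((TangentSpace 𝓘(ℝ, E) x →L[ℝ] V x) →L[ℝ] VolForm E x) ×
      VolForm E x))))

set_option synthInstance.maxHeartbeats 400000 in
set_option maxHeartbeats 1000000 in
instance : FiberBundle (SplitModel E F) (SplitDual E V) :=
  inferInstanceAs (FiberBundle (F × (((E →L[ℝ] F) →L[ℝ]
    (E [⋀^Fin (Module.finrank ℝ E)]→L[ℝ] ℝ)) × (E [⋀^Fin (Module.finrank ℝ E)]→L[ℝ] ℝ)))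
    (fun x : M => V x × (((TangentSpace 𝓘(ℝ, E) x →L[ℝ] V x) →L[ℝ] VolForm E x) ×
      VolForm E x)))

set_option synthInstance.maxHeartbeats 400000 in
set_option maxHeartbeats 1000000 in
instance : VectorBundle ℝ (SplitModel E F) (SplitDual E V) :=
  inferInstanceAs (VectorBundle ℝ (F × (((E →L[ℝ] F) →L[ℝ]
    (E [⋀^Fin (Module.finrank ℝ E)]→L[ℝ] ℝ)) × (E [⋀^Fin (Module.finrank ℝ E)]→L[ℝ] ℝ)))
    (fun x : M => V x × (((TangentSpace 𝓘(ℝ, E) x →L[ℝ] V x) →L[ℝ] VolForm E x) ×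
      VolForm E x)))

set_option synthInstance.maxHeartbeats 400000 in
set_option maxHeartbeats 1000000 in
instance : ContMDiffVectorBundle ∞ (SplitModel E F) (SplitDual E V) 𝓘(ℝ, E) :=
  inferInstanceAs (ContMDiffVectorBundle ∞ (F × (((E →L[ℝ] F) →L[ℝ]
    (E [⋀^Fin (Module.finrank ℝ E)]→L[ℝ] ℝ)) × (E [⋀^Fin (Module.finrank ℝ E)]→L[ℝ] ℝ)))
    (fun x : M => V x × (((TangentSpace 𝓘(ℝ, E) x →L[ℝ] V x) →L[ℝ] VolForm E x) ×
      VolForm E x)) 𝓘(ℝ, E))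

/-- A linear map out of the finite-dimensional space `Hom(T_x M, V_x)` is continuous. -/
def homToCLM (x : M) (f : (TangentSpace 𝓘(ℝ, E) x →L[ℝ] V x) →ₗ[ℝ] VolForm E x) :
    (TangentSpace 𝓘(ℝ, E) x →L[ℝ] V x) →L[ℝ] VolForm E x where
  toLinearMap := f
  cont := by
    let k : (TangentSpace 𝓘(ℝ, E) x →L[ℝ] V x) ≃L[ℝ] (E →L[ℝ] F) :=
      ContinuousLinearEquiv.arrowCongr (ContinuousLinearEquiv.refl ℝ E)
        ((trivializationAt F V x).continuousLinearEquivAt ℝ x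
          (FiberBundle.mem_baseSet_trivializationAt F V x))
    have h := (f ∘ₗ k.symm.toLinearMap).continuous_of_finiteDimensional.comp k.continuous
    refine h.congr fun J => ?_
    exact congrArg f (k.symm_apply_apply J)

/-- The jet `Γ(v) ∈ J¹_v V` of a connection. -/
def connectionJet (Γ : CovariantDerivative 𝓘(ℝ, E) F V) (v : TotalSpace F V) :
    jetSpace (E := E) v :=
  ⟨horLift Γ v, projTangent_comp_horLift Γ v⟩

/-- With the jet `Γ(v)` as origin, an affine map `f` on `J¹_v V` splits as
`f(A) = q(A - Γ(v)) + c`, where `q : Hom(T_x M, V_x) → Λⁿ T*_x M` is linear and `c = f(Γ(v))`. -/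
def splitAt (Γ : CovariantDerivative 𝓘(ℝ, E) F V) (v : TotalSpace F V) :
    AffineJetDual E v ≃
      ((TangentSpace 𝓘(ℝ, E) v.proj →L[ℝ] V v.proj) →L[ℝ] VolForm E v.proj) ×
        VolForm E v.proj where
  toFun f := (homToCLM (F := F) (V := V) v.proj (f.linear ∘ₗ (jetTranslation (E := E) v).toLinearMap),
    f (connectionJet Γ v))
  invFun p :=
    { toFun := fun A => p.1 ((jetTranslation (E := E) v).symm (A -ᵥ connectionJet Γ v)) + p.2
      linear := p.1.toLinearMap ∘ₗ (jetTranslation (E := E) v).symm.toLinearMap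
      map_vadd' := fun A B => by
        rw [vadd_vsub_assoc, map_add, map_add]
        exact add_assoc _ _ _ }
  left_inv f := by
    refine AffineMap.ext fun A => ?_
    change f.linear ((jetTranslation (E := E) v) ((jetTranslation (E := E) v).symm
      (A -ᵥ connectionJet Γ v))) + f (connectionJet Γ v) = f A
    rw [LinearEquiv.apply_symm_apply, AffineMap.linearMap_vsub]
    exact sub_add_cancel _ _
  right_inv p := by
    refine Prod.ext ?_ ?_
    · ext J : 1
      change p.1 ((jetTranslation (E := E) v).symm ((jetTranslation (E := E) v) J)) = p.1 J
      rw [LinearEquiv.symm_apply_apply]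
    · change p.1 ((jetTranslation (E := E) v).symm
        (connectionJet Γ v -ᵥ connectionJet Γ v)) + p.2 = p.2
      rw [vsub_self, map_zero, map_zero, zero_add]

/-- The identification of the affine dual with the split bundle provided by `Γ`. -/
def splitEquiv (Γ : CovariantDerivative 𝓘(ℝ, E) F V) (x : M) :
    AffineDual E F V x ≃ SplitDual E V x :=
  (Equiv.sigmaCongrRight fun v : V x => splitAt Γ (⟨x, v⟩ : TotalSpace F V)).trans
    (Equiv.sigmaEquivProd (V x)
      (((TangentSpace 𝓘(ℝ, E) x →L[ℝ] V x) →L[ℝ] VolForm E x) × VolForm E x))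

/-- The fibres of the phase space `P = (J¹V)*` over `M`: the affine dual of the jet bundle, with
the vector bundle structure over `M` for which the splitting by `Γ` is an isomorphism. -/
def PhaseFibre (Γ : CovariantDerivative 𝓘(ℝ, E) F V) : M → Type _ :=
  Transported (splitEquiv Γ)

variable (Γ : CovariantDerivative 𝓘(ℝ, E) F V)

instance (x : M) : AddCommGroup (PhaseFibre Γ x) :=
  inferInstanceAs (AddCommGroup (Transported (splitEquiv Γ) x))

instance (x : M) : Module ℝ (PhaseFibre Γ x) :=
  inferInstanceAs (Module ℝ (Transported (splitEquiv Γ) x))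

instance (x : M) : TopologicalSpace (PhaseFibre Γ x) :=
  inferInstanceAs (TopologicalSpace (Transported (splitEquiv Γ) x))

instance (x : M) : IsTopologicalAddGroup (PhaseFibre Γ x) :=
  inferInstanceAs (IsTopologicalAddGroup (Transported (splitEquiv Γ) x))

instance (x : M) : ContinuousSMul ℝ (PhaseFibre Γ x) :=
  inferInstanceAs (ContinuousSMul ℝ (Transported (splitEquiv Γ) x))

instance : TopologicalSpace (TotalSpace (SplitModel E F) (PhaseFibre Γ)) :=
  inferInstanceAs (TopologicalSpace (TotalSpace (SplitModel E F) (Transported (splitEquiv Γ))))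

instance : FiberBundle (SplitModel E F) (PhaseFibre Γ) :=
  inferInstanceAs (FiberBundle (SplitModel E F) (Transported (splitEquiv Γ)))

instance : VectorBundle ℝ (SplitModel E F) (PhaseFibre Γ) :=
  inferInstanceAs (VectorBundle ℝ (SplitModel E F) (Transported (splitEquiv Γ)))

instance : ContMDiffVectorBundle ∞ (SplitModel E F) (PhaseFibre Γ) 𝓘(ℝ, E) :=
  inferInstanceAs (ContMDiffVectorBundle ∞ (SplitModel E F) (Transported (splitEquiv Γ)) 𝓘(ℝ, E))

/-- The phase space, as a manifold: the total space of the bundle `PhaseFibre Γ` over `M`. -/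
abbrev Phase : Type _ := TotalSpace (SplitModel E F) (PhaseFibre Γ)

/-- The splitting of `P_x` into `V_x`, the linear part and the constant part, as a continuous
linear isomorphism. -/
def phaseSplit (x : M) : PhaseFibre Γ x ≃L[ℝ] SplitDual E V x :=
  Transported.equivL (splitEquiv Γ) x

end PhaseSpace

section Connections

variable {E : Type*} [NormedAddCommGroup E] [NormedSpace ℝ E]
  {H : Type*} [TopologicalSpace H] {I : ModelWithCorners ℝ E H}
  {M : Type*} [TopologicalSpace M] [ChartedSpace H M] [IsManifold I 1 M]
  {F : Type*} [NormedAddCommGroup F] [NormedSpace ℝ F]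
  {V : M → Type*} [TopologicalSpace (TotalSpace F V)] [∀ x, AddCommGroup (V x)]
  [∀ x, Module ℝ (V x)] [∀ x, TopologicalSpace (V x)] [∀ x, IsTopologicalAddGroup (V x)]
  [∀ x, ContinuousSMul ℝ (V x)] [FiberBundle F V]
  {F' : Type*} [NormedAddCommGroup F'] [NormedSpace ℝ F']
  {V' : M → Type*} [TopologicalSpace (TotalSpace F' V')] [∀ x, AddCommGroup (V' x)]
  [∀ x, Module ℝ (V' x)] [∀ x, TopologicalSpace (V' x)] [∀ x, IsTopologicalAddGroup (V' x)]
  [∀ x, ContinuousSMul ℝ (V' x)] [FiberBundle F' V']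

/-- The curvature `R(u, w) s = ∇_u ∇_Y s - ∇_w ∇_X s - ∇_[X, Y] s` at `x`, where `X`, `Y` and the
section `s` are extensions of `u`, `w ∈ T_x M` and of `s₀ ∈ V_x`. -/
def curvature (cov : CovariantDerivative I F V) (x : M) (u w : TangentSpace I x) (s₀ : V x) :
    V x :=
  let X : ∀ y, TangentSpace I y := FiberBundle.extend E u
  let Y : ∀ y, TangentSpace I y := FiberBundle.extend E w
  let s : ∀ y, V y := FiberBundle.extend F s₀
  cov (fun y => cov s y (Y y)) x u - cov (fun y => cov s y (X y)) x w
    - cov s x (VectorField.mlieBracket I X Y x)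

/-- `covH` is the connection on `Hom(V, V')` induced by connections on `V` and `V'`:
`(∇_u φ)(s) = ∇_u (φ(s)) - φ(∇_u s)`. -/
def IsHomConnection [VectorBundle ℝ F V] [VectorBundle ℝ F' V']
    (cov : CovariantDerivative I F V) (cov' : CovariantDerivative I F' V')
    (covH : CovariantDerivative I (F →L[ℝ] F') (fun x => V x →L[ℝ] V' x)) : Prop :=
  ∀ (φ : ∀ x, V x →L[ℝ] V' x) (s : ∀ x, V x) (x : M),
    MDifferentiableAt I (I.prod 𝓘(ℝ, F →L[ℝ] F'))
      (fun y => (⟨y, φ y⟩ : TotalSpace (F →L[ℝ] F') (fun x => V x →L[ℝ] V' x))) x →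
    MDifferentiableAt I (I.prod 𝓘(ℝ, F)) (fun y => (⟨y, s y⟩ : TotalSpace F V)) x →
    ∀ u : TangentSpace I x,
      covH φ x u (s x) = cov' (fun y => φ y (s y)) x u - φ x (cov s x u)

/-- The fibre `Λˡ T*_x M`. -/
abbrev Forms (I : ModelWithCorners ℝ E H) (l : ℕ) (x : M) : Type _ :=
  TangentSpace I x [⋀^Fin l]→L[ℝ] Trivial M ℝ x

/-- `covF` is the connection on `Λˡ T*M` induced by a connection `∇` on `TM`:
`(∇_u α)(Y₁, …, Y_l) = u(α(Y₁, …, Y_l)) - ∑ i, α(Y₁, …, ∇_u Y_i, …, Y_l)`. -/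
def IsFormConnection (l : ℕ)
    (cov : CovariantDerivative I E (TangentSpace I : M → Type _))
    (covF : CovariantDerivative I (E [⋀^Fin l]→L[ℝ] ℝ) (fun x : M => Forms I l x)) : Prop :=
  ∀ (α : ∀ x : M, Forms I l x) (Y : Fin l → ∀ x : M, TangentSpace I x) (x : M),
    MDifferentiableAt I (I.prod 𝓘(ℝ, E [⋀^Fin l]→L[ℝ] ℝ))
      (fun y => (⟨y, α y⟩ : TotalSpace (E [⋀^Fin l]→L[ℝ] ℝ) (fun x : M => Forms I l x))) x →
    (∀ i, MDifferentiableAt I (I.prod 𝓘(ℝ, E))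
      (fun y => (⟨y, Y i y⟩ : TotalSpace E (TangentSpace I : M → Type _))) x) →
    ∀ u : TangentSpace I x,
      (show ℝ from covF α x u fun i => Y i x) =
        mvfderiv I (fun y => (show ℝ from α y fun i => Y i y)) x u -
          ∑ i, (show ℝ from α x (Function.update (fun j => Y j x) i (cov (Y i) x u)))

/-- The wedge product `θ ∧ β` of a one-form and an `l`-form:
`(θ ∧ β)(y₀, …, y_l) = ∑ j, (-1)ʲ θ(y_j) β(y₀, …, ŷ_j, …, y_l)`. -/
def wedgeOne {l : ℕ} {x : M} (θ : TangentSpace I x →ₗ[ℝ] ℝ) (β : Forms I l x)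
    (y : Fin (l + 1) → TangentSpace I x) : ℝ :=
  ∑ j : Fin (l + 1), (-1) ^ (j : ℕ) * θ (y j) * (show ℝ from β (j.removeNth y))

/-- The smooth `l`-forms on a manifold. -/
abbrev SmoothForms (I : ModelWithCorners ℝ E H) (M : Type*) [TopologicalSpace M]
    [ChartedSpace H M] [IsManifold I 1 M] (l : ℕ) : Type _ :=
  ContMDiffSection I (E [⋀^Fin l]→L[ℝ] ℝ) ∞ (fun x : M => Forms I l x)

end Connections

section Lifted

variable {E : Type*} [NormedAddCommGroup E] [NormedSpace ℝ E] [FiniteDimensional ℝ E]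
  {M : Type*} [TopologicalSpace M] [ChartedSpace E M] [IsManifold 𝓘(ℝ, E) ∞ M]
  {F : Type*} [NormedAddCommGroup F] [NormedSpace ℝ F] [FiniteDimensional ℝ F]
  {V : M → Type*} [TopologicalSpace (TotalSpace F V)] [∀ x, AddCommGroup (V x)]
  [∀ x, Module ℝ (V x)] [∀ x, TopologicalSpace (V x)] [∀ x, IsTopologicalAddGroup (V x)]
  [∀ x, ContinuousSMul ℝ (V x)] [FiberBundle F V] [VectorBundle ℝ F V]
  [ContMDiffVectorBundle ∞ F V 𝓘(ℝ, E)]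

/-- `P → M` is locally trivial with fibre `SplitModel E F`, so `P` is modelled on this space. -/
abbrev phaseModel (E F : Type*) [NormedAddCommGroup E] [NormedSpace ℝ E]
    [NormedAddCommGroup F] [NormedSpace ℝ F] :
    ModelWithCorners ℝ (E × SplitModel E F) (ModelProd E (SplitModel E F)) :=
  𝓘(ℝ, E).prod 𝓘(ℝ, SplitModel E F)

variable (Γ : CovariantDerivative 𝓘(ℝ, E) F V)
  (Λ : CovariantDerivative 𝓘(ℝ, E) E (TangentSpace 𝓘(ℝ, E) : M → Type _))

/-- `covP` is the connection on `P → M` induced by `Γ` and `Λ`: in the splitting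
`P ≅ V ⊕ Hom(Hom(TM, V), Λⁿ T*M) ⊕ Λⁿ T*M` it is the direct sum of `Γ` and of the connections
that `Γ` and `Λ` induce on the other two summands. -/
def IsPhaseConnection
    (covP : CovariantDerivative 𝓘(ℝ, E) (SplitModel E F) (PhaseFibre Γ)) : Prop :=
  ∃ (covJ : CovariantDerivative 𝓘(ℝ, E) (E →L[ℝ] F)
      (fun x : M => TangentSpace 𝓘(ℝ, E) x →L[ℝ] V x))
    (covL : CovariantDerivative 𝓘(ℝ, E) (E [⋀^Fin (Module.finrank ℝ E)]→L[ℝ] ℝ)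
      (fun x : M => Forms 𝓘(ℝ, E) (Module.finrank ℝ E) x))
    (covQ : CovariantDerivative 𝓘(ℝ, E)
      ((E →L[ℝ] F) →L[ℝ] (E [⋀^Fin (Module.finrank ℝ E)]→L[ℝ] ℝ))
      (fun x : M => (TangentSpace 𝓘(ℝ, E) x →L[ℝ] V x) →L[ℝ] VolForm E x)),
    IsHomConnection Λ Γ covJ ∧ IsFormConnection (Module.finrank ℝ E) Λ covL ∧
    IsHomConnection covJ covL covQ ∧
    ∀ (σ : ∀ x : M, PhaseFibre Γ x) (x : M),
      MDifferentiableAt 𝓘(ℝ, E) (phaseModel E F) (fun y => (⟨y, σ y⟩ : Phase Γ)) x →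
      ∀ u : TangentSpace 𝓘(ℝ, E) x,
        (phaseSplit Γ x (covP σ x u)).1 = Γ (fun y => (phaseSplit Γ y (σ y)).1) x u ∧
        (phaseSplit Γ x (covP σ x u)).2.1 = covQ (fun y => (phaseSplit Γ y (σ y)).2.1) x u ∧
        (phaseSplit Γ x (covP σ x u)).2.2 = covL (fun y => (phaseSplit Γ y (σ y)).2.2) x u

variable (covP : CovariantDerivative 𝓘(ℝ, E) (SplitModel E F) (PhaseFibre Γ))

/-- The connection map `K : T_p P → P_x`, `x = π(p)`: it vanishes on horizontal vectors and
inverts the vertical lift. -/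
def connectionMap (p : Phase Γ) : TangentSpace (phaseModel E F) p →L[ℝ] PhaseFibre Γ p.proj :=
  vertInv p ∘L (ContinuousLinearMap.id ℝ _ - horLift covP p ∘L projTangent p)

/-- `D` is the lift to `TP` of the connections `Λ` on `M` and `covP` on `P → M`: for vector fields
`X`, `Y` on `M` and sections `β`, `γ` of `P → M`, with horizontal lifts `X^h`, `Y^h` and vertical
lifts `β^v`, `γ^v`, at the point `p`
`D_{X^h} Y^h = (Λ_X Y)^h - ½ (R(X, Y) p)^v`, `D_{X^h} β^v = (∇_X β)^v`,
`D_{β^v} Y^h = 0`, `D_{γ^v} β^v = 0`, where `R` is the curvature of `∇ = covP`. -/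
def IsLiftedConnection
    (D : CovariantDerivative (phaseModel E F) (E × SplitModel E F)
      (TangentSpace (phaseModel E F) : Phase Γ → Type _)) : Prop :=
  (∀ (Y : ∀ x : M, TangentSpace 𝓘(ℝ, E) x) (p : Phase Γ),
    MDifferentiableAt 𝓘(ℝ, E) (𝓘(ℝ, E).prod 𝓘(ℝ, E))
      (fun y => (⟨y, Y y⟩ : TotalSpace E (TangentSpace 𝓘(ℝ, E) : M → Type _))) p.proj →
    (∀ u : TangentSpace 𝓘(ℝ, E) p.proj,
      D (fun q : Phase Γ => horLift covP q (Y q.proj)) p (horLift covP p u) =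
        horLift covP p (Λ Y p.proj u) -
          (1 / 2 : ℝ) • vertLift p (curvature covP p.proj u (Y p.proj) p.2)) ∧
    ∀ b : PhaseFibre Γ p.proj,
      D (fun q : Phase Γ => horLift covP q (Y q.proj)) p (vertLift p b) = 0) ∧
  ∀ (β : ∀ x : M, PhaseFibre Γ x) (p : Phase Γ),
    MDifferentiableAt 𝓘(ℝ, E) (phaseModel E F) (fun y => (⟨y, β y⟩ : Phase Γ)) p.proj →
    (∀ u : TangentSpace 𝓘(ℝ, E) p.proj,
      D (fun q : Phase Γ => vertLift q (β q.proj)) p (horLift covP p u) =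
        vertLift p (covP β p.proj u)) ∧
    ∀ b : PhaseFibre Γ p.proj,
      D (fun q : Phase Γ => vertLift q (β q.proj)) p (vertLift p b) = 0

/-- `D` is flat along the fibres of `P → M`: its curvature `R(ξ, η)` vanishes for vertical
`ξ`, `η`. -/
def IsFlatAlongFibres
    (D : CovariantDerivative (phaseModel E F) (E × SplitModel E F)
      (TangentSpace (phaseModel E F) : Phase Γ → Type _)) : Prop :=
  ∀ (p : Phase Γ) (ξ η ζ : TangentSpace (phaseModel E F) p),
    projTangent p ξ = 0 → projTangent p η = 0 → curvature D p ξ η ζ = 0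

/-- The fibres of `V ⊕ Hom(Hom(TM, V), Λⁿ T*M)`. -/
def VQFibre (E : Type*) [NormedAddCommGroup E] [NormedSpace ℝ E]
    {M : Type*} [TopologicalSpace M] [ChartedSpace E M]
    (V : M → Type*) [∀ x, AddCommGroup (V x)]
    [∀ x, Module ℝ (V x)] [∀ x, TopologicalSpace (V x)] [∀ x, IsTopologicalAddGroup (V x)]
    [∀ x, ContinuousSMul ℝ (V x)] (x : M) : Type _ :=
  V x × ((TangentSpace 𝓘(ℝ, E) x →L[ℝ] V x) →L[ℝ] VolForm E x)

instance (x : M) : AddCommGroup (VQFibre E V x) :=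
  inferInstanceAs (AddCommGroup (V x × ((TangentSpace 𝓘(ℝ, E) x →L[ℝ] V x) →L[ℝ] VolForm E x)))

instance (x : M) : Module ℝ (VQFibre E V x) :=
  inferInstanceAs (Module ℝ (V x × ((TangentSpace 𝓘(ℝ, E) x →L[ℝ] V x) →L[ℝ] VolForm E x)))

/-- The inclusion `(v, q) ↦ (v, q, 0)` of `V_x ⊕ Hom(Hom(T_x M, V_x), Λⁿ T*_x M)` into `P_x`. -/
def vqInclusion (x : M) : VQFibre E V x →ₗ[ℝ] PhaseFibre Γ x where
  toFun w := (phaseSplit Γ x).symm (show SplitDual E V x from (w.1, w.2, 0))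
  map_add' w w' := by
    refine Eq.trans (congrArg _ ?_) (map_add (phaseSplit Γ x).symm
      (show SplitDual E V x from (w.1, w.2, 0)) (show SplitDual E V x from (w'.1, w'.2, 0)))
    exact Prod.ext rfl (Prod.ext rfl (add_zero 0).symm)
  map_smul' c w := by
    refine Eq.trans (congrArg _ ?_) (map_smul (phaseSplit Γ x).symm c
      (show SplitDual E V x from (w.1, w.2, 0)))
    exact Prod.ext rfl (Prod.ext rfl (smul_zero c).symm)

/-- The projection `(v, q, c) ↦ (v, q)` of `P_x` onto `V_x ⊕ Hom(Hom(T_x M, V_x), Λⁿ T*_x M)`. -/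
def vqProjection (x : M) : PhaseFibre Γ x →ₗ[ℝ] VQFibre E V x where
  toFun p := ((phaseSplit Γ x p).1, (phaseSplit Γ x p).2.1)
  map_add' p p' := by rw [map_add]; rfl
  map_smul' c p := by rw [map_smul]; rfl

/-- `d = e^{*M} ∧ D*_{e_M}`, summed over `M`. Here `W_x` is a summand of `P_x`, given with its
inclusion and projection; `f` is any basis of `W_x`, `e_M` is the vertical lift of `f_M` to `T_p P`,
and `e^{*M}` is the one-form on `T_p P` that is dual to `e_M`, that is, the composition of `K`, the
projection `P_x → W_x` and the coordinate function of `f_M`. -/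
def IsVerticalDerivative {W : M → Type*} [∀ x, AddCommGroup (W x)] [∀ x, Module ℝ (W x)]
    (inc : ∀ x, W x →ₗ[ℝ] PhaseFibre Γ x) (pr : ∀ x, PhaseFibre Γ x →ₗ[ℝ] W x)
    (Dst : ∀ l : ℕ, CovariantDerivative (phaseModel E F)
      ((E × SplitModel E F) [⋀^Fin l]→L[ℝ] ℝ) (fun p : Phase Γ => Forms (phaseModel E F) l p))
    (d : ∀ l : ℕ, SmoothForms (phaseModel E F) (Phase Γ) l →ₗ[ℝ]
      SmoothForms (phaseModel E F) (Phase Γ) (l + 1)) : Prop :=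
  ∀ (l : ℕ) (α : SmoothForms (phaseModel E F) (Phase Γ) l) (p : Phase Γ)
    (ι : Type) [Fintype ι] (f : Module.Basis ι ℝ (W p.proj))
    (y : Fin (l + 1) → TangentSpace (phaseModel E F) p),
    (show ℝ from d l α p y) =
      ∑ m, wedgeOne (f.coord m ∘ₗ pr p.proj ∘ₗ (connectionMap Γ covP p).toLinearMap)
        (Dst l (fun q => α q) p (vertLift p (inc p.proj (f m)))) y

end Lifted

end PhaseSpace

end

open PhaseSpace

/-! Only the construction of the connection on `P` is special to the phase space. Up to the
splitting its bundle is a direct sum, so the connection is built and determined summand by summand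
(`exists_isPhaseConnection`, `IsPhaseConnection.eq_of_mdifferentiableAt`). Everything after that is
proved for an arbitrary smooth vector bundle `V → M` with a smooth connection `cov`, and then
applied to `P`.

Horizontal and vertical lifts split the tangent bundle of the total space as `π*TM ⊕ π*V`. The
lifted connection is the direct sum of the pullbacks of `Λ` and `cov`, corrected by the tensor `-½
(R(π_*ξ, π_*Z) p)^v`; this gives existence (`isLift_liftedConnection`). Conversely, the prescribed
values on lifts determine `D` on a local frame, and these values are smooth because the curvature is
a smooth tensor, so every such `D` is smooth (`IsLift.locSmooth`).

The key observation is `IsLift.apply_liftField_of_vertical`: the lifted fields `Y^h + β^v` are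
parallel in vertical directions, because every term of the defining formulas, the curvature term
included, sees only the projection of the direction to `TM`. They supply a frame that is parallel
along the fibres. Since brackets of vertical fields are vertical, the curvature of `D` on two
vertical vectors vanishes (`IsLift.curvature_eq_zero`). By duality, `D*` in a vertical direction is
the plain derivative of the coefficients of a form in this frame
(`IsFormConnection.apply_vertical`).

Restricted to the fibre over `x` and written in this frame, an `l`-form is therefore a smooth
function `φ` from the model fibre `F` to the alternating forms on the fixed space `E × F`
(`fibreForm`). The vertical derivative becomes `φ ↦ Alt(Dφ ∘ P)`, where `P : E × F → F` is the
vertical projection followed by the endomorphism `S = inc ∘ pr` of `V_x` (`fibreForm_vertDeriv`). As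
`P` does not depend on the point of the fibre, applying the operation twice alternates the symmetric
expression `D²φ(P·, P·)` and gives zero (`vertDeriv_vertDeriv`). The basis has disappeared: `∑ f_M ⊗
f^M` is the identity of the summand, so only `S` remains (`vertDeriv_eq_sum_wedgeOne`). The two
choices of vertical directions differ only in `S`.

The axioms of a covariant derivative say nothing about sections that are not differentiable, so
induced connections are unique on differentiable sections only. The vertical derivative depends on
the connection through its horizontal lifts alone (`vertDeriv_congr`), and these use differentiable
sections; hence one operator serves all phase connections. -/

noncomputable section
set_option linter.unusedSectionVars false
namespace PhaseSpace

/-! ### Smoothness of maps into finite-dimensional spaces, tested by linear maps. -/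

section Coordinates

variable {EM : Type*} [NormedAddCommGroup EM] [NormedSpace ℝ EM] {HM : Type*} [TopologicalSpace HM]
  {IM : ModelWithCorners ℝ EM HM} {N : Type*} [TopologicalSpace N] [ChartedSpace HM N]
  {W : Type*} [NormedAddCommGroup W] [NormedSpace ℝ W] [FiniteDimensional ℝ W]
  {G : Type*} [NormedAddCommGroup G] [NormedSpace ℝ G] [FiniteDimensional ℝ G]

/-- A family of linear maps without common kernel embeds `W` in a finite power of `G`. The embedding
splits, and finite dimension makes the splitting continuous, hence smooth. -/
theorem exists_leftInverse_pi {κ : Type*} [Fintype κ] (L : κ → W →ₗ[ℝ] G)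
    (hL : ∀ w, (∀ k, L k w = 0) → w = 0) :
    ∃ R : (κ → G) →L[ℝ] W, ∀ w, R (fun k => L k w) = w := by
  obtain ⟨R, hR⟩ := (LinearMap.pi L).exists_leftInverse_of_injective
    (LinearMap.ker_eq_bot'.2 fun w hw => hL w fun k => congrFun hw k)
  exact ⟨LinearMap.toContinuousLinearMap R, fun w => LinearMap.congr_fun hR w⟩

/-- `f` is recovered from its components by the continuous left inverse, so no basis of `W` has to
be chosen. -/
theorem contMDiffAt_of_separating {κ : Type*} [Fintype κ] (L : κ → W →ₗ[ℝ] G)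
    (hL : ∀ w, (∀ k, L k w = 0) → w = 0) {n : ℕ∞ω} {f : N → W} {x : N}
    (hf : ∀ k, ContMDiffAt IM 𝓘(ℝ, G) n (fun y => L k (f y)) x) :
    ContMDiffAt IM 𝓘(ℝ, W) n f x := by
  obtain ⟨R, hR⟩ := exists_leftInverse_pi L hL
  have h1 : ContMDiffAt IM 𝓘(ℝ, κ → G) n (fun y k => L k (f y)) x := contMDiffAt_pi_space.2 hf
  have h2 := (R.contMDiff (n := n)).contMDiffAt.comp x h1
  refine h2.congr_of_eventuallyEq (Filter.Eventually.of_forall fun y => ?_)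
  exact (hR (f y)).symm

theorem contMDiffAt_clm_of_apply {n : ℕ∞ω} {f : N → W →L[ℝ] G} {x : N}
    (hf : ∀ w, ContMDiffAt IM 𝓘(ℝ, G) n (fun y => f y w) x) :
    ContMDiffAt IM 𝓘(ℝ, W →L[ℝ] G) n f x := by
  let b := Module.finBasis ℝ W
  refine contMDiffAt_of_separating (fun k => (ContinuousLinearMap.apply ℝ G (b k)).toLinearMap)
    (fun w hw => ?_) fun k => hf (b k)
  exact ContinuousLinearMap.coe_injective (b.ext hw)

/-- An alternating map is determined by its values on tuples of basis vectors. All tuples are used,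
with repetitions and in any order, so that no basis of the space of alternating maps is needed. -/
theorem contMDiffAt_alternating_of_apply {l : ℕ} {n : ℕ∞ω} {f : N → W [⋀^Fin l]→L[ℝ] G} {x : N}
    (hf : ∀ w, ContMDiffAt IM 𝓘(ℝ, G) n (fun y => f y w) x) :
    ContMDiffAt IM 𝓘(ℝ, W [⋀^Fin l]→L[ℝ] G) n f x := by
  let b := Module.finBasis ℝ W
  refine contMDiffAt_of_separating
    (κ := Fin l → Fin (Module.finrank ℝ W))
    (fun k => { toFun := fun w => w (fun i => b (k i))
                map_add' := fun _ _ => rfl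
                map_smul' := fun _ _ => rfl })
    (fun w hw => ?_) fun k => hf _
  ext v
  have := Module.Basis.ext_multilinear (f := w.toMultilinearMap) (g := 0) (fun _ => b)
    (fun k => hw k)
  exact congrArg (fun q : MultilinearMap ℝ (fun _ : Fin l => W) G => q v) this

end Coordinates

/-! ### Locally constant sections, coordinates and germs of smooth sections. -/

section Sections

variable {EB HB B : Type*} [NormedAddCommGroup EB] [NormedSpace ℝ EB] [TopologicalSpace HB]
  {IB : ModelWithCorners ℝ EB HB} [TopologicalSpace B] [ChartedSpace HB B]
  {F : Type*} [NormedAddCommGroup F] [NormedSpace ℝ F] [FiniteDimensional ℝ F]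
  {V : B → Type*} [TopologicalSpace (TotalSpace F V)] [∀ x, AddCommGroup (V x)]
  [∀ x, Module ℝ (V x)] [∀ x, TopologicalSpace (V x)]
  [FiberBundle F V] [VectorBundle ℝ F V]
  {F' : Type*} [NormedAddCommGroup F'] [NormedSpace ℝ F'] [FiniteDimensional ℝ F']
  {V' : B → Type*} [TopologicalSpace (TotalSpace F' V')] [∀ x, AddCommGroup (V' x)]
  [∀ x, Module ℝ (V' x)] [∀ x, TopologicalSpace (V' x)] [∀ x, IsTopologicalAddGroup (V' x)]
  [∀ x, ContinuousSMul ℝ (V' x)] [FiberBundle F' V'] [VectorBundle ℝ F' V']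

/-- The section that is constant, with value `b`, in the trivialization `e`. -/
def constSec (e : Trivialization F (π F V)) [e.IsLinear ℝ] (b : F) : ∀ y, V y :=
  fun y => e.symmL ℝ y b

theorem coord_eq (e : Trivialization F (π F V)) [e.IsLinear ℝ] {y : B}
    (hy : y ∈ e.baseSet) (v : V y) : (e ⟨y, v⟩).2 = e.continuousLinearMapAt ℝ y v := by
  rw [e.continuousLinearMapAt_apply ℝ, e.coe_linearMapAt_of_mem hy]

theorem constSec_coord {e : Trivialization F (π F V)} [e.IsLinear ℝ] {y : B} (hy : y ∈ e.baseSet)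
    (b : F) : (e ⟨y, constSec e b y⟩).2 = b := by
  rw [coord_eq e hy]
  exact e.continuousLinearMapAt_symmL hy b

theorem constSec_of_coord {e : Trivialization F (π F V)} [e.IsLinear ℝ] {y : B}
    (hy : y ∈ e.baseSet) (v : V y) : constSec e (e ⟨y, v⟩).2 y = v := by
  rw [coord_eq e hy]
  exact e.symmL_continuousLinearMapAt hy v

theorem constSec_add (e : Trivialization F (π F V)) [e.IsLinear ℝ] (b b' : F) :
    constSec e (b + b') = constSec e b + constSec e b' :=
  funext fun y => map_add (e.symmL ℝ y) b b'

theorem constSec_smul (e : Trivialization F (π F V)) [e.IsLinear ℝ] (c : ℝ) (b : F) :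
    constSec e (c • b) = c • constSec e b :=
  funext fun y => map_smul (e.symmL ℝ y) c b

variable (F) in
/-- The extension of `v ∈ V_x` to a section that is constant in the trivialization at `x`, linear
in `v`. -/
def constExt {x : B} (v : V x) : ∀ y, V y :=
  constSec (trivializationAt F V x) ((trivializationAt F V x).continuousLinearMapAt ℝ x v)

theorem constExt_self {x : B} (v : V x) : constExt F v x = v :=
  (trivializationAt F V x).symmL_continuousLinearMapAt
    (FiberBundle.mem_baseSet_trivializationAt F V x) v

theorem constExt_add {x : B} (v w : V x) :
    constExt F (v + w) = constExt F v + constExt F w := by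
  simp only [constExt, map_add, constSec_add]

theorem constExt_smul {x : B} (c : ℝ) (v : V x) : constExt F (c • v) = c • constExt F v := by
  simp only [constExt, map_smul, constSec_smul]

/-- The definition of curvature extends vectors by `FiberBundle.extend`; this comparison supplies
the smoothness of those extensions near `x`. -/
theorem extend_eq_constExt {x : B} (v : V x) :
    ∀ᶠ y in 𝓝 x, FiberBundle.extend F v y = constExt F v y := by
  have hx := FiberBundle.mem_baseSet_trivializationAt F V x
  filter_upwards [(trivializationAt F V x).open_baseSet.mem_nhds hx] with y hy
  rw [constExt, ← coord_eq _ hx]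
  exact ((trivializationAt F V x).symmL_apply hy _).symm

/-- The coordinates of the section `σ` in the trivialization `e`. -/
def secCoord (e : Trivialization F (π F V)) [e.IsLinear ℝ] (σ : ∀ y, V y) : B → F :=
  fun y => e.continuousLinearMapAt ℝ y (σ y)

theorem secCoord_add (e : Trivialization F (π F V)) [e.IsLinear ℝ] (σ τ : ∀ y, V y) :
    secCoord e (σ + τ) = secCoord e σ + secCoord e τ :=
  funext fun y => map_add (e.continuousLinearMapAt ℝ y) _ _

theorem secCoord_smul (e : Trivialization F (π F V)) [e.IsLinear ℝ] (f : B → ℝ) (σ : ∀ y, V y) :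
    secCoord e (f • σ) = f • secCoord e σ :=
  funext fun y => map_smul (e.continuousLinearMapAt ℝ y) _ _

theorem secCoord_eventuallyEq (e : Trivialization F (π F V)) [e.IsLinear ℝ] (σ : ∀ y, V y) {y : B}
    (hy : y ∈ e.baseSet) : secCoord e σ =ᶠ[𝓝 y] fun z => (e ⟨z, σ z⟩).2 := by
  filter_upwards [e.open_baseSet.mem_nhds hy] with z hz
  exact (coord_eq e hz _).symm

theorem secCoord_constSec (e : Trivialization F (π F V)) [e.IsLinear ℝ] (b : F) {y : B}
    (hy : y ∈ e.baseSet) : secCoord e (constSec e b) =ᶠ[𝓝 y] fun _ => b := by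
  filter_upwards [e.open_baseSet.mem_nhds hy] with z hz
  exact e.continuousLinearMapAt_symmL hz b

theorem contMDiffAt_secCoord_iff {n : ℕ∞ω} [ContMDiffVectorBundle n F V IB]
    (e : Trivialization F (π F V)) [MemTrivializationAtlas e] {σ : ∀ y, V y} {y : B}
    (hy : y ∈ e.baseSet) : ContMDiffAt IB 𝓘(ℝ, F) n (secCoord e σ) y ↔
      ContMDiffAt IB (IB.prod 𝓘(ℝ, F)) n (fun z => (⟨z, σ z⟩ : TotalSpace F V)) y := by
  refine Iff.trans ?_ (e.contMDiffAt_section_iff hy).symm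
  exact ⟨fun h => h.congr_of_eventuallyEq (secCoord_eventuallyEq e σ hy).symm,
    fun h => h.congr_of_eventuallyEq (secCoord_eventuallyEq e σ hy)⟩

theorem mdifferentiableAt_secCoord_iff [ContMDiffVectorBundle 1 F V IB]
    (e : Trivialization F (π F V)) [MemTrivializationAtlas e] {σ : ∀ y, V y} {y : B}
    (hy : y ∈ e.baseSet) : MDifferentiableAt IB 𝓘(ℝ, F) (secCoord e σ) y ↔
      MDifferentiableAt IB (IB.prod 𝓘(ℝ, F)) (fun z => (⟨z, σ z⟩ : TotalSpace F V)) y := by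
  refine Iff.trans ?_ (e.mdifferentiableAt_section_iff IB σ hy).symm
  exact ⟨fun h => h.congr_of_eventuallyEq (secCoord_eventuallyEq e σ hy).symm,
    fun h => h.congr_of_eventuallyEq (secCoord_eventuallyEq e σ hy)⟩

variable (IB) in
/-- The section `σ` is smooth in a neighbourhood of `x`. -/
def SmoothNear (σ : ∀ y, V y) (x : B) : Prop :=
  ∀ᶠ y in 𝓝 x, ContMDiffAt IB (IB.prod 𝓘(ℝ, F)) ∞ (fun z => (⟨z, σ z⟩ : TotalSpace F V)) y

theorem SmoothNear.contMDiffAt {σ : ∀ y, V y} {x : B} (h : SmoothNear (F := F) IB σ x) :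
    ContMDiffAt IB (IB.prod 𝓘(ℝ, F)) ∞ (fun z => (⟨z, σ z⟩ : TotalSpace F V)) x :=
  h.self_of_nhds

theorem SmoothNear.mdifferentiableAt {σ : ∀ y, V y} {x : B} (h : SmoothNear (F := F) IB σ x) :
    MDifferentiableAt IB (IB.prod 𝓘(ℝ, F)) (fun z => (⟨z, σ z⟩ : TotalSpace F V)) x :=
  h.contMDiffAt.mdifferentiableAt (by simp)

/-- The reason for quantifying over nearby points in `SmoothNear`: smoothness of order `∞` at a
single point provides a separate neighbourhood for each finite order and does not spread to nearby
points, while iterated covariant derivatives need it there. -/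
theorem SmoothNear.eventually {σ : ∀ y, V y} {x : B} (h : SmoothNear (F := F) IB σ x) :
    ∀ᶠ y in 𝓝 x, SmoothNear (F := F) IB σ y :=
  eventually_eventually_nhds.2 h

theorem _root_.ContMDiff.smoothNear {σ : ∀ y, V y}
    (h : ContMDiff IB (IB.prod 𝓘(ℝ, F)) ∞ (fun z => (⟨z, σ z⟩ : TotalSpace F V))) (x : B) :
    SmoothNear (F := F) IB σ x :=
  Filter.Eventually.of_forall fun y => h y

theorem SmoothNear.congr {σ τ : ∀ y, V y} {x : B} (h : SmoothNear (F := F) IB σ x)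
    (hst : ∀ᶠ y in 𝓝 x, τ y = σ y) : SmoothNear (F := F) IB τ x := by
  filter_upwards [h, eventually_eventually_nhds.2 hst] with y h1 h2
  refine h1.congr_of_eventuallyEq ?_
  filter_upwards [h2] with z hz
  rw [hz]

theorem contMDiffAt_constSec {n : ℕ∞ω} [ContMDiffVectorBundle n F V IB]
    (e : Trivialization F (π F V)) [MemTrivializationAtlas e] (b : F) {y : B} (hy : y ∈ e.baseSet) :
    ContMDiffAt IB (IB.prod 𝓘(ℝ, F)) n (fun z => (⟨z, constSec e b z⟩ : TotalSpace F V)) y := by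
  refine (e.contMDiffAt_section_iff (s := constSec e b) hy).2 ?_
  have : ContMDiffAt IB 𝓘(ℝ, F) n (fun _ : B => b) y := contMDiffAt_const
  refine this.congr_of_eventuallyEq ?_
  filter_upwards [e.open_baseSet.mem_nhds hy] with z hz
  exact constSec_coord hz b

theorem smoothNear_constSec [ContMDiffVectorBundle ∞ F V IB]
    (e : Trivialization F (π F V)) [MemTrivializationAtlas e] (b : F) {y : B} (hy : y ∈ e.baseSet) :
    SmoothNear (F := F) IB (constSec e b) y := by
  filter_upwards [e.open_baseSet.mem_nhds hy] with z hz
  exact contMDiffAt_constSec e b hz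

theorem smoothNear_constExt [ContMDiffVectorBundle ∞ F V IB] {x : B} (v : V x) :
    SmoothNear (F := F) IB (constExt F v) x :=
  smoothNear_constSec _ _ (FiberBundle.mem_baseSet_trivializationAt F V x)

theorem smoothNear_extend [ContMDiffVectorBundle ∞ F V IB] {x : B} (v : V x) :
    SmoothNear (F := F) IB (FiberBundle.extend F v) x :=
  (smoothNear_constExt v).congr (extend_eq_constExt v)

/-- A section of `Hom(V, V')` is smooth if it maps sections that are constant in a trivialization
to smooth sections. -/
theorem contMDiffAt_hom_of_constSec {n : ℕ∞ω} [ContMDiffVectorBundle n F' V' IB]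
    {A : ∀ y, V y →L[ℝ] V' y} {x : B}
    (h : ∀ b : F, ContMDiffAt IB (IB.prod 𝓘(ℝ, F')) n
      (fun z => (⟨z, A z (constSec (trivializationAt F V x) b z)⟩ : TotalSpace F' V')) x) :
    ContMDiffAt IB (IB.prod 𝓘(ℝ, F →L[ℝ] F')) n
      (fun z => (⟨z, A z⟩ : TotalSpace (F →L[ℝ] F') (fun x => V x →L[ℝ] V' x))) x := by
  rw [contMDiffAt_hom_bundle]
  refine ⟨contMDiffAt_id, contMDiffAt_clm_of_apply fun b => ?_⟩
  have h1 := (contMDiffAt_section (IB := IB) (n := n) x).1 (h b)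
  refine h1.congr_of_eventuallyEq ?_
  have hx := (trivializationAt F' V' x).open_baseSet.mem_nhds
    (FiberBundle.mem_baseSet_trivializationAt F' V' x)
  filter_upwards [hx] with z hz
  rw [coord_eq _ hz]
  rfl

/-- In the trivialization at `x`, evaluating on a fixed tuple of the model fibre is the same as
evaluating on constant sections. -/
theorem contMDiffAt_alternating_of_constSec {l : ℕ} {n : ℕ∞ω} [ContMDiffVectorBundle n F' V' IB]
    {A : ∀ y, V y [⋀^Fin l]→L[ℝ] V' y} {x : B}
    (h : ∀ b : Fin l → F, ContMDiffAt IB (IB.prod 𝓘(ℝ, F')) n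
      (fun z => (⟨z, A z (fun i => constSec (trivializationAt F V x) (b i) z)⟩ :
        TotalSpace F' V')) x) :
    ContMDiffAt IB (IB.prod 𝓘(ℝ, F [⋀^Fin l]→L[ℝ] F')) n
      (fun z => (⟨z, A z⟩ : TotalSpace (F [⋀^Fin l]→L[ℝ] F') (fun x => V x [⋀^Fin l]→L[ℝ] V' x)))
      x := by
  refine (contMDiffAt_section (s := A) (IB := IB) (n := n) x).2 ?_
  refine contMDiffAt_alternating_of_apply fun b => ?_
  have h1 := (contMDiffAt_section (IB := IB) (n := n) x).1 (h b)
  refine h1.congr_of_eventuallyEq ?_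
  have hx := (trivializationAt F' V' x).open_baseSet.mem_nhds
    (FiberBundle.mem_baseSet_trivializationAt F' V' x)
  filter_upwards [hx] with z hz
  rw [coord_eq _ hz]
  rfl

end Sections

/-! ### Derivatives of vector-valued functions along vector fields. -/

section Derivatives

variable {EB HB B : Type*} [NormedAddCommGroup EB] [NormedSpace ℝ EB] [TopologicalSpace HB]
  {IB : ModelWithCorners ℝ EB HB} [TopologicalSpace B] [ChartedSpace HB B]
  {G : Type*} [NormedAddCommGroup G] [NormedSpace ℝ G]

theorem mvfderiv_congr {f g : B → G} {x : B} (h : f =ᶠ[𝓝 x] g) :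
    mvfderiv IB f x = mvfderiv IB g x :=
  ContinuousLinearMap.ext fun u =>
    congrArg (fun A : TangentSpace IB x →L[ℝ] G => A u) (h.mfderiv_eq (I := IB) (I' := 𝓘(ℝ, G)))

theorem mvfderiv_clm_comp {G' : Type*} [NormedAddCommGroup G'] [NormedSpace ℝ G'] (L : G →L[ℝ] G')
    {f : B → G} {x : B} (hf : MDifferentiableAt IB 𝓘(ℝ, G) f x) (u : TangentSpace IB x) :
    mvfderiv IB (fun y => L (f y)) x u = L (mvfderiv IB f x u) := by
  have h := mfderiv_comp x (L.mdifferentiableAt (x := f x)) hf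
  rw [ContinuousLinearMap.mfderiv_eq] at h
  exact congrArg (fun A : TangentSpace IB x →L[ℝ] G' => A u) h

/-- Order `∞` absorbs the derivative that is lost. The differential applied to `X` is a smooth map
into the tangent bundle of the vector space `G`, which is then projected to `G`. -/
theorem contMDiffAt_mvfderiv_apply [IsManifold IB 1 B] {f : B → G} {x : B}
    {X : ∀ y, TangentSpace IB y} (hf : ContMDiffAt IB 𝓘(ℝ, G) ∞ f x)
    (hX : ContMDiffAt IB (IB.prod 𝓘(ℝ, EB)) ∞ (fun y => (⟨y, X y⟩ : TangentBundle IB B)) x) :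
    ContMDiffAt IB 𝓘(ℝ, G) ∞ (fun y => mvfderiv IB f y (X y)) x := by
  have h1 := hf.mfderiv_const (m := ∞) (by simp)
  have h2 := ContMDiffAt.clm_apply_of_inCoordinates (b₁ := id) (b₂ := f) (v := X)
    (E₂ := (TangentSpace 𝓘(ℝ, G) : G → Type _)) (ϕ := fun y => mfderiv IB 𝓘(ℝ, G) f y) h1 hX hf
  exact (contMDiff_snd_tangentBundle_modelSpace G 𝓘(ℝ, G)).contMDiffAt.comp x h2

end Derivatives

/-! ### Locality, coordinate formula and smoothness of a connection. -/

section Connection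

variable {EB HB B : Type*} [NormedAddCommGroup EB] [NormedSpace ℝ EB] [FiniteDimensional ℝ EB]
  [TopologicalSpace HB]
  {IB : ModelWithCorners ℝ EB HB} [TopologicalSpace B] [ChartedSpace HB B] [IsManifold IB 1 B]
  {F : Type*} [NormedAddCommGroup F] [NormedSpace ℝ F] [FiniteDimensional ℝ F]
  {V : B → Type*} [TopologicalSpace (TotalSpace F V)] [∀ x, AddCommGroup (V x)]
  [∀ x, Module ℝ (V x)] [∀ x, TopologicalSpace (V x)] [∀ x, IsTopologicalAddGroup (V x)]
  [∀ x, ContinuousSMul ℝ (V x)]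
  [FiberBundle F V] [VectorBundle ℝ F V]

theorem cov_sum (cov : CovariantDerivative IB F V) {ι : Type*} (t : Finset ι)
    {σ : ι → ∀ y, V y} {x : B}
    (hσ : ∀ i ∈ t, MDifferentiableAt IB (IB.prod 𝓘(ℝ, F)) (fun z => (⟨z, σ i z⟩ : TotalSpace F V)) x) :
    cov (fun y => ∑ i ∈ t, σ i y) x = ∑ i ∈ t, cov (σ i) x := by
  classical
  induction t using Finset.induction_on with
  | empty =>
    simp only [Finset.sum_empty]
    exact congrFun cov.zero x
  | insert a s ha ih =>
    simp only [Finset.sum_insert ha]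
    rw [← ih fun i hi => hσ i (Finset.mem_insert_of_mem hi)]
    exact cov.isCovariantDerivativeOnUniv.add (hσ a (Finset.mem_insert_self a s))
      (MDifferentiableAt.sum_section fun i hi => hσ i (Finset.mem_insert_of_mem hi))

theorem cov_sum_smul (cov : CovariantDerivative IB F V) {ι : Type*} [Fintype ι]
    {s : ι → ∀ y, V y} {f : ι → B → ℝ} {x : B}
    (hs : ∀ i, MDifferentiableAt IB (IB.prod 𝓘(ℝ, F)) (fun z => (⟨z, s i z⟩ : TotalSpace F V)) x)
    (hf : ∀ i, MDifferentiableAt IB 𝓘(ℝ, ℝ) (f i) x) :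
    cov (fun y => ∑ i, f i y • s i y) x =
      ∑ i, (f i x • cov (s i) x + (mvfderiv IB (f i) x).smulRight (s i x)) := by
  rw [cov_sum cov Finset.univ (σ := fun i y => f i y • s i y) fun i _ => (hf i).smul_section (hs i)]
  exact Finset.sum_congr rfl fun i _ => cov.isCovariantDerivativeOnUniv.leibniz (hs i) (hf i)

/-- The axioms constrain a connection at differentiable sections only, so locality needs
differentiability of one of the two sections; the other one inherits it. -/
theorem cov_congr (cov : CovariantDerivative IB F V) {σ τ : ∀ y, V y} {x : B}
    (hσ : MDifferentiableAt IB (IB.prod 𝓘(ℝ, F)) (fun z => (⟨z, σ z⟩ : TotalSpace F V)) x)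
    (h : ∀ᶠ y in 𝓝 x, σ y = τ y) : cov σ x = cov τ x := by
  refine cov.isCovariantDerivativeOnUniv.congr_of_eventuallyEq hσ ?_ Filter.univ_mem h
  refine hσ.congr_of_eventuallyEq ?_
  filter_upwards [h] with y hy
  rw [hy]

/-- The derivative in the trivialization `e`, corrected by the value of the connection on the
sections that are constant in `e`. -/
theorem cov_eq_coord [ContMDiffVectorBundle 1 F V IB] (cov : CovariantDerivative IB F V)
    (e : Trivialization F (π F V)) [MemTrivializationAtlas e] {σ : ∀ y, V y} {x : B}
    (hx : x ∈ e.baseSet)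
    (hσ : MDifferentiableAt IB (IB.prod 𝓘(ℝ, F)) (fun z => (⟨z, σ z⟩ : TotalSpace F V)) x) :
    cov σ x = e.symmL ℝ x ∘L mvfderiv IB (secCoord e σ) x + cov (constSec e (secCoord e σ x)) x := by
  -- The connection and the derivative of coordinates have the same Leibniz defect, so their
  -- difference is tensorial. It may be evaluated on the constant section with the same value at
  -- `x`, for which the coordinate derivative vanishes.
  have hT : TensorialAt IB F (fun τ : ∀ y, V y =>
      cov τ x - e.symmL ℝ x ∘L mvfderiv IB (secCoord e τ) x) x := by
    constructor
    · intro f τ hf hτ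
      have h1 := cov.isCovariantDerivativeOnUniv.leibniz hτ hf
      have h2 := mvfderiv_smul hf ((mdifferentiableAt_secCoord_iff e hx).2 hτ)
      simp only [secCoord_smul]
      rw [h1, h2]
      ext u
      have h3 : e.symmL ℝ x (secCoord e τ x) = τ x := e.symmL_continuousLinearMapAt hx _
      simp only [sub_apply, add_apply,
        smul_apply, ContinuousLinearMap.smulRight_apply,
        ContinuousLinearMap.comp_apply, map_add, map_smul, h3]
      module
    · intro τ τ' hτ hτ'
      have h1 := cov.isCovariantDerivativeOnUniv.add hτ hτ'
      have h2 := mvfderiv_add ((mdifferentiableAt_secCoord_iff e hx).2 hτ)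
        ((mdifferentiableAt_secCoord_iff e hx).2 hτ')
      simp only [secCoord_add]
      rw [h1, h2, ContinuousLinearMap.comp_add]
      abel
  have hc : MDifferentiableAt IB (IB.prod 𝓘(ℝ, F))
      (fun z => (⟨z, constSec e (secCoord e σ x) z⟩ : TotalSpace F V)) x :=
    (contMDiffAt_constSec (n := 1) e _ hx).mdifferentiableAt one_ne_zero
  have h := hT.pointwise hσ hc (e.symmL_continuousLinearMapAt hx _).symm
  have h0 : mvfderiv IB (secCoord e (constSec e (secCoord e σ x))) x = 0 := by
    rw [mvfderiv_congr (secCoord_constSec e _ hx)]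
    exact mvfderiv_const _
  rw [h0, ContinuousLinearMap.comp_zero, sub_zero] at h
  rw [← h]
  abel

/-- The connection maps locally smooth sections to locally smooth sections. -/
def LocSmooth (cov : CovariantDerivative IB F V) : Prop :=
  ∀ (σ : ∀ y, V y) (x : B), SmoothNear (F := F) IB σ x →
    ContMDiffAt IB (IB.prod 𝓘(ℝ, EB →L[ℝ] F)) ∞
      (fun z => (⟨z, cov σ z⟩ : TotalSpace (EB →L[ℝ] F) (fun x => TangentSpace IB x →L[ℝ] V x))) x

theorem LocSmooth.smoothNear {cov : CovariantDerivative IB F V} (h : LocSmooth cov)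
    {σ : ∀ y, V y} {x : B} (hσ : SmoothNear (F := F) IB σ x) :
    SmoothNear (F := EB →L[ℝ] F) (V := fun x => TangentSpace IB x →L[ℝ] V x) IB (cov σ) x := by
  filter_upwards [hσ.eventually] with y hy
  exact h σ y hy

theorem LocSmooth.contMDiffCovariantDerivative {cov : CovariantDerivative IB F V}
    (h : LocSmooth cov) : CovariantDerivative.ContMDiffCovariantDerivative cov ∞ := by
  constructor
  constructor
  intro σ hσ x _
  refine (h σ x ?_).contMDiffWithinAt
  have h1 := contMDiffOn_univ.1 hσ
  exact ContMDiff.smoothNear (h1.of_le (by simp)) x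

/-- Smoothness of a connection is formulated for global sections. A section that is smooth near `x`
is made global by a bump function which is `1` near `x`, so that its germ is unchanged. This is
where the Hausdorff property of the manifold enters. -/
theorem locSmooth_of_contMDiffCovariantDerivative [T2Space B] [IsManifold IB ∞ B]
    [ContMDiffVectorBundle ∞ F V IB]
    {cov : CovariantDerivative IB F V} (h : CovariantDerivative.ContMDiffCovariantDerivative cov ∞) :
    LocSmooth cov := by
  intro σ x hσ
  obtain ⟨u, hu, huo, hxu⟩ := eventually_nhds_iff.1 hσ
  obtain ⟨f, -, hf⟩ := (SmoothBumpFunction.nhds_basis_tsupport (I := IB) x).mem_iff.1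
    (huo.mem_nhds hxu)
  have h1 : ContMDiff IB (IB.prod 𝓘(ℝ, F)) ∞
      (fun z => (⟨z, ((f : B → ℝ) • σ) z⟩ : TotalSpace F V)) :=
    ContMDiffOn.smul_section_of_tsupport (s := σ) f.contMDiff.contMDiffOn huo hf
      fun y hy => (hu y hy).contMDiffWithinAt
  have h2 := h.contMDiff.contMDiff (σ := (f : B → ℝ) • σ) (contMDiffOn_univ.2 (h1.of_le (by simp)))
  refine (contMDiffOn_univ.1 h2 x).congr_of_eventuallyEq ?_
  -- The derivatives of the two sections are compared on a neighbourhood of `x`, so the sections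
  -- must have equal germs at all points of it.
  have h3 : ∀ᶠ y in 𝓝 x, ∀ᶠ z in 𝓝 y, σ z = ((f : B → ℝ) • σ) z := by
    refine eventually_eventually_nhds.2 ?_
    filter_upwards [f.eventuallyEq_one] with z hz
    simp [hz]
  filter_upwards [h3, hσ] with y hy hy'
  rw [cov_congr cov (hy'.mdifferentiableAt (by simp)) hy]

/-- By the Leibniz rule, the derivative of a combination consists of the derivatives of the `s i`
and the differentials of the coefficients. The `s i` need not be independent. For lifted connections
these are the lifts of constant sections. -/
theorem contMDiffAt_cov_of_frame [ContMDiffVectorBundle ∞ F V IB] [IsManifold IB ∞ B]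
    (cov : CovariantDerivative IB F V) {ι : Type*} [Fintype ι]
    {s : ι → ∀ y, V y} {f : ι → B → ℝ} {σ : ∀ y, V y} {x : B}
    (hs : ∀ i, SmoothNear (F := F) IB (s i) x)
    (hf : ∀ i, ∀ᶠ y in 𝓝 x, ContMDiffAt IB 𝓘(ℝ, ℝ) ∞ (f i) y)
    (hσ : ∀ᶠ y in 𝓝 x, σ y = ∑ i, f i y • s i y)
    (hcov : ∀ i, ContMDiffAt IB (IB.prod 𝓘(ℝ, EB →L[ℝ] F)) ∞
      (fun z => (⟨z, cov (s i) z⟩ : TotalSpace (EB →L[ℝ] F) (fun x => TangentSpace IB x →L[ℝ] V x)))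
      x) :
    ContMDiffAt IB (IB.prod 𝓘(ℝ, EB →L[ℝ] F)) ∞
      (fun z => (⟨z, cov σ z⟩ : TotalSpace (EB →L[ℝ] F) (fun x => TangentSpace IB x →L[ℝ] V x)))
      x := by
  have h1 : ContMDiffAt IB (IB.prod 𝓘(ℝ, EB →L[ℝ] F)) ∞
      (fun z => (⟨z, ∑ i, (f i z • cov (s i) z + (mvfderiv IB (f i) z).smulRight (s i z))⟩ :
        TotalSpace (EB →L[ℝ] F) (fun x => TangentSpace IB x →L[ℝ] V x))) x := by
    refine ContMDiffAt.sum_section (V := fun x => TangentSpace IB x →L[ℝ] V x) fun i _ => ?_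
    refine ContMDiffAt.add_section (V := fun x => TangentSpace IB x →L[ℝ] V x)
      ((hf i).self_of_nhds.smul_section (hcov i)) ?_
    refine contMDiffAt_hom_of_constSec fun b => ?_
    refine ContMDiffAt.smul_section (f := fun z => mvfderiv IB (f i) z (constSec _ b z))
      (contMDiffAt_mvfderiv_apply (hf i).self_of_nhds (contMDiffAt_constSec _ _
        (FiberBundle.mem_baseSet_trivializationAt _ _ x))) (hs i).contMDiffAt
  refine h1.congr_of_eventuallyEq ?_
  filter_upwards [eventually_eventually_nhds.2 hσ, Filter.eventually_all.2 hs,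
    Filter.eventually_all.2 hf] with y h2 h3 h4
  have h5 : ∀ i, MDifferentiableAt IB 𝓘(ℝ, ℝ) (f i) y := fun i =>
    (h4 i).mdifferentiableAt (by simp)
  have h6 : ∀ i, MDifferentiableAt IB (IB.prod 𝓘(ℝ, F)) (fun z => (⟨z, s i z⟩ : TotalSpace F V)) y :=
    fun i => (h3 i).mdifferentiableAt (by simp)
  rw [← cov_sum_smul cov h6 h5]
  refine congrArg (TotalSpace.mk y) (cov_congr cov ?_ (h2.mono fun _ h => h.symm)).symm
  exact MDifferentiableAt.sum_section fun i _ => (h5 i).smul_section (h6 i)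

theorem SmoothNear.exists_sum_constSec [ContMDiffVectorBundle ∞ F V IB] {σ : ∀ y, V y} {x : B}
    (hσ : SmoothNear (F := F) IB σ x) {ι : Type*} [Fintype ι] (b : Module.Basis ι ℝ F) :
    ∃ f : ι → B → ℝ, (∀ i, ∀ᶠ y in 𝓝 x, ContMDiffAt IB 𝓘(ℝ, ℝ) ∞ (f i) y) ∧
      ∀ᶠ y in 𝓝 x, σ y = ∑ i, f i y • constSec (trivializationAt F V x) (b i) y := by
  set e := trivializationAt F V x with he
  have hx : x ∈ e.baseSet := FiberBundle.mem_baseSet_trivializationAt F V x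
  refine ⟨fun i y => LinearMap.toContinuousLinearMap (b.coord i) (secCoord e σ y),
    fun i => ?_, ?_⟩
  · filter_upwards [hσ, e.open_baseSet.mem_nhds hx] with y hy hye
    exact (LinearMap.toContinuousLinearMap (b.coord i)).contMDiff.contMDiffAt.comp y
      ((contMDiffAt_secCoord_iff e hye).2 hy)
  · filter_upwards [e.open_baseSet.mem_nhds hx] with y hy
    have h1 : ∑ i, b.coord i (secCoord e σ y) • b i = secCoord e σ y := b.sum_repr _
    have h2 : e.symmL ℝ y (secCoord e σ y) = σ y := e.symmL_continuousLinearMapAt hy _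
    rw [← h2]
    conv_lhs => rw [← h1, map_sum]
    exact Finset.sum_congr rfl fun i _ => map_smul _ _ _

end Connection

/-! ### The induced connection on a Hom bundle. -/

section HomConnection

variable {EB HB B : Type*} [NormedAddCommGroup EB] [NormedSpace ℝ EB] [FiniteDimensional ℝ EB]
  [TopologicalSpace HB]
  {IB : ModelWithCorners ℝ EB HB} [TopologicalSpace B] [ChartedSpace HB B] [IsManifold IB 1 B]
  {F : Type*} [NormedAddCommGroup F] [NormedSpace ℝ F] [FiniteDimensional ℝ F]
  {V : B → Type*} [TopologicalSpace (TotalSpace F V)] [∀ x, AddCommGroup (V x)]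
  [∀ x, Module ℝ (V x)] [∀ x, TopologicalSpace (V x)] [∀ x, IsTopologicalAddGroup (V x)]
  [∀ x, ContinuousSMul ℝ (V x)]
  [FiberBundle F V] [VectorBundle ℝ F V] [ContMDiffVectorBundle 1 F V IB]
  {F' : Type*} [NormedAddCommGroup F'] [NormedSpace ℝ F'] [FiniteDimensional ℝ F']
  {V' : B → Type*} [TopologicalSpace (TotalSpace F' V')] [∀ x, AddCommGroup (V' x)]
  [∀ x, Module ℝ (V' x)] [∀ x, TopologicalSpace (V' x)] [∀ x, IsTopologicalAddGroup (V' x)]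
  [∀ x, ContinuousSMul ℝ (V' x)] [FiberBundle F' V'] [VectorBundle ℝ F' V']
  [ContMDiffVectorBundle 1 F' V' IB]

variable (cov : CovariantDerivative IB F V) (cov' : CovariantDerivative IB F' V')

/-- When `s` is replaced by `f • s`, both terms produce the same summand `df ⊗ φ(s)`, and these
cancel. So the value at `x` depends on `s x` only and defines a homomorphism. -/
theorem tensorialAt_homConnection {φ : ∀ x, V x →L[ℝ] V' x} {x : B}
    (hφ : MDifferentiableAt IB (IB.prod 𝓘(ℝ, F →L[ℝ] F'))
      (fun y => (⟨y, φ y⟩ : TotalSpace (F →L[ℝ] F') (fun x => V x →L[ℝ] V' x))) x) :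
    TensorialAt IB F (fun s : ∀ y, V y => cov' (fun y => φ y (s y)) x - φ x ∘L cov s x) x := by
  constructor
  · intro f s hf hs
    have h1 := cov'.isCovariantDerivativeOnUniv.leibniz (hφ.clm_bundle_apply (v := s) hs) hf
    have h2 := cov.isCovariantDerivativeOnUniv.leibniz hs hf
    have h3 : (fun y => φ y ((f • s) y)) = f • fun y => φ y (s y) :=
      funext fun y => map_smul (φ y) _ _
    rw [h3, h2, h1]
    ext u
    simp only [sub_apply, add_apply, smul_apply, ContinuousLinearMap.smulRight_apply,
      ContinuousLinearMap.comp_apply, map_add, map_smul]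
    module
  · intro s s' hs hs'
    have h1 := cov'.isCovariantDerivativeOnUniv.add (hφ.clm_bundle_apply (v := s) hs)
      (hφ.clm_bundle_apply (v := s') hs')
    have h2 := cov.isCovariantDerivativeOnUniv.add hs hs'
    have h3 : (fun y => φ y ((s + s') y)) = (fun y => φ y (s y)) + fun y => φ y (s' y) :=
      funext fun y => map_add (φ y) _ _
    rw [h3, h2, h1, ContinuousLinearMap.comp_add]
    abel

open scoped Classical in
/-- The values of the induced connection on `Hom(V, V')`. -/
def homDeriv (φ : ∀ x, V x →L[ℝ] V' x) (x : B) : TangentSpace IB x →L[ℝ] V x →L[ℝ] V' x :=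
  if hφ : MDifferentiableAt IB (IB.prod 𝓘(ℝ, F →L[ℝ] F'))
      (fun y => (⟨y, φ y⟩ : TotalSpace (F →L[ℝ] F') (fun x => V x →L[ℝ] V' x))) x then
    have : T2Space (V x) := FiberBundle.t2Space F V x
    have : FiniteDimensional ℝ (V x) := VectorBundle.finiteDimensional ℝ F V x
    have : FiniteDimensional ℝ (TangentSpace IB x) := inferInstanceAs (FiniteDimensional ℝ EB)
    have : T2Space (TangentSpace IB x) := inferInstanceAs (T2Space EB)
    -- `mkHom` takes the vector of the bundle first and the direction second; the two arguments are
    -- exchanged below.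
    let m := TensorialAt.mkHom _ x (tensorialAt_homConnection cov cov' hφ)
    LinearMap.toContinuousLinearMap
      { toFun := fun u => LinearMap.toContinuousLinearMap
          { toFun := fun v => m v u
            map_add' := fun v w => by rw [map_add]; rfl
            map_smul' := fun c v => by rw [map_smul]; rfl }
        map_add' := fun u u' => by ext v; exact map_add (m v) u u'
        map_smul' := fun c u => by ext v; exact map_smul (m v) c u }
  -- An arbitrary value: the axioms of a connection concern differentiable sections only.
  else 0

theorem homDeriv_apply {φ : ∀ x, V x →L[ℝ] V' x} {s : ∀ x, V x} {x : B}
    (hφ : MDifferentiableAt IB (IB.prod 𝓘(ℝ, F →L[ℝ] F'))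
      (fun y => (⟨y, φ y⟩ : TotalSpace (F →L[ℝ] F') (fun x => V x →L[ℝ] V' x))) x)
    (hs : MDifferentiableAt IB (IB.prod 𝓘(ℝ, F)) (fun y => (⟨y, s y⟩ : TotalSpace F V)) x)
    (u : TangentSpace IB x) :
    homDeriv cov cov' φ x u (s x) = cov' (fun y => φ y (s y)) x u - φ x (cov s x u) := by
  have h := TensorialAt.mkHom_apply (tensorialAt_homConnection cov cov' hφ) hs
  rw [homDeriv, dif_pos hφ]
  exact congrArg (fun A : TangentSpace IB x →L[ℝ] V' x => A u) h

theorem mdifferentiableAt_constExt {x : B} (v : V x) :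
    MDifferentiableAt IB (IB.prod 𝓘(ℝ, F)) (fun y => (⟨y, constExt F v y⟩ : TotalSpace F V)) x :=
  (contMDiffAt_constSec (n := 1) _ _
    (FiberBundle.mem_baseSet_trivializationAt F V x)).mdifferentiableAt one_ne_zero

theorem homDeriv_apply_constExt {φ : ∀ x, V x →L[ℝ] V' x} {x : B}
    (hφ : MDifferentiableAt IB (IB.prod 𝓘(ℝ, F →L[ℝ] F'))
      (fun y => (⟨y, φ y⟩ : TotalSpace (F →L[ℝ] F') (fun x => V x →L[ℝ] V' x))) x)
    (u : TangentSpace IB x) (v : V x) :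
    homDeriv cov cov' φ x u v =
      cov' (fun y => φ y (constExt F v y)) x u - φ x (cov (constExt F v) x u) := by
  have h := homDeriv_apply cov cov' hφ (mdifferentiableAt_constExt v) u
  rwa [constExt_self] at h

/-- The connection on `Hom(V, V')` induced by connections on `V` and `V'`. -/
def homConnection : CovariantDerivative IB (F →L[ℝ] F') (fun x => V x →L[ℝ] V' x) where
  toFun := homDeriv cov cov'
  isCovariantDerivativeOnUniv :=
    { add := by
        intro φ φ' x hφ hφ' _
        have hsum := mdifferentiableAt_add_section hφ hφ'
        ext u v
        rw [homDeriv_apply_constExt cov cov' hsum]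
        have h1 := cov'.isCovariantDerivativeOnUniv.add
          (hφ.clm_bundle_apply (mdifferentiableAt_constExt v))
          (hφ'.clm_bundle_apply (mdifferentiableAt_constExt v))
        change (cov' ((fun y => φ y (constExt F v y)) + fun y => φ' y (constExt F v y)) x) u
          - _ = homDeriv cov cov' φ x u v + homDeriv cov cov' φ' x u v
        rw [homDeriv_apply_constExt cov cov' hφ, homDeriv_apply_constExt cov cov' hφ', h1]
        simp only [Pi.add_apply, add_apply]
        abel
      leibniz := by
        intro φ g x hφ hg _
        have hsm := hg.smul_section hφ
        ext u v
        rw [homDeriv_apply_constExt cov cov' hsm]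
        have h1 := cov'.isCovariantDerivativeOnUniv.leibniz
          (hφ.clm_bundle_apply (mdifferentiableAt_constExt v)) hg
        change (cov' (g • fun y => φ y (constExt F v y)) x) u
          - _ = g x • homDeriv cov cov' φ x u v + mvfderiv IB g x u • φ x v
        rw [homDeriv_apply_constExt cov cov' hφ, h1, constExt_self]
        simp only [Pi.smul_apply', add_apply, smul_apply, ContinuousLinearMap.smulRight_apply]
        module }

theorem isHomConnection_homConnection : IsHomConnection cov cov' (homConnection cov cov') :=
  fun _ _ _ hφ hs u => homDeriv_apply cov cov' hφ hs u

variable {cov cov'}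

/-- The defining identity fixes the values at differentiable sections and no others. Therefore
agreement of the given connections is also required at differentiable sections only, which allows
the lemma to be applied to a Hom bundle whose source is a Hom bundle. -/
theorem IsHomConnection.eq_of_mdifferentiableAt {cov₁ : CovariantDerivative IB F V}
    {cov₁' : CovariantDerivative IB F' V'}
    {covH covH₁ : CovariantDerivative IB (F →L[ℝ] F') (fun x => V x →L[ℝ] V' x)}
    (h : IsHomConnection cov cov' covH) (h₁ : IsHomConnection cov₁ cov₁' covH₁)
    {x : B}
    (hcov : ∀ s : ∀ y, V y, MDifferentiableAt IB (IB.prod 𝓘(ℝ, F))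
      (fun y => (⟨y, s y⟩ : TotalSpace F V)) x → cov s x = cov₁ s x)
    (hcov' : ∀ s : ∀ y, V' y, MDifferentiableAt IB (IB.prod 𝓘(ℝ, F'))
      (fun y => (⟨y, s y⟩ : TotalSpace F' V')) x → cov' s x = cov₁' s x)
    {φ : ∀ x, V x →L[ℝ] V' x}
    (hφ : MDifferentiableAt IB (IB.prod 𝓘(ℝ, F →L[ℝ] F'))
      (fun y => (⟨y, φ y⟩ : TotalSpace (F →L[ℝ] F') (fun x => V x →L[ℝ] V' x))) x) :
    covH φ x = covH₁ φ x := by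
  ext u v
  have hv := mdifferentiableAt_constExt (IB := IB) (F := F) v
  have e1 := h φ (constExt F v) x hφ hv u
  have e2 := h₁ φ (constExt F v) x hφ hv u
  rw [constExt_self] at e1 e2
  rw [e1, e2, hcov _ hv, hcov' _ (hφ.clm_bundle_apply hv)]

/-- On constant fields `X` and `s` the defining identity exhibits the value as a difference of two
smooth sections, and evaluation on such fields detects smoothness. -/
theorem IsHomConnection.locSmooth [IsManifold IB ∞ B] [ContMDiffVectorBundle ∞ F V IB]
    [ContMDiffVectorBundle ∞ F' V' IB]
    {covH : CovariantDerivative IB (F →L[ℝ] F') (fun x => V x →L[ℝ] V' x)}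
    (h : IsHomConnection cov cov' covH) (hc : LocSmooth cov) (hc' : LocSmooth cov') :
    LocSmooth covH := by
  intro φ x hφ
  refine contMDiffAt_hom_of_constSec (V' := fun x => V x →L[ℝ] V' x) fun a => ?_
  refine contMDiffAt_hom_of_constSec fun b => ?_
  set X := constSec (trivializationAt EB (TangentSpace IB : B → Type _) x) a
  set s := constSec (trivializationAt F V x) b
  have hX : SmoothNear IB X x := smoothNear_constSec _ _
    (FiberBundle.mem_baseSet_trivializationAt _ _ x)
  have hs : SmoothNear IB s x := smoothNear_constSec _ _
    (FiberBundle.mem_baseSet_trivializationAt _ _ x)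
  have hφs : SmoothNear (F := F') IB (fun y => φ y (s y)) x := by
    filter_upwards [hφ, hs] with y h1 h2
    exact h1.clm_bundle_apply h2
  have h1 := (hc' _ _ hφs).clm_bundle_apply hX.contMDiffAt
  have h2 := hφ.contMDiffAt.clm_bundle_apply
    ((hc _ _ hs).clm_bundle_apply hX.contMDiffAt)
  refine (ContMDiffAt.sub_section h1 h2).congr_of_eventuallyEq ?_
  filter_upwards [hφ, hs] with y h3 h4
  exact congrArg (TotalSpace.mk y) (h φ s y (h3.mdifferentiableAt (by simp))
    (h4.mdifferentiableAt (by simp)) (X y))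

end HomConnection

/-! ### The induced connection on alternating forms. -/

section FormConnection

variable {EB HB B : Type*} [NormedAddCommGroup EB] [NormedSpace ℝ EB] [FiniteDimensional ℝ EB]
  [TopologicalSpace HB]
  {IB : ModelWithCorners ℝ EB HB} [TopologicalSpace B] [ChartedSpace HB B] [IsManifold IB 1 B]
  {F : Type*} [NormedAddCommGroup F] [NormedSpace ℝ F] [FiniteDimensional ℝ F]
  {V : B → Type*} [TopologicalSpace (TotalSpace F V)] [∀ x, AddCommGroup (V x)]
  [∀ x, Module ℝ (V x)] [∀ x, TopologicalSpace (V x)] [∀ x, IsTopologicalAddGroup (V x)]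
  [∀ x, ContinuousSMul ℝ (V x)]
  [FiberBundle F V] [VectorBundle ℝ F V]
  {l : ℕ}

theorem mvfderiv_eq_fderivWithin {G : Type*} [NormedAddCommGroup G] [NormedSpace ℝ G]
    {f : B → G} {x : B} (hf : MDifferentiableAt IB 𝓘(ℝ, G) f x) :
    mvfderiv IB f x =
      fderivWithin ℝ (f ∘ (extChartAt IB x).symm) (range IB) (extChartAt IB x x) := by
  have h := hf.mfderiv
  ext u
  exact congrArg (fun A : EB →L[ℝ] G => A u) h

theorem mdifferentiableAt_pi_of {ι : Type*} [Fintype ι] {G : Type*} [NormedAddCommGroup G]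
    [NormedSpace ℝ G] {g : ι → B → G} {x : B} (hg : ∀ i, MDifferentiableAt IB 𝓘(ℝ, G) (g i) x) :
    MDifferentiableAt IB 𝓘(ℝ, ι → G) (fun y i => g i y) x := by
  rw [mdifferentiableAt_iff]
  exact ⟨continuousAt_pi.2 fun i => (hg i).continuousAt, differentiableWithinAt_pi.2 fun i =>
    (hg i).differentiableWithinAt_writtenInExtChartAt⟩

theorem contMDiffAt_sum {ι : Type*} [Fintype ι] {G : Type*} [NormedAddCommGroup G]
    [NormedSpace ℝ G] {n : ℕ∞ω} {g : ι → B → G} {x : B}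
    (hg : ∀ i, ContMDiffAt IB 𝓘(ℝ, G) n (g i) x) :
    ContMDiffAt IB 𝓘(ℝ, G) n (fun y => ∑ i, g i y) x :=
  (ContDiff.sum fun i _ => contDiff_apply ℝ G i).contMDiff.contMDiffAt.comp x
    (contMDiffAt_pi_space.2 hg)

/-- Multilinear expansion in a basis makes the evaluation a polynomial in finitely many linear
coordinates of the form and of the vectors. -/
theorem contDiff_alternating_apply {n : ℕ∞ω} :
    ContDiff ℝ n (fun p : (F [⋀^Fin l]→L[ℝ] ℝ) × (Fin l → F) => p.1 p.2) := by
  let b := Module.finBasis ℝ F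
  have key : (fun p : (F [⋀^Fin l]→L[ℝ] ℝ) × (Fin l → F) => p.1 p.2) = fun p =>
      ∑ k : Fin l → Fin (Module.finrank ℝ F),
        (∏ i, LinearMap.toContinuousLinearMap (b.coord (k i)) (p.2 i)) *
          ContinuousAlternatingMap.apply ℝ F ℝ (fun i => b (k i)) p.1 := by
    funext p
    have h1 : p.2 = fun i => ∑ j, b.repr (p.2 i) j • b j := funext fun i => (b.sum_repr _).symm
    conv_lhs => rw [h1]
    refine (MultilinearMap.map_sum p.1.toMultilinearMap _).trans ?_
    refine Finset.sum_congr rfl fun k _ => ?_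
    exact MultilinearMap.map_smul_univ p.1.toMultilinearMap _ _
  rw [key]
  refine ContDiff.sum fun k _ => ContDiff.mul (contDiff_prod fun i _ => ?_) ?_
  · exact (ContinuousLinearMap.contDiff _).comp ((contDiff_apply ℝ F i).comp contDiff_snd)
  · exact (ContinuousLinearMap.contDiff _).comp contDiff_fst

/-- The product rule for the evaluation, carried over from the chart at `x`; the range of the model
with corners has unique derivatives there. -/
theorem mvfderiv_alternating_apply {f : B → F [⋀^Fin l]→L[ℝ] ℝ} {g : Fin l → B → F} {x : B}
    (hf : MDifferentiableAt IB 𝓘(ℝ, F [⋀^Fin l]→L[ℝ] ℝ) f x)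
    (hg : ∀ i, MDifferentiableAt IB 𝓘(ℝ, F) (g i) x) (u : TangentSpace IB x) :
    mvfderiv IB (fun y => f y (g · y)) x u =
      mvfderiv IB f x u (g · x) +
        ∑ i, f x (Function.update (g · x) i (mvfderiv IB (g i) x u)) := by
  have hfg : MDifferentiableAt IB 𝓘(ℝ, ℝ) (fun y => f y (g · y)) x := by
    have h1 := (contDiff_alternating_apply (F := F) (l := l) (n := 1)).contMDiff.mdifferentiable
      one_ne_zero (f x, (g · x))
    have h2 : MDifferentiableAt IB 𝓘(ℝ, Fin l → F) (fun y i => g i y) x :=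
      mdifferentiableAt_pi_of hg
    exact h1.comp x (hf.prodMk_space h2)
  rw [mvfderiv_eq_fderivWithin hfg, mvfderiv_eq_fderivWithin hf]
  simp only [fun i => mvfderiv_eq_fderivWithin (hg i)]
  have hx : (extChartAt IB x).symm (extChartAt IB x x) = x := extChartAt_to_inv x
  have h := fderivWithin_continuousAlternatingMap_apply_apply
    (f := f ∘ (extChartAt IB x).symm) (g := fun i => g i ∘ (extChartAt IB x).symm)
    (s := range IB) (x := extChartAt IB x x) hf.differentiableWithinAt_writtenInExtChartAt
    (fun i => (hg i).differentiableWithinAt_writtenInExtChartAt)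
    (IB.uniqueDiffWithinAt_image (x := chartAt HB x x)) u
  simp only [Function.comp_apply, hx] at h
  exact h

/-- The coordinates, in the trivialization of `V` at `x₀`, of a family of alternating forms. -/
def formCoord (x₀ : B) (α : ∀ y, V y [⋀^Fin l]→L[ℝ] Trivial B ℝ y) (y : B) : F [⋀^Fin l]→L[ℝ] ℝ :=
  (show V y [⋀^Fin l]→L[ℝ] ℝ from α y).compContinuousLinearMap
    ((trivializationAt F V x₀).symmL ℝ y)

/-- The trivial line bundle contributes the identity, so that passing to coordinates only transforms
the arguments. -/
theorem formCoord_eq (x₀ : B) (α : ∀ y, V y [⋀^Fin l]→L[ℝ] Trivial B ℝ y) (y : B) :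
    formCoord (F := F) x₀ α y = (trivializationAt (F [⋀^Fin l]→L[ℝ] ℝ)
      (fun y => V y [⋀^Fin l]→L[ℝ] Trivial B ℝ y) x₀ ⟨y, α y⟩).2 := by
  ext b
  have h := coord_eq (trivializationAt ℝ (Trivial B ℝ) x₀) (mem_univ y)
    (α y fun i => (trivializationAt F V x₀).symmL ℝ y (b i))
  exact h

theorem contMDiffAt_formCoord_iff {n : ℕ∞ω}
    {α : ∀ y, V y [⋀^Fin l]→L[ℝ] Trivial B ℝ y} {x : B} :
    ContMDiffAt IB 𝓘(ℝ, F [⋀^Fin l]→L[ℝ] ℝ) n (formCoord (F := F) x α) x ↔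
      ContMDiffAt IB (IB.prod 𝓘(ℝ, F [⋀^Fin l]→L[ℝ] ℝ)) n
        (fun y => (⟨y, α y⟩ : TotalSpace (F [⋀^Fin l]→L[ℝ] ℝ)
          (fun y => V y [⋀^Fin l]→L[ℝ] Trivial B ℝ y))) x := by
  rw [contMDiffAt_section]
  exact iff_of_eq (congrArg (fun f => ContMDiffAt IB 𝓘(ℝ, F [⋀^Fin l]→L[ℝ] ℝ) n f x)
    (funext (formCoord_eq x α)))

theorem mdifferentiableAt_formCoord_iff
    {α : ∀ y, V y [⋀^Fin l]→L[ℝ] Trivial B ℝ y} {x : B} :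
    MDifferentiableAt IB 𝓘(ℝ, F [⋀^Fin l]→L[ℝ] ℝ) (formCoord (F := F) x α) x ↔
      MDifferentiableAt IB (IB.prod 𝓘(ℝ, F [⋀^Fin l]→L[ℝ] ℝ))
        (fun y => (⟨y, α y⟩ : TotalSpace (F [⋀^Fin l]→L[ℝ] ℝ)
          (fun y => V y [⋀^Fin l]→L[ℝ] Trivial B ℝ y))) x := by
  rw [mdifferentiableAt_section]
  exact iff_of_eq (congrArg (fun f => MDifferentiableAt IB 𝓘(ℝ, F [⋀^Fin l]→L[ℝ] ℝ) f x)
    (funext (formCoord_eq x α)))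

theorem formCoord_apply_secCoord {x₀ y : B} (hy : y ∈ (trivializationAt F V x₀).baseSet)
    (α : ∀ y, V y [⋀^Fin l]→L[ℝ] Trivial B ℝ y) (Y : Fin l → ∀ y, V y) :
    formCoord (F := F) x₀ α y (fun i => secCoord (trivializationAt F V x₀) (Y i) y) =
      (show ℝ from α y fun i => Y i y) := by
  refine congrArg (fun v => (show ℝ from α y v)) (funext fun i => ?_)
  exact (trivializationAt F V x₀).symmL_continuousLinearMapAt hy _

variable (F) in
theorem form_apply_eventuallyEq (x : B)
    (α : ∀ y, V y [⋀^Fin l]→L[ℝ] Trivial B ℝ y) (Y : Fin l → ∀ y, V y) :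
    (fun y => (show ℝ from α y fun i => Y i y)) =ᶠ[𝓝 x] fun y =>
      formCoord (F := F) x α y (fun i => secCoord (trivializationAt F V x) (Y i) y) := by
  filter_upwards [(trivializationAt F V x).open_baseSet.mem_nhds
    (FiberBundle.mem_baseSet_trivializationAt F V x)] with y hy
  exact (formCoord_apply_secCoord hy α Y).symm

theorem contMDiffAt_form_apply {n : ℕ∞ω} [ContMDiffVectorBundle n F V IB]
    {α : ∀ y, V y [⋀^Fin l]→L[ℝ] Trivial B ℝ y} {Y : Fin l → ∀ y, V y} {x : B}
    (hα : ContMDiffAt IB (IB.prod 𝓘(ℝ, F [⋀^Fin l]→L[ℝ] ℝ)) n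
        (fun y => (⟨y, α y⟩ : TotalSpace (F [⋀^Fin l]→L[ℝ] ℝ)
          (fun y => V y [⋀^Fin l]→L[ℝ] Trivial B ℝ y))) x)
    (hY : ∀ i, ContMDiffAt IB (IB.prod 𝓘(ℝ, F)) n (fun y => (⟨y, Y i y⟩ : TotalSpace F V)) x) :
    ContMDiffAt IB 𝓘(ℝ, ℝ) n (fun y => (show ℝ from α y fun i => Y i y)) x := by
  have hx := FiberBundle.mem_baseSet_trivializationAt F V x
  refine ContMDiffAt.congr_of_eventuallyEq ?_ (form_apply_eventuallyEq F x α Y)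
  have h2 : ContMDiffAt IB 𝓘(ℝ, Fin l → F) n
      (fun y i => secCoord (trivializationAt F V x) (Y i) y) x :=
    contMDiffAt_pi_space.2 fun i => (contMDiffAt_secCoord_iff _ hx).2 (hY i)
  exact (contDiff_alternating_apply (F := F) (l := l) (n := n)).contMDiff.contMDiffAt.comp x
    ((contMDiffAt_formCoord_iff.2 hα).prodMk_space h2)

theorem mdifferentiableAt_form_apply [ContMDiffVectorBundle 1 F V IB]
    {α : ∀ y, V y [⋀^Fin l]→L[ℝ] Trivial B ℝ y} {Y : Fin l → ∀ y, V y} {x : B}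
    (hα : MDifferentiableAt IB (IB.prod 𝓘(ℝ, F [⋀^Fin l]→L[ℝ] ℝ))
        (fun y => (⟨y, α y⟩ : TotalSpace (F [⋀^Fin l]→L[ℝ] ℝ)
          (fun y => V y [⋀^Fin l]→L[ℝ] Trivial B ℝ y))) x)
    (hY : ∀ i, MDifferentiableAt IB (IB.prod 𝓘(ℝ, F)) (fun y => (⟨y, Y i y⟩ : TotalSpace F V)) x) :
    MDifferentiableAt IB 𝓘(ℝ, ℝ) (fun y => (show ℝ from α y fun i => Y i y)) x := by
  have hx := FiberBundle.mem_baseSet_trivializationAt F V x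
  refine MDifferentiableAt.congr_of_eventuallyEq ?_ (form_apply_eventuallyEq F x α Y)
  have h2 : MDifferentiableAt IB 𝓘(ℝ, Fin l → F)
      (fun y i => secCoord (trivializationAt F V x) (Y i) y) x :=
    mdifferentiableAt_pi_of fun i => (mdifferentiableAt_secCoord_iff _ hx).2 (hY i)
  exact ((contDiff_alternating_apply (F := F) (l := l) (n := 1)).contMDiff.mdifferentiable
    one_ne_zero _).comp x ((mdifferentiableAt_formCoord_iff.2 hα).prodMk_space h2)

/-- The connection form of `cov` in the trivialization at `x`. -/
def connForm [ContMDiffVectorBundle 1 F V IB] (cov : CovariantDerivative IB F V) (x : B) :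
    TangentSpace IB x →ₗ[ℝ] F →L[ℝ] F where
  toFun u := LinearMap.toContinuousLinearMap
    { toFun := fun b => (trivializationAt F V x).continuousLinearMapAt ℝ x
        (cov (constSec (trivializationAt F V x) b) x u)
      map_add' := fun b b' => by
        have hx := FiberBundle.mem_baseSet_trivializationAt F V x
        have h := cov.isCovariantDerivativeOnUniv.add
          ((contMDiffAt_constSec (IB := IB) (n := 1) (trivializationAt F V x) b
            hx).mdifferentiableAt one_ne_zero)
          ((contMDiffAt_constSec (IB := IB) (n := 1) (trivializationAt F V x) b'
            hx).mdifferentiableAt one_ne_zero)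
        rw [constSec_add, h, add_apply, map_add]
      map_smul' := fun c b => by
        have hx := FiberBundle.mem_baseSet_trivializationAt F V x
        have h := cov.isCovariantDerivativeOnUniv.smul_const c
          ((contMDiffAt_constSec (IB := IB) (n := 1) (trivializationAt F V x) b
            hx).mdifferentiableAt one_ne_zero)
        rw [constSec_smul, h, smul_apply, map_smul]; rfl }
  map_add' u u' := by
    ext b
    exact (congrArg ((trivializationAt F V x).continuousLinearMapAt ℝ x)
      (map_add (cov (constSec (trivializationAt F V x) b) x) u u')).trans
      (map_add ((trivializationAt F V x).continuousLinearMapAt ℝ x) _ _)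
  map_smul' c u := by
    ext b
    exact (congrArg ((trivializationAt F V x).continuousLinearMapAt ℝ x)
      (map_smul (cov (constSec (trivializationAt F V x) b) x) c u)).trans
      (map_smul ((trivializationAt F V x).continuousLinearMapAt ℝ x) _ _)

variable [ContMDiffVectorBundle 1 F V IB]

/-- The values of the induced connection on alternating forms, in the trivialization at `x`. -/
def formDerivCoord (cov : CovariantDerivative IB F V) (α : ∀ y, V y [⋀^Fin l]→L[ℝ] Trivial B ℝ y)
    (x : B) : TangentSpace IB x →ₗ[ℝ] F [⋀^Fin l]→L[ℝ] ℝ :=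
  (mvfderiv IB (formCoord (F := F) x α) x).toLinearMap -
    -- The derivative of `g ↦ A ∘ g` at the identity, in the direction of the connection form, is
    -- the sum over all slots of `A` with the connection form inserted in one slot. This is the
    -- action of the connection on forms, already known to be alternating.
    ((formCoord (F := F) x α x).fderivCompContinuousLinearMap
      (ContinuousLinearMap.id ℝ F)).toLinearMap ∘ₗ connForm cov x

/-- The values of the induced connection on alternating forms. -/
def formDeriv (cov : CovariantDerivative IB F V) (α : ∀ y, V y [⋀^Fin l]→L[ℝ] Trivial B ℝ y)
    (x : B) : TangentSpace IB x →L[ℝ] V x [⋀^Fin l]→L[ℝ] Trivial B ℝ x :=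
  have : FiniteDimensional ℝ (TangentSpace IB x) := inferInstanceAs (FiniteDimensional ℝ EB)
  have : T2Space (TangentSpace IB x) := inferInstanceAs (T2Space EB)
  LinearMap.toContinuousLinearMap
    { toFun := fun u => (formDerivCoord cov α x u).compContinuousLinearMap
        ((trivializationAt F V x).continuousLinearMapAt ℝ x)
      map_add' := fun u u' => by rw [map_add]; rfl
      map_smul' := fun c u => by rw [map_smul]; rfl }

/-- The product rule differentiates the coordinates of the `Y i`. The same terms occur in the
covariant derivatives of the `Y i`, so they cancel, and what is left involves only the derivative of
the form and the connection form. -/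
theorem formDeriv_apply (cov : CovariantDerivative IB F V)
    {α : ∀ y, V y [⋀^Fin l]→L[ℝ] Trivial B ℝ y} {Y : Fin l → ∀ y, V y} {x : B}
    (hα : MDifferentiableAt IB (IB.prod 𝓘(ℝ, F [⋀^Fin l]→L[ℝ] ℝ))
        (fun y => (⟨y, α y⟩ : TotalSpace (F [⋀^Fin l]→L[ℝ] ℝ)
          (fun y => V y [⋀^Fin l]→L[ℝ] Trivial B ℝ y))) x)
    (hY : ∀ i, MDifferentiableAt IB (IB.prod 𝓘(ℝ, F)) (fun y => (⟨y, Y i y⟩ : TotalSpace F V)) x)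
    (u : TangentSpace IB x) :
    (show ℝ from formDeriv cov α x u fun i => Y i x) =
      mvfderiv IB (fun y => (show ℝ from α y fun i => Y i y)) x u -
        ∑ i, (show ℝ from α x (Function.update (fun j => Y j x) i (cov (Y i) x u))) := by
  set e := trivializationAt F V x with he
  have hx : x ∈ e.baseSet := FiberBundle.mem_baseSet_trivializationAt F V x
  set A := formCoord (F := F) x α with hA
  set v : Fin l → F := fun i => secCoord e (Y i) x with hv
  have h1 : mvfderiv IB (fun y => (show ℝ from α y fun i => Y i y)) x u =
      mvfderiv IB A x u v +
        ∑ i, A x (Function.update v i (mvfderiv IB (secCoord e (Y i)) x u)) := by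
    rw [mvfderiv_congr (form_apply_eventuallyEq F x α Y)]
    exact mvfderiv_alternating_apply (g := fun i => secCoord e (Y i))
      (mdifferentiableAt_formCoord_iff.2 hα)
      (fun i => (mdifferentiableAt_secCoord_iff e hx).2 (hY i)) u
  have h2 : ∀ i, (show ℝ from α x (Function.update (fun j => Y j x) i (cov (Y i) x u))) =
      A x (Function.update v i (mvfderiv IB (secCoord e (Y i)) x u)) +
        A x (Function.update v i (connForm cov x u (v i))) := by
    intro i
    -- In slot `i`, `cov_eq_coord` splits the covariant derivative into the coordinate derivative
    -- and the connection form.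
    rw [← (A x).map_update_add]
    refine congrArg (fun w => (show ℝ from α x w)) (funext fun j => ?_)
    by_cases hj : j = i
    · subst hj
      simp only [Function.update_self]
      rw [cov_eq_coord cov e hx (hY j), map_add]
      exact congrArg _ (e.symmL_continuousLinearMapAt hx _).symm
    · simp only [Function.update_of_ne hj]
      exact (e.symmL_continuousLinearMapAt hx _).symm
  rw [h1, Finset.sum_congr rfl fun i _ => h2 i, Finset.sum_add_distrib]
  have h3 : (show ℝ from formDeriv cov α x u fun i => Y i x) =
      mvfderiv IB A x u v - ∑ i, A x (Function.update v i (connForm cov x u (v i))) := by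
    change mvfderiv IB A x u v - (A x).fderivCompContinuousLinearMap (ContinuousLinearMap.id ℝ F)
      (connForm cov x u) v = _
    rw [ContinuousAlternatingMap.fderivCompContinuousLinearMap_apply]
    refine congrArg _ (Finset.sum_congr rfl fun i _ => congrArg (A x) (funext fun j => ?_))
    by_cases hj : j = i
    · subst hj; simp
    · simp [Function.update_of_ne hj]
  rw [h3]
  ring

/-- The connection on alternating forms induced by a connection on `V`. -/
def formConnection (l : ℕ) (cov : CovariantDerivative IB F V) :
    CovariantDerivative IB (F [⋀^Fin l]→L[ℝ] ℝ) (fun x => V x [⋀^Fin l]→L[ℝ] Trivial B ℝ x) where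
  toFun := formDeriv cov
  isCovariantDerivativeOnUniv :=
    { add := by
        intro α β x hα hβ _
        ext u y
        have h1 := mvfderiv_add (mdifferentiableAt_formCoord_iff.2 hα)
          (mdifferentiableAt_formCoord_iff.2 hβ)
        have h2 : formCoord (F := F) x (α + β) = formCoord x α + formCoord x β := rfl
        have h3 : formDerivCoord cov (α + β) x u = formDerivCoord cov α x u + formDerivCoord cov β x u := by
          simp only [formDerivCoord, h2, h1]
          ext v
          simp only [LinearMap.sub_apply, LinearMap.comp_apply, ContinuousLinearMap.coe_coe,
            add_apply, Pi.add_apply, ContinuousAlternatingMap.add_apply,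
            ContinuousAlternatingMap.sub_apply,
            ContinuousAlternatingMap.fderivCompContinuousLinearMap_apply, Finset.sum_add_distrib]
          ring
        exact congrArg (fun A : F [⋀^Fin l]→L[ℝ] ℝ => A fun i =>
          (trivializationAt F V x).continuousLinearMapAt ℝ x (y i)) h3
      leibniz := by
        intro α g x hα hg _
        ext u y
        have hx := FiberBundle.mem_baseSet_trivializationAt F V x
        have h1 := mvfderiv_smul hg (mdifferentiableAt_formCoord_iff.2 hα)
        have h2 : formCoord (F := F) x (g • α) = g • formCoord x α := rfl
        have h3 : formDerivCoord cov (g • α) x u =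
            g x • formDerivCoord cov α x u + mvfderiv IB g x u • formCoord x α x := by
          simp only [formDerivCoord, h2, h1]
          ext v
          simp only [LinearMap.sub_apply, LinearMap.comp_apply, ContinuousLinearMap.coe_coe,
            add_apply, smul_apply, Pi.smul_apply', ContinuousAlternatingMap.add_apply,
            ContinuousAlternatingMap.sub_apply, ContinuousAlternatingMap.smul_apply,
            ContinuousLinearMap.smulRight_apply,
            ContinuousAlternatingMap.fderivCompContinuousLinearMap_apply, smul_eq_mul, ← Finset.mul_sum]
          ring
        have h4 := congrArg (fun A : F [⋀^Fin l]→L[ℝ] ℝ => A fun i =>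
          (trivializationAt F V x).continuousLinearMapAt ℝ x (y i)) h3
        have h5 : formCoord (F := F) x α x (fun i =>
          (trivializationAt F V x).continuousLinearMapAt ℝ x (y i)) = (show ℝ from α x y) :=
          congrArg (fun v => (show ℝ from α x v)) (funext fun i =>
            (trivializationAt F V x).symmL_continuousLinearMapAt hx _)
        refine h4.trans ?_
        exact congrArg (fun r : ℝ => g x * formDerivCoord cov α x u (fun i =>
          (trivializationAt F V x).continuousLinearMapAt ℝ x (y i)) + mvfderiv IB g x u * r) h5 }

end FormConnection

/-! ### The form connection of a connection on the tangent bundle. -/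

section Tangent

variable {EB HB B : Type*} [NormedAddCommGroup EB] [NormedSpace ℝ EB] [FiniteDimensional ℝ EB]
  [TopologicalSpace HB]
  {IB : ModelWithCorners ℝ EB HB} [TopologicalSpace B] [ChartedSpace HB B] [IsManifold IB ∞ B]
  {l : ℕ}

theorem exists_isFormConnection
    [IsManifold IB 1 B] (cov : CovariantDerivative IB EB (TangentSpace IB : B → Type _)) :
    IsFormConnection l cov (formConnection l cov) :=
  fun _ _ _ hα hY u => formDeriv_apply cov hα hY u

/-- Every tuple of tangent vectors extends to differentiable vector fields, so the defining identity
leaves no freedom at a differentiable form. -/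
theorem IsFormConnection.eq_of_mdifferentiableAt [IsManifold IB 1 B]
    {cov : CovariantDerivative IB EB (TangentSpace IB : B → Type _)}
    {covF covF' : CovariantDerivative IB (EB [⋀^Fin l]→L[ℝ] ℝ) (fun x : B => Forms IB l x)}
    (h : IsFormConnection l cov covF) (h' : IsFormConnection l cov covF')
    {α : ∀ x, Forms IB l x} {x : B}
    (hα : MDifferentiableAt IB (IB.prod 𝓘(ℝ, EB [⋀^Fin l]→L[ℝ] ℝ))
      (fun y => (⟨y, α y⟩ : TotalSpace (EB [⋀^Fin l]→L[ℝ] ℝ) (fun x : B => Forms IB l x))) x) :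
    covF α x = covF' α x := by
  ext u y
  have hy := fun i => mdifferentiableAt_constExt (IB := IB) (F := EB) (V := TangentSpace IB) (y i)
  have e1 := h α (fun i => constExt EB (V := TangentSpace IB) (y i)) x hα hy u
  have e2 := h' α (fun i => constExt EB (V := TangentSpace IB) (y i)) x hα hy u
  simp only [constExt_self] at e1 e2
  exact e1.trans e2.symm

theorem IsFormConnection.locSmooth
    {cov : CovariantDerivative IB EB (TangentSpace IB : B → Type _)}
    {covF : CovariantDerivative IB (EB [⋀^Fin l]→L[ℝ] ℝ) (fun x : B => Forms IB l x)}
    (h : IsFormConnection l cov covF) (hc : LocSmooth cov) : LocSmooth covF := by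
  intro α x hα
  refine contMDiffAt_hom_of_constSec (V' := fun x : B => Forms IB l x) fun a => ?_
  refine contMDiffAt_alternating_of_constSec fun b => ?_
  set X := constSec (trivializationAt EB (TangentSpace IB : B → Type _) x) a
  set Y : Fin l → ∀ y, TangentSpace IB y :=
    fun i => constSec (trivializationAt EB (TangentSpace IB : B → Type _) x) (b i) with hY'
  have hx := FiberBundle.mem_baseSet_trivializationAt EB (TangentSpace IB : B → Type _) x
  have hX : SmoothNear IB X x := smoothNear_constSec _ _ hx
  have hY : ∀ i, SmoothNear IB (Y i) x := fun i => smoothNear_constSec _ _ hx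
  have hαY : ContMDiffAt IB 𝓘(ℝ, ℝ) ∞ (fun y => (show ℝ from α y fun i => Y i y)) x :=
    contMDiffAt_form_apply hα.contMDiffAt fun i => (hY i).contMDiffAt
  have h1 := contMDiffAt_mvfderiv_apply hαY hX.contMDiffAt
  -- The update is performed on the tuple of vector fields instead of its values, so that smoothness
  -- can be checked slot by slot.
  have h2 : ∀ i, ContMDiffAt IB 𝓘(ℝ, ℝ) ∞ (fun y => (show ℝ from α y
      fun j => Function.update Y i (fun z => cov (Y i) z (X z)) j y)) x := by
    intro i
    refine contMDiffAt_form_apply hα.contMDiffAt fun j => ?_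
    by_cases hj : j = i
    · subst hj
      rw [Function.update_self]
      exact (hc _ _ (hY j)).clm_bundle_apply hX.contMDiffAt
    · rw [Function.update_of_ne hj]
      exact (hY j).contMDiffAt
  refine (contMDiffAt_section (E := Trivial B ℝ) x).2 ?_
  refine (h1.sub (contMDiffAt_sum h2)).congr_of_eventuallyEq ?_
  filter_upwards [hα, Filter.eventually_all.2 hY] with y h3 h4
  refine (h α Y y (h3.mdifferentiableAt (by simp))
    (fun i => (h4 i).mdifferentiableAt (by simp)) (X y)).trans ?_
  refine congrArg _ (Finset.sum_congr rfl fun i _ => congrArg (α y) (funext fun j => ?_))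
  by_cases hj : j = i
  · subst hj; simp
  · simp [Function.update_of_ne hj]

end Tangent

/-! ### Direct sums of connections. -/

section Sum

variable {EB HB B : Type*} [NormedAddCommGroup EB] [NormedSpace ℝ EB] [FiniteDimensional ℝ EB]
  [TopologicalSpace HB]
  {IB : ModelWithCorners ℝ EB HB} [TopologicalSpace B] [ChartedSpace HB B] [IsManifold IB 1 B]
  {G : Type*} [NormedAddCommGroup G] [NormedSpace ℝ G]
  {W : B → Type*} [TopologicalSpace (TotalSpace G W)] [∀ x, AddCommGroup (W x)]
  [∀ x, Module ℝ (W x)] [∀ x, TopologicalSpace (W x)] [∀ x, IsTopologicalAddGroup (W x)]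
  [∀ x, ContinuousSMul ℝ (W x)] [FiberBundle G W]
  {G₁ : Type*} [NormedAddCommGroup G₁] [NormedSpace ℝ G₁]
  {W₁ : B → Type*} [TopologicalSpace (TotalSpace G₁ W₁)] [∀ x, AddCommGroup (W₁ x)]
  [∀ x, Module ℝ (W₁ x)] [∀ x, TopologicalSpace (W₁ x)] [∀ x, IsTopologicalAddGroup (W₁ x)]
  [∀ x, ContinuousSMul ℝ (W₁ x)] [FiberBundle G₁ W₁]
  {G₂ : Type*} [NormedAddCommGroup G₂] [NormedSpace ℝ G₂]
  {W₂ : B → Type*} [TopologicalSpace (TotalSpace G₂ W₂)] [∀ x, AddCommGroup (W₂ x)]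
  [∀ x, Module ℝ (W₂ x)] [∀ x, TopologicalSpace (W₂ x)] [∀ x, IsTopologicalAddGroup (W₂ x)]
  [∀ x, ContinuousSMul ℝ (W₂ x)] [FiberBundle G₂ W₂]
  {G₃ : Type*} [NormedAddCommGroup G₃] [NormedSpace ℝ G₃]
  {W₃ : B → Type*} [TopologicalSpace (TotalSpace G₃ W₃)] [∀ x, AddCommGroup (W₃ x)]
  [∀ x, Module ℝ (W₃ x)] [∀ x, TopologicalSpace (W₃ x)] [∀ x, IsTopologicalAddGroup (W₃ x)]
  [∀ x, ContinuousSMul ℝ (W₃ x)] [FiberBundle G₃ W₃]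

/-- The direct sum of three connections. -/
def sumConnection (cov₁ : CovariantDerivative IB G₁ W₁) (cov₂ : CovariantDerivative IB G₂ W₂)
    (cov₃ : CovariantDerivative IB G₃ W₃)
    (p₁ : ∀ x, W x →ₗ[ℝ] W₁ x) (p₂ : ∀ x, W x →ₗ[ℝ] W₂ x) (p₃ : ∀ x, W x →ₗ[ℝ] W₃ x)
    (mk : ∀ x, W₁ x → W₂ x → W₃ x → W x) (h₁ : ∀ x a b c, p₁ x (mk x a b c) = a)
    (h₂ : ∀ x a b c, p₂ x (mk x a b c) = b) (h₃ : ∀ x a b c, p₃ x (mk x a b c) = c)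
    (hext : ∀ x (w w' : W x), p₁ x w = p₁ x w' → p₂ x w = p₂ x w' → p₃ x w = p₃ x w' → w = w')
    (hp : ∀ (σ : ∀ x, W x) (x : B), MDifferentiableAt IB (IB.prod 𝓘(ℝ, G))
      (fun y => (⟨y, σ y⟩ : TotalSpace G W)) x →
      MDifferentiableAt IB (IB.prod 𝓘(ℝ, G₁))
        (fun y => (⟨y, p₁ y (σ y)⟩ : TotalSpace G₁ W₁)) x ∧
      MDifferentiableAt IB (IB.prod 𝓘(ℝ, G₂))
        (fun y => (⟨y, p₂ y (σ y)⟩ : TotalSpace G₂ W₂)) x ∧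
      MDifferentiableAt IB (IB.prod 𝓘(ℝ, G₃))
        (fun y => (⟨y, p₃ y (σ y)⟩ : TotalSpace G₃ W₃)) x) :
    CovariantDerivative IB G W where
  toFun σ x :=
    have : FiniteDimensional ℝ (TangentSpace IB x) := inferInstanceAs (FiniteDimensional ℝ EB)
    have : T2Space (TangentSpace IB x) := inferInstanceAs (T2Space EB)
    LinearMap.toContinuousLinearMap
      { toFun := fun u => mk x (cov₁ (fun y => p₁ y (σ y)) x u) (cov₂ (fun y => p₂ y (σ y)) x u)
          (cov₃ (fun y => p₃ y (σ y)) x u)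
        map_add' := fun u u' => by
          -- `mk` is not assumed to be linear; linearity is verified on the three components, which
          -- determine an element.
          refine hext x _ _ ?_ ?_ ?_ <;> simp only [map_add, h₁, h₂, h₃]
        map_smul' := fun c u => by
          refine hext x _ _ ?_ ?_ ?_ <;> simp only [map_smul, h₁, h₂, h₃, RingHom.id_apply] }
  isCovariantDerivativeOnUniv :=
    { add := by
        intro σ τ x hσ hτ _
        ext u
        rw [add_apply]
        refine hext x _ _ ?_ ?_ ?_ <;> rw [map_add]
        · have h := cov₁.isCovariantDerivativeOnUniv.add (hp σ x hσ).1 (hp τ x hτ).1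
          have k : (fun y => p₁ y ((σ + τ) y)) = (fun y => p₁ y (σ y)) + fun y => p₁ y (τ y) :=
            funext fun y => map_add (p₁ y) (σ y) (τ y)
          refine (h₁ _ _ _ _).trans (Eq.trans ?_
            (congrArg₂ (· + ·) (h₁ _ _ _ _) (h₁ _ _ _ _)).symm)
          rw [k]
          exact congrArg (fun A => A u) h
        · have h := cov₂.isCovariantDerivativeOnUniv.add (hp σ x hσ).2.1 (hp τ x hτ).2.1
          have k : (fun y => p₂ y ((σ + τ) y)) = (fun y => p₂ y (σ y)) + fun y => p₂ y (τ y) :=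
            funext fun y => map_add (p₂ y) (σ y) (τ y)
          refine (h₂ _ _ _ _).trans (Eq.trans ?_
            (congrArg₂ (· + ·) (h₂ _ _ _ _) (h₂ _ _ _ _)).symm)
          rw [k]
          exact congrArg (fun A => A u) h
        · have h := cov₃.isCovariantDerivativeOnUniv.add (hp σ x hσ).2.2 (hp τ x hτ).2.2
          have k : (fun y => p₃ y ((σ + τ) y)) = (fun y => p₃ y (σ y)) + fun y => p₃ y (τ y) :=
            funext fun y => map_add (p₃ y) (σ y) (τ y)
          refine (h₃ _ _ _ _).trans (Eq.trans ?_
            (congrArg₂ (· + ·) (h₃ _ _ _ _) (h₃ _ _ _ _)).symm)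
          rw [k]
          exact congrArg (fun A => A u) h
      leibniz := by
        intro σ g x hσ hg _
        ext u
        rw [add_apply, smul_apply, ContinuousLinearMap.smulRight_apply]
        refine hext x _ _ ?_ ?_ ?_ <;> rw [map_add, map_smul, map_smul]
        · have h := cov₁.isCovariantDerivativeOnUniv.leibniz (hp σ x hσ).1 hg
          have k : (fun y => p₁ y ((g • σ) y)) = g • fun y => p₁ y (σ y) :=
            funext fun y => map_smul (p₁ y) (g y) (σ y)
          refine (h₁ _ _ _ _).trans (Eq.trans ?_
            (congrArg₂ (· + ·) (congrArg _ (h₁ _ _ _ _)) rfl).symm)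
          rw [k]
          exact congrArg (fun A => A u) h
        · have h := cov₂.isCovariantDerivativeOnUniv.leibniz (hp σ x hσ).2.1 hg
          have k : (fun y => p₂ y ((g • σ) y)) = g • fun y => p₂ y (σ y) :=
            funext fun y => map_smul (p₂ y) (g y) (σ y)
          refine (h₂ _ _ _ _).trans (Eq.trans ?_
            (congrArg₂ (· + ·) (congrArg _ (h₂ _ _ _ _)) rfl).symm)
          rw [k]
          exact congrArg (fun A => A u) h
        · have h := cov₃.isCovariantDerivativeOnUniv.leibniz (hp σ x hσ).2.2 hg
          have k : (fun y => p₃ y ((g • σ) y)) = g • fun y => p₃ y (σ y) :=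
            funext fun y => map_smul (p₃ y) (g y) (σ y)
          refine (h₃ _ _ _ _).trans (Eq.trans ?_
            (congrArg₂ (· + ·) (congrArg _ (h₃ _ _ _ _)) rfl).symm)
          rw [k]
          exact congrArg (fun A => A u) h }

end Sum

/-! ### The connection on the phase bundle: existence, uniqueness, smoothness. -/

section Phase

variable {E : Type*} [NormedAddCommGroup E] [NormedSpace ℝ E] [FiniteDimensional ℝ E]
  {M : Type*} [TopologicalSpace M] [ChartedSpace E M] [IsManifold 𝓘(ℝ, E) ∞ M]
  {F : Type*} [NormedAddCommGroup F] [NormedSpace ℝ F] [FiniteDimensional ℝ F]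
  {V : M → Type*} [TopologicalSpace (TotalSpace F V)] [∀ x, AddCommGroup (V x)]
  [∀ x, Module ℝ (V x)] [∀ x, TopologicalSpace (V x)] [∀ x, IsTopologicalAddGroup (V x)]
  [∀ x, ContinuousSMul ℝ (V x)] [FiberBundle F V] [VectorBundle ℝ F V]
  [ContMDiffVectorBundle ∞ F V 𝓘(ℝ, E)]

theorem finiteDimensional_normed_prod (G₁ G₂ : Type*) [NormedAddCommGroup G₁] [NormedSpace ℝ G₁]
    [FiniteDimensional ℝ G₁] [NormedAddCommGroup G₂] [NormedSpace ℝ G₂] [FiniteDimensional ℝ G₂] :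
    @FiniteDimensional ℝ (G₁ × G₂) _ NormedAddCommGroup.toAddCommGroup NormedSpace.toModule :=
  Module.Finite.prod

instance : FiniteDimensional ℝ (SplitModel E F) :=
  have := finiteDimensional_normed_prod ((E →L[ℝ] F) →L[ℝ]
    (E [⋀^Fin (Module.finrank ℝ E)]→L[ℝ] ℝ)) (E [⋀^Fin (Module.finrank ℝ E)]→L[ℝ] ℝ)
  finiteDimensional_normed_prod F (((E →L[ℝ] F) →L[ℝ]
    (E [⋀^Fin (Module.finrank ℝ E)]→L[ℝ] ℝ)) × (E [⋀^Fin (Module.finrank ℝ E)]→L[ℝ] ℝ))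

/-- The fibres `Hom(Hom(T_x M, V_x), Λⁿ T*_x M)`. -/
abbrev LinFibre (E : Type*) [NormedAddCommGroup E] [NormedSpace ℝ E]
    {M : Type*} [TopologicalSpace M] [ChartedSpace E M]
    (V : M → Type*) [∀ x, AddCommGroup (V x)]
    [∀ x, Module ℝ (V x)] [∀ x, TopologicalSpace (V x)] [∀ x, IsTopologicalAddGroup (V x)]
    [∀ x, ContinuousSMul ℝ (V x)] (x : M) : Type _ :=
  (TangentSpace 𝓘(ℝ, E) x →L[ℝ] V x) →L[ℝ] VolForm E x

/-- The model fibre of `VolForm`. -/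
abbrev VolModel (E : Type*) [NormedAddCommGroup E] [NormedSpace ℝ E] : Type _ :=
  E [⋀^Fin (Module.finrank ℝ E)]→L[ℝ] ℝ

variable {Γ : CovariantDerivative 𝓘(ℝ, E) F V}

/-- The bundle structure of `P` is transported along the splitting, so the coordinates of a section
are literally those of its three components. -/
theorem contMDiffAt_phase_iff {n : ℕ∞ω} {σ : ∀ x : M, PhaseFibre Γ x} {x : M} :
    ContMDiffAt 𝓘(ℝ, E) (phaseModel E F) n (fun y => (⟨y, σ y⟩ : Phase Γ)) x ↔
      ContMDiffAt 𝓘(ℝ, E) (𝓘(ℝ, E).prod 𝓘(ℝ, F)) n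
        (fun y => (⟨y, (phaseSplit Γ y (σ y)).1⟩ : TotalSpace F V)) x ∧
      ContMDiffAt 𝓘(ℝ, E) (𝓘(ℝ, E).prod 𝓘(ℝ, (E →L[ℝ] F) →L[ℝ] VolModel E)) n
        (fun y => (⟨y, (phaseSplit Γ y (σ y)).2.1⟩ :
          TotalSpace ((E →L[ℝ] F) →L[ℝ] VolModel E) (LinFibre E V))) x ∧
      ContMDiffAt 𝓘(ℝ, E) (𝓘(ℝ, E).prod 𝓘(ℝ, VolModel E)) n
        (fun y => (⟨y, (phaseSplit Γ y (σ y)).2.2⟩ :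
          TotalSpace (VolModel E) (fun x : M => VolForm E x))) x := by
  refine (contMDiffAt_section x).trans ?_
  refine (contMDiffAt_prod_module_iff (F₁ := F)
    (F₂ := ((E →L[ℝ] F) →L[ℝ] VolModel E) × VolModel E) _).trans ?_
  refine and_congr (contMDiffAt_section x).symm ?_
  refine (contMDiffAt_prod_module_iff (F₁ := (E →L[ℝ] F) →L[ℝ] VolModel E)
    (F₂ := VolModel E) _).trans ?_
  exact and_congr (contMDiffAt_section x).symm (contMDiffAt_section x).symm

theorem mdifferentiableAt_phase_iff {σ : ∀ x : M, PhaseFibre Γ x} {x : M} :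
    MDifferentiableAt 𝓘(ℝ, E) (phaseModel E F) (fun y => (⟨y, σ y⟩ : Phase Γ)) x ↔
      MDifferentiableAt 𝓘(ℝ, E) (𝓘(ℝ, E).prod 𝓘(ℝ, F))
        (fun y => (⟨y, (phaseSplit Γ y (σ y)).1⟩ : TotalSpace F V)) x ∧
      MDifferentiableAt 𝓘(ℝ, E) (𝓘(ℝ, E).prod 𝓘(ℝ, (E →L[ℝ] F) →L[ℝ] VolModel E))
        (fun y => (⟨y, (phaseSplit Γ y (σ y)).2.1⟩ :
          TotalSpace ((E →L[ℝ] F) →L[ℝ] VolModel E) (LinFibre E V))) x ∧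
      MDifferentiableAt 𝓘(ℝ, E) (𝓘(ℝ, E).prod 𝓘(ℝ, VolModel E))
        (fun y => (⟨y, (phaseSplit Γ y (σ y)).2.2⟩ :
          TotalSpace (VolModel E) (fun x : M => VolForm E x))) x := by
  refine (mdifferentiableAt_section 𝓘(ℝ, E) _).trans ?_
  refine (mdifferentiableAt_prod_module_iff (F₁ := F)
    (F₂ := ((E →L[ℝ] F) →L[ℝ] VolModel E) × VolModel E) _).trans ?_
  refine and_congr (mdifferentiableAt_section 𝓘(ℝ, E) _).symm ?_
  refine (mdifferentiableAt_prod_module_iff (F₁ := (E →L[ℝ] F) →L[ℝ] VolModel E)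
    (F₂ := VolModel E) _).trans ?_
  exact and_congr (mdifferentiableAt_section 𝓘(ℝ, E) _).symm
    (mdifferentiableAt_section 𝓘(ℝ, E) _).symm

variable (Γ)

/-- The component of `P_x` in `V_x`. -/
def phaseFst (x : M) : PhaseFibre Γ x →ₗ[ℝ] V x where
  toFun p := (phaseSplit Γ x p).1
  map_add' p q := congrArg Prod.fst (map_add (phaseSplit Γ x) p q)
  map_smul' c p := congrArg Prod.fst (map_smul (phaseSplit Γ x) c p)

/-- The component of `P_x` in `Hom(Hom(T_x M, V_x), Λⁿ T*_x M)`. -/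
def phaseSnd (x : M) : PhaseFibre Γ x →ₗ[ℝ] LinFibre E V x where
  toFun p := (phaseSplit Γ x p).2.1
  map_add' p q := congrArg (fun w => w.2.1) (map_add (phaseSplit Γ x) p q)
  map_smul' c p := congrArg (fun w => w.2.1) (map_smul (phaseSplit Γ x) c p)

/-- The component of `P_x` in `Λⁿ T*_x M`. -/
def phaseTrd (x : M) : PhaseFibre Γ x →ₗ[ℝ] VolForm E x where
  toFun p := (phaseSplit Γ x p).2.2
  map_add' p q := congrArg (fun w => w.2.2) (map_add (phaseSplit Γ x) p q)
  map_smul' c p := congrArg (fun w => w.2.2) (map_smul (phaseSplit Γ x) c p)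

variable {Γ}

theorem phase_ext {x : M} {p q : PhaseFibre Γ x} (h1 : phaseFst Γ x p = phaseFst Γ x q)
    (h2 : phaseSnd Γ x p = phaseSnd Γ x q) (h3 : phaseTrd Γ x p = phaseTrd Γ x q) : p = q :=
  (phaseSplit Γ x).injective (Prod.ext h1 (Prod.ext h2 h3))

/-- The element of `P_x` with given components. -/
def phaseMk (x : M) (v : V x) (q : LinFibre E V x) (c : VolForm E x) : PhaseFibre Γ x :=
  (phaseSplit Γ x).symm (show SplitDual E V x from (v, q, c))

theorem phaseFst_phaseMk (x : M) (v : V x) (q : LinFibre E V x) (c : VolForm E x) :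
    phaseFst Γ x (phaseMk x v q c) = v :=
  congrArg Prod.fst ((phaseSplit Γ x).apply_symm_apply (show SplitDual E V x from (v, q, c)))

theorem phaseSnd_phaseMk (x : M) (v : V x) (q : LinFibre E V x) (c : VolForm E x) :
    phaseSnd Γ x (phaseMk x v q c) = q :=
  congrArg (fun w => w.2.1)
    ((phaseSplit Γ x).apply_symm_apply (show SplitDual E V x from (v, q, c)))

theorem phaseTrd_phaseMk (x : M) (v : V x) (q : LinFibre E V x) (c : VolForm E x) :
    phaseTrd Γ x (phaseMk x v q c) = c :=
  congrArg (fun w => w.2.2)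
    ((phaseSplit Γ x).apply_symm_apply (show SplitDual E V x from (v, q, c)))

variable {Λ : CovariantDerivative 𝓘(ℝ, E) E (TangentSpace 𝓘(ℝ, E) : M → Type _)}

/-- The direct sum of connections on the three summands of the phase bundle. -/
def phaseConnection (Γ : CovariantDerivative 𝓘(ℝ, E) F V)
    (covQ : CovariantDerivative 𝓘(ℝ, E) ((E →L[ℝ] F) →L[ℝ] VolModel E)
      (LinFibre E V : M → Type _))
    (covL : CovariantDerivative 𝓘(ℝ, E) (VolModel E) (fun x : M => VolForm E x)) :
    CovariantDerivative 𝓘(ℝ, E) (SplitModel E F) (PhaseFibre Γ) :=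
  sumConnection Γ covQ covL (phaseFst Γ) (phaseSnd Γ) (phaseTrd Γ) phaseMk phaseFst_phaseMk
    phaseSnd_phaseMk phaseTrd_phaseMk (fun _ _ _ => phase_ext)
    fun _ _ h => mdifferentiableAt_phase_iff.1 h

theorem isPhaseConnection_phaseConnection
    {covJ : CovariantDerivative 𝓘(ℝ, E) (E →L[ℝ] F)
      (fun x : M => TangentSpace 𝓘(ℝ, E) x →L[ℝ] V x)}
    {covQ : CovariantDerivative 𝓘(ℝ, E) ((E →L[ℝ] F) →L[ℝ] VolModel E)
      (LinFibre E V : M → Type _)}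
    {covL : CovariantDerivative 𝓘(ℝ, E) (VolModel E) (fun x : M => VolForm E x)}
    (hJ : IsHomConnection Λ Γ covJ) (hL : IsFormConnection (Module.finrank ℝ E) Λ covL)
    (hQ : IsHomConnection covJ covL covQ) :
    IsPhaseConnection Γ Λ (phaseConnection Γ covQ covL) :=
  ⟨covJ, covL, covQ, hJ, hL, hQ, fun σ x _ u =>
    have h₁ := phaseFst_phaseMk (Γ := Γ) x (Γ (fun y => phaseFst Γ y (σ y)) x u)
      (covQ (fun y => phaseSnd Γ y (σ y)) x u) (covL (fun y => phaseTrd Γ y (σ y)) x u)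
    have h₂ := phaseSnd_phaseMk (Γ := Γ) x (Γ (fun y => phaseFst Γ y (σ y)) x u)
      (covQ (fun y => phaseSnd Γ y (σ y)) x u) (covL (fun y => phaseTrd Γ y (σ y)) x u)
    have h₃ := phaseTrd_phaseMk (Γ := Γ) x (Γ (fun y => phaseFst Γ y (σ y)) x u)
      (covQ (fun y => phaseSnd Γ y (σ y)) x u) (covL (fun y => phaseTrd Γ y (σ y)) x u)
    ⟨h₁, h₂, h₃⟩⟩

/-- The Hom construction is used twice: first for `Hom(TM, V)`, then for the homomorphisms from
there to `Λⁿ T*M`. Smoothness of `Γ` and `Λ` plays no role. -/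
theorem exists_isPhaseConnection (Γ : CovariantDerivative 𝓘(ℝ, E) F V)
    (Λ : CovariantDerivative 𝓘(ℝ, E) E (TangentSpace 𝓘(ℝ, E) : M → Type _)) :
    ∃ covP, IsPhaseConnection Γ Λ covP := by
  have : IsManifold 𝓘(ℝ, E) 1 M := inferInstance
  have : ContMDiffVectorBundle 1 F V 𝓘(ℝ, E) := inferInstance
  have h1 := isHomConnection_homConnection Λ Γ
  have h2 := exists_isFormConnection (l := Module.finrank ℝ E) Λ
  have h3 := isHomConnection_homConnection (homConnection Λ Γ)
    (formConnection (Module.finrank ℝ E) Λ)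
  exact ⟨_, isPhaseConnection_phaseConnection h1 h2 h3⟩

/-- The auxiliary connections on the summands may differ, but only at sections that are not
differentiable; a differentiable section of `P` has differentiable components. -/
theorem IsPhaseConnection.eq_of_mdifferentiableAt
    {covP covP' : CovariantDerivative 𝓘(ℝ, E) (SplitModel E F) (PhaseFibre Γ)}
    (h : IsPhaseConnection Γ Λ covP) (h' : IsPhaseConnection Γ Λ covP')
    {σ : ∀ x : M, PhaseFibre Γ x} {x : M}
    (hσ : MDifferentiableAt 𝓘(ℝ, E) (phaseModel E F) (fun y => (⟨y, σ y⟩ : Phase Γ)) x) :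
    covP σ x = covP' σ x := by
  obtain ⟨covJ, covL, covQ, hJ, hL, hQ, hP⟩ := h
  obtain ⟨covJ', covL', covQ', hJ', hL', hQ', hP'⟩ := h'
  obtain ⟨-, m2, m3⟩ := mdifferentiableAt_phase_iff.1 hσ
  ext u
  obtain ⟨a1, a2, a3⟩ := hP σ x hσ u
  obtain ⟨b1, b2, b3⟩ := hP' σ x hσ u
  refine (phaseSplit Γ x).injective (Prod.ext (a1.trans b1.symm) (Prod.ext ?_ ?_))
  · refine a2.trans (Eq.trans ?_ b2.symm)
    rw [hQ.eq_of_mdifferentiableAt hQ'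
      (fun s hs => hJ.eq_of_mdifferentiableAt hJ' (fun _ _ => rfl) (fun _ _ => rfl) hs)
      (fun s hs => hL.eq_of_mdifferentiableAt hL' hs) m2]
  · refine a3.trans (Eq.trans ?_ b3.symm)
    rw [hL.eq_of_mdifferentiableAt hL' m3]

theorem IsPhaseConnection.locSmooth
    {covP : CovariantDerivative 𝓘(ℝ, E) (SplitModel E F) (PhaseFibre Γ)}
    (h : IsPhaseConnection Γ Λ covP) (hΓ : LocSmooth Γ) (hΛ : LocSmooth Λ) : LocSmooth covP := by
  obtain ⟨covJ, covL, covQ, hJ, hL, hQ, hP⟩ := h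
  have hL' := hL.locSmooth hΛ
  have hQ' := hQ.locSmooth (hJ.locSmooth hΛ hΓ) hL'
  intro σ x hσ
  refine contMDiffAt_hom_of_constSec (V' := PhaseFibre Γ) fun a => ?_
  have hX : SmoothNear (F := E) 𝓘(ℝ, E)
      (constSec (trivializationAt E (TangentSpace 𝓘(ℝ, E) : M → Type _) x) a) x :=
    smoothNear_constSec _ _ (FiberBundle.mem_baseSet_trivializationAt _ _ x)
  set X := constSec (trivializationAt E (TangentSpace 𝓘(ℝ, E) : M → Type _) x) a
  have s1 : SmoothNear (F := F) 𝓘(ℝ, E) (fun y => (phaseSplit Γ y (σ y)).1) x := by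
    filter_upwards [hσ] with y hy using (contMDiffAt_phase_iff.1 hy).1
  have s2 : SmoothNear (F := (E →L[ℝ] F) →L[ℝ] VolModel E) (V := LinFibre E V) 𝓘(ℝ, E)
      (fun y => (phaseSplit Γ y (σ y)).2.1) x := by
    filter_upwards [hσ] with y hy using (contMDiffAt_phase_iff.1 hy).2.1
  have s3 : SmoothNear (F := VolModel E) (V := fun x : M => VolForm E x) 𝓘(ℝ, E)
      (fun y => (phaseSplit Γ y (σ y)).2.2) x := by
    filter_upwards [hσ] with y hy using (contMDiffAt_phase_iff.1 hy).2.2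
  -- The componentwise formula holds at all points near `x`, since `σ` is differentiable there; so
  -- the germs of the components are known.
  have hev : ∀ᶠ y in 𝓝 x, ∀ u,
        (phaseSplit Γ y (covP σ y u)).1 = Γ (fun y => (phaseSplit Γ y (σ y)).1) y u ∧
        (phaseSplit Γ y (covP σ y u)).2.1 = covQ (fun y => (phaseSplit Γ y (σ y)).2.1) y u ∧
        (phaseSplit Γ y (covP σ y u)).2.2 = covL (fun y => (phaseSplit Γ y (σ y)).2.2) y u := by
    filter_upwards [hσ] with y hy
    exact hP σ y (hy.mdifferentiableAt (by simp))
  refine contMDiffAt_phase_iff.2 ⟨?_, ?_, ?_⟩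
  · refine ((hΓ _ _ s1).clm_bundle_apply hX.contMDiffAt).congr_of_eventuallyEq ?_
    filter_upwards [hev] with y hy
    exact congrArg (TotalSpace.mk y) (hy (X y)).1
  · refine ((hQ' _ _ s2).clm_bundle_apply (E₂ := LinFibre E V) hX.contMDiffAt).congr_of_eventuallyEq ?_
    filter_upwards [hev] with y hy
    exact congrArg (TotalSpace.mk y) (hy (X y)).2.1
  · refine ((hL' _ _ s3).clm_bundle_apply (E₂ := fun x : M => VolForm E x)
      hX.contMDiffAt).congr_of_eventuallyEq ?_
    filter_upwards [hev] with y hy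
    exact congrArg (TotalSpace.mk y) (hy (X y)).2.2

end Phase

/-! ### The Lie bracket as a commutator of derivations. -/

section Bracket

variable {EB HB B : Type*} [NormedAddCommGroup EB] [NormedSpace ℝ EB] [CompleteSpace EB]
  [TopologicalSpace HB]
  {IB : ModelWithCorners ℝ EB HB} [TopologicalSpace B] [ChartedSpace HB B] [IsManifold IB ∞ B]
  [IB.Boundaryless]
  {G : Type*} [NormedAddCommGroup G] [NormedSpace ℝ G]

/-- The derivative of `f` along a vector field, in the chart at `x`. -/
theorem mvfderiv_apply_eq_fderiv {f : B → G} {x y : B} (hy : y ∈ (extChartAt IB x).source)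
    (hf : MDifferentiableAt IB 𝓘(ℝ, G) f y) (X : ∀ y : B, TangentSpace IB y) :
    mvfderiv IB f y (X y) = fderiv ℝ (f ∘ (extChartAt IB x).symm) (extChartAt IB x y)
      (VectorField.mpullbackWithin 𝓘(ℝ, EB) IB (extChartAt IB x).symm X (range IB)
        (extChartAt IB x y)) := by
  set φ := extChartAt IB x with hφ
  have hz : φ y ∈ φ.target := φ.map_source hy
  have hzy : φ.symm (φ y) = y := φ.left_inv hy
  have hr : range IB = univ := IB.range_eq_univ
  have h1 : MDifferentiableAt 𝓘(ℝ, EB) IB φ.symm (φ y) := by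
    have := mdifferentiableWithinAt_extChartAt_symm (I := IB) hz
    rwa [hr, mdifferentiableWithinAt_univ] at this
  have hf' : MDifferentiableAt IB 𝓘(ℝ, G) f (φ.symm (φ y)) := by rwa [hzy]
  have h2 := mfderiv_comp (φ y) hf' h1
  rw [← mfderiv_eq_fderiv, h2, VectorField.mpullbackWithin_apply]
  have h3 := isInvertible_mfderivWithin_extChartAt_symm (I := IB) hz
  have h4 := h3.self_apply_inverse (X (φ.symm (φ y)))
  rw [hr, mfderivWithin_univ] at h4 ⊢
  refine Eq.trans ?_ (congrArg (mfderiv IB 𝓘(ℝ, G) f (φ.symm (φ y))) h4).symm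
  rw [hzy]
  rfl

/-- The Lie bracket acts on functions as a commutator. -/
theorem mvfderiv_mlieBracket {f : B → G} {x : B} {X Y : ∀ y : B, TangentSpace IB y}
    (hf : ContMDiffAt IB 𝓘(ℝ, G) ∞ f x)
    (hX : MDifferentiableAt IB (IB.prod 𝓘(ℝ, EB)) (fun y => (⟨y, X y⟩ : TangentBundle IB B)) x)
    (hY : MDifferentiableAt IB (IB.prod 𝓘(ℝ, EB)) (fun y => (⟨y, Y y⟩ : TangentBundle IB B)) x)
    (hXf : MDifferentiableAt IB 𝓘(ℝ, G) (fun y => mvfderiv IB f y (X y)) x)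
    (hYf : MDifferentiableAt IB 𝓘(ℝ, G) (fun y => mvfderiv IB f y (Y y)) x) :
    mvfderiv IB f x (VectorField.mlieBracket IB X Y x) =
      mvfderiv IB (fun y => mvfderiv IB f y (Y y)) x (X x) -
        mvfderiv IB (fun y => mvfderiv IB f y (X y)) x (Y x) := by
  have : IsManifold IB 2 B := IsManifold.of_le (n := ∞) ENat.LEInfty.out
  set φ := extChartAt IB x with hφ
  have hx : x ∈ φ.source := mem_extChartAt_source x
  have hr : range IB = univ := IB.range_eq_univ
  have hfx : MDifferentiableAt IB 𝓘(ℝ, G) f x := hf.mdifferentiableAt (by simp)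
  have hfev : ∀ᶠ y in 𝓝 x, MDifferentiableAt IB 𝓘(ℝ, G) f y := by
    have h : ContMDiffAt IB 𝓘(ℝ, G) 1 f x := hf.of_le (by simp)
    filter_upwards [(contMDiffAt_iff_contMDiffAt_nhds (by simp)).1 h] with y hy
    exact hy.mdifferentiableAt (by simp)
  have hfs : ContDiffAt ℝ 2 (f ∘ φ.symm) (φ x) := by
    have h := (contMDiffAt_iff.1 (hf.of_le (m := 2) ENat.LEInfty.out)).2
    rw [hr, contDiffWithinAt_univ] at h
    exact h
  -- An equality of germs in the chart, so that it can be differentiated once more.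
  have key : ∀ Z : ∀ y : B, TangentSpace IB y,
      (fun y => mvfderiv IB f y (Z y)) ∘ φ.symm =ᶠ[𝓝 (φ x)] fun z =>
        fderiv ℝ (f ∘ φ.symm) z
          (VectorField.mpullbackWithin 𝓘(ℝ, EB) IB φ.symm Z (range IB) z) := by
    intro Z
    have h1 : ∀ᶠ z in 𝓝 (φ x), MDifferentiableAt IB 𝓘(ℝ, G) f (φ.symm z) := by
      have hc : Filter.Tendsto φ.symm (𝓝 (φ x)) (𝓝 x) := by
        have := (continuousAt_extChartAt_symm (I := IB) x).tendsto
        rwa [extChartAt_to_inv] at this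
      exact hc.eventually hfev
    filter_upwards [extChartAt_target_mem_nhds (I := IB) x, h1] with z hz hfz
    have h2 := mvfderiv_apply_eq_fderiv (φ.map_target hz) hfz Z
    rw [φ.right_inv hz] at h2
    exact h2
  have hd : ∀ Z : ∀ y : B, TangentSpace IB y,
      MDifferentiableAt IB (IB.prod 𝓘(ℝ, EB)) (fun y => (⟨y, Z y⟩ : TangentBundle IB B)) x →
      DifferentiableAt ℝ (VectorField.mpullbackWithin 𝓘(ℝ, EB) IB φ.symm Z (range IB)) (φ x) := by
    intro Z hZ
    have h := MDifferentiableWithinAt.differentiableWithinAt_mpullbackWithin_vectorField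
      (s := univ) hZ.mdifferentiableWithinAt
    rw [preimage_univ, univ_inter] at h
    refine differentiableWithinAt_univ.1 (h.mono_of_mem_nhdsWithin ?_)
    rw [hr]
    exact Filter.univ_mem
  -- In the chart this is the commutator identity in a vector space, which rests on the symmetry of
  -- the second derivative.
  have h := VectorField.fderiv_apply_lieBracket hfs (by simp) (hd Y hY) (hd X hX)
  rw [mvfderiv_apply_eq_fderiv hx hXf Y, mvfderiv_apply_eq_fderiv hx hYf X, (key X).fderiv_eq,
    (key Y).fderiv_eq]
  refine Eq.trans ?_ h
  have h1 : MDifferentiableAt 𝓘(ℝ, EB) 𝓘(ℝ, G) (f ∘ φ.symm) (φ x) :=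
    (hfs.differentiableAt (by simp)).mdifferentiableAt
  have h2 := mfderiv_comp x h1 (mdifferentiableAt_extChartAt (I := IB) (mem_chart_source HB x))
  have h3 : (f ∘ φ.symm) ∘ φ =ᶠ[𝓝 x] f := by
    filter_upwards [extChartAt_source_mem_nhds (I := IB) x] with y hy
    exact congrArg f (φ.left_inv hy)
  -- The bracket on the manifold is the bracket in the chart, pulled back by the inverse of the
  -- differential of the chart; applying the differential undoes this.
  have h4 : ∀ w : EB, mfderiv IB 𝓘(ℝ, EB) φ x ((mfderiv IB 𝓘(ℝ, EB) φ x).inverse w) = w :=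
    fun w => (isInvertible_mfderiv_extChartAt (I := IB) hx).self_apply_inverse w
  have h5 := h3.mfderiv_eq (I := IB) (I' := 𝓘(ℝ, G))
  rw [h2] at h5
  have h6 : ∀ v, mvfderiv IB f x v = fderiv ℝ (f ∘ φ.symm) (φ x) (mfderiv IB 𝓘(ℝ, EB) φ x v) := by
    intro v
    rw [← mfderiv_eq_fderiv]
    exact (congrArg (fun A : TangentSpace IB x →L[ℝ] G => A v) h5).symm
  rw [h6]
  refine congrArg (fderiv ℝ (f ∘ φ.symm) (φ x)) (Eq.trans (h4 _) ?_)
  rw [preimage_univ, univ_inter, hr]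
  exact congrFun VectorField.lieBracketWithin_univ (φ x)

end Bracket

/-! ### The curvature is a smooth tensor. -/

section Curvature

variable {EB HB B : Type*} [NormedAddCommGroup EB] [NormedSpace ℝ EB] [FiniteDimensional ℝ EB]
  [TopologicalSpace HB]
  {IB : ModelWithCorners ℝ EB HB} [TopologicalSpace B] [ChartedSpace HB B] [IsManifold IB 1 B]
  [IsManifold IB ∞ B]
  [IB.Boundaryless]
  {F : Type*} [NormedAddCommGroup F] [NormedSpace ℝ F] [FiniteDimensional ℝ F]
  {V : B → Type*} [TopologicalSpace (TotalSpace F V)] [∀ x, AddCommGroup (V x)]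
  [∀ x, Module ℝ (V x)] [∀ x, TopologicalSpace (V x)] [∀ x, IsTopologicalAddGroup (V x)]
  [∀ x, ContinuousSMul ℝ (V x)]
  [FiberBundle F V] [VectorBundle ℝ F V] [ContMDiffVectorBundle ∞ F V IB]

/-- The expression `∇_X ∇_Y s - ∇_Y ∇_X s - ∇_[X, Y] s`. -/
def curvSec (cov : CovariantDerivative IB F V) (X Y : ∀ y : B, TangentSpace IB y) (s : ∀ y, V y)
    (x : B) : V x :=
  cov (fun y => cov s y (Y y)) x (X x) - cov (fun y => cov s y (X y)) x (Y x)
    - cov s x (VectorField.mlieBracket IB X Y x)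

variable {cov : CovariantDerivative IB F V} {X X' Y Y' : ∀ y : B, TangentSpace IB y}
  {s s' : ∀ y, V y} {x : B}

theorem curvSec_swap (cov : CovariantDerivative IB F V) (X Y : ∀ y : B, TangentSpace IB y)
    (s : ∀ y, V y) (x : B) : curvSec cov X Y s x = -curvSec cov Y X s x := by
  rw [curvSec, curvSec, VectorField.mlieBracket_swap_apply (V := X), map_neg]
  abel

theorem LocSmooth.mdifferentiableAt_apply (hc : LocSmooth cov) (hs : SmoothNear (F := F) IB s x)
    (hX : MDifferentiableAt IB (IB.prod 𝓘(ℝ, EB)) (fun y => (⟨y, X y⟩ : TangentBundle IB B)) x) :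
    MDifferentiableAt IB (IB.prod 𝓘(ℝ, F))
      (fun y => (⟨y, cov s y (X y)⟩ : TotalSpace F V)) x :=
  ((hc s x hs).mdifferentiableAt (by simp)).clm_bundle_apply hX

theorem LocSmooth.smoothNear_apply (hc : LocSmooth cov) (hs : SmoothNear (F := F) IB s x)
    (hX : SmoothNear (F := EB) IB X x) : SmoothNear (F := F) IB (fun y => cov s y (X y)) x := by
  filter_upwards [hc.smoothNear hs, hX] with y h1 h2
  exact h1.clm_bundle_apply h2

/-- The Leibniz term `(Y f) ∇_X s` of `∇_Y (f ∇_X s)` is cancelled by the extra term of the bracket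
`[f X, Y] = f [X, Y] - (Y f) X`. The argument `Y` is treated by antisymmetry. -/
theorem tensorialAt_curvSec (hc : LocSmooth cov) (hs : SmoothNear (F := F) IB s x) :
    TensorialAt IB EB (fun X => curvSec cov X Y s x) x := by
  have : CompleteSpace EB := FiniteDimensional.complete ℝ EB
  have : IsManifold IB 2 B := IsManifold.of_le (n := ∞) ENat.LEInfty.out
  constructor
  · intro f X hf hX
    have h1 := cov.isCovariantDerivativeOnUniv.leibniz (hc.mdifferentiableAt_apply hs hX) hf
    have h2 : (fun y => cov s y ((f • X) y)) = f • fun y => cov s y (X y) :=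
      funext fun y => map_smul (cov s y) _ _
    simp only [curvSec]
    rw [h2, h1, VectorField.mlieBracket_smul_left hf hX]
    simp only [add_apply, smul_apply, ContinuousLinearMap.smulRight_apply, map_add, map_smul,
      Pi.smul_apply']
    module
  · intro X X' hX hX'
    have h1 := cov.isCovariantDerivativeOnUniv.add (hc.mdifferentiableAt_apply hs hX)
      (hc.mdifferentiableAt_apply hs hX')
    have h2 : (fun y => cov s y ((X + X') y)) = (fun y => cov s y (X y)) + fun y => cov s y (X' y) :=
      funext fun y => map_add (cov s y) _ _
    simp only [curvSec]
    rw [h2, h1, VectorField.mlieBracket_add_left hX hX']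
    simp only [add_apply, map_add, Pi.add_apply]
    abel

theorem curvSec_section_add (hc : LocSmooth cov) (hs : SmoothNear (F := F) IB s x)
    (hs' : SmoothNear (F := F) IB s' x)
    (hX : MDifferentiableAt IB (IB.prod 𝓘(ℝ, EB)) (fun y => (⟨y, X y⟩ : TangentBundle IB B)) x)
    (hY : MDifferentiableAt IB (IB.prod 𝓘(ℝ, EB)) (fun y => (⟨y, Y y⟩ : TangentBundle IB B)) x) :
    curvSec cov X Y (fun y => s y + s' y) x = curvSec cov X Y s x + curvSec cov X Y s' x := by
  have key : ∀ᶠ y in 𝓝 x, cov (fun y => s y + s' y) y = cov s y + cov s' y := by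
    filter_upwards [hs.eventually, hs'.eventually] with y h1 h2
    exact cov.isCovariantDerivativeOnUniv.add h1.mdifferentiableAt h2.mdifferentiableAt
  have h3 : ∀ Z : ∀ y : B, TangentSpace IB y,
      MDifferentiableAt IB (IB.prod 𝓘(ℝ, EB)) (fun y => (⟨y, Z y⟩ : TangentBundle IB B)) x →
      cov (fun y => cov (fun y => s y + s' y) y (Z y)) x =
        cov (fun y => cov s y (Z y)) x + cov (fun y => cov s' y (Z y)) x := by
    intro Z hZ
    have h4 := cov.isCovariantDerivativeOnUniv.add (hc.mdifferentiableAt_apply hs hZ)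
      (hc.mdifferentiableAt_apply hs' hZ)
    rw [← h4]
    refine (cov_congr cov (mdifferentiableAt_add_section (hc.mdifferentiableAt_apply hs hZ)
      (hc.mdifferentiableAt_apply hs' hZ)) (key.mono fun y hy => ?_)).symm
    rw [hy]; rfl
  simp only [curvSec]
  rw [h3 X hX, h3 Y hY, key.self_of_nhds]
  simp only [add_apply]
  abel

/-- The terms with one derivative of `f` and one of `s` are symmetric in `X` and `Y` and cancel. The
terms with two derivatives of `f` combine to `(X Y f - Y X f - [X, Y] f) s`, which is zero by
`mvfderiv_mlieBracket`. -/
theorem curvSec_section_smul (hc : LocSmooth cov) {f : B → ℝ}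
    (hf : ∀ᶠ y in 𝓝 x, ContMDiffAt IB 𝓘(ℝ, ℝ) ∞ f y) (hs : SmoothNear (F := F) IB s x)
    (hX : SmoothNear (F := EB) IB X x) (hY : SmoothNear (F := EB) IB Y x) :
    curvSec cov X Y (fun y => f y • s y) x = f x • curvSec cov X Y s x := by
  have : CompleteSpace EB := FiniteDimensional.complete ℝ EB
  have hfx : MDifferentiableAt IB 𝓘(ℝ, ℝ) f x := hf.self_of_nhds.mdifferentiableAt (by simp)
  have key : ∀ᶠ y in 𝓝 x, cov (fun y => f y • s y) y =
      f y • cov s y + (mvfderiv IB f y).smulRight (s y) := by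
    filter_upwards [hf, hs.eventually] with y h1 h2
    exact cov.isCovariantDerivativeOnUniv.leibniz h2.mdifferentiableAt
      (h1.mdifferentiableAt (by simp))
  have hd : ∀ Z : ∀ y : B, TangentSpace IB y, SmoothNear (F := EB) IB Z x →
      MDifferentiableAt IB 𝓘(ℝ, ℝ) (fun y => mvfderiv IB f y (Z y)) x := fun Z hZ =>
    (contMDiffAt_mvfderiv_apply hf.self_of_nhds hZ.contMDiffAt).mdifferentiableAt (by simp)
  have h3 : ∀ Z : ∀ y : B, TangentSpace IB y, SmoothNear (F := EB) IB Z x →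
      cov (fun y => cov (fun y => f y • s y) y (Z y)) x =
        (f x • cov (fun y => cov s y (Z y)) x + (mvfderiv IB f x).smulRight (cov s x (Z x))) +
        (mvfderiv IB f x (Z x) • cov s x +
          (mvfderiv IB (fun y => mvfderiv IB f y (Z y)) x).smulRight (s x)) := by
    intro Z hZ
    have hsZ := hc.mdifferentiableAt_apply hs hZ.mdifferentiableAt
    have h4 := cov.isCovariantDerivativeOnUniv.leibniz hsZ hfx
    have h5 := cov.isCovariantDerivativeOnUniv.leibniz hs.mdifferentiableAt (hd Z hZ)
    have h6 := cov.isCovariantDerivativeOnUniv.add (hfx.smul_section hsZ)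
      ((hd Z hZ).smul_section hs.mdifferentiableAt)
    rw [← h4, ← h5]
    refine Eq.trans ?_ h6
    refine (cov_congr cov (mdifferentiableAt_add_section (hfx.smul_section hsZ)
      ((hd Z hZ).smul_section hs.mdifferentiableAt)) (key.mono fun y hy => ?_)).symm
    rw [hy]; rfl
  have h7 := mvfderiv_mlieBracket hf.self_of_nhds hX.mdifferentiableAt hY.mdifferentiableAt
    (hd X hX) (hd Y hY)
  simp only [curvSec]
  rw [h3 X hX, h3 Y hY, key.self_of_nhds]
  simp only [add_apply, smul_apply, ContinuousLinearMap.smulRight_apply, h7]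
  module

theorem curvSec_section_congr (hc : LocSmooth cov) (hs : SmoothNear (F := F) IB s x)
    (hs' : ∀ᶠ y in 𝓝 x, s' y = s y)
    (hX : MDifferentiableAt IB (IB.prod 𝓘(ℝ, EB)) (fun y => (⟨y, X y⟩ : TangentBundle IB B)) x)
    (hY : MDifferentiableAt IB (IB.prod 𝓘(ℝ, EB)) (fun y => (⟨y, Y y⟩ : TangentBundle IB B)) x) :
    curvSec cov X Y s' x = curvSec cov X Y s x := by
  have key : ∀ᶠ y in 𝓝 x, cov s y = cov s' y := by
    filter_upwards [hs.eventually, eventually_eventually_nhds.2 hs'] with y h1 h2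
    exact cov_congr cov h1.mdifferentiableAt (h2.mono fun _ h => h.symm)
  have h3 : ∀ Z : ∀ y : B, TangentSpace IB y,
      MDifferentiableAt IB (IB.prod 𝓘(ℝ, EB)) (fun y => (⟨y, Z y⟩ : TangentBundle IB B)) x →
      cov (fun y => cov s' y (Z y)) x = cov (fun y => cov s y (Z y)) x := fun Z hZ =>
    (cov_congr cov (hc.mdifferentiableAt_apply hs hZ) (key.mono fun y hy => by rw [hy])).symm
  simp only [curvSec]
  rw [h3 X hX, h3 Y hY, ← key.self_of_nhds]

theorem curvSec_section_sum (hc : LocSmooth cov) {ι : Type*} (t : Finset ι) {f : ι → B → ℝ}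
    {S : ι → ∀ y, V y} (hf : ∀ i, ∀ᶠ y in 𝓝 x, ContMDiffAt IB 𝓘(ℝ, ℝ) ∞ (f i) y)
    (hS : ∀ i, SmoothNear (F := F) IB (S i) x)
    (hX : SmoothNear (F := EB) IB X x) (hY : SmoothNear (F := EB) IB Y x) :
    curvSec cov X Y (fun y => ∑ i ∈ t, f i y • S i y) x =
      ∑ i ∈ t, f i x • curvSec cov X Y (S i) x := by
  classical
  have hfS : ∀ i, SmoothNear (F := F) IB (fun y => f i y • S i y) x := by
    intro i
    filter_upwards [hf i, hS i] with y h1 h2 using h1.smul_section h2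
  induction t using Finset.induction_on with
  | empty =>
    simp only [Finset.sum_empty]
    have h0 : ∀ y, cov (fun y => (0 : V y)) y = 0 := fun y => congrFun cov.zero y
    simp only [curvSec, h0, zero_apply, sub_zero]
  | insert a t ha ih =>
    simp only [Finset.sum_insert ha]
    rw [curvSec_section_add hc (hfS a) ?_ hX.mdifferentiableAt hY.mdifferentiableAt, ih,
      curvSec_section_smul hc (hf a) (hS a) hX hY]
    filter_upwards [Filter.eventually_all_finset t |>.2 fun i _ => hfS i] with y hy
    exact ContMDiffAt.sum_section fun i hi => hy i hi

/-- Expand `s` in a constant frame: its coefficients vanish at `x`, and the curvature is linear over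
functions. `TensorialAt` does not apply to the section argument, because linearity is available only
for functions and sections that are smooth near `x`. -/
theorem curvSec_eq_zero (hc : LocSmooth cov) (hs : SmoothNear (F := F) IB s x)
    (hX : SmoothNear (F := EB) IB X x) (hY : SmoothNear (F := EB) IB Y x) (h0 : s x = 0) :
    curvSec cov X Y s x = 0 := by
  let b := Module.finBasis ℝ F
  set e := trivializationAt F V x with he
  have hx : x ∈ e.baseSet := FiberBundle.mem_baseSet_trivializationAt F V x
  obtain ⟨f, hf, hfs⟩ := hs.exists_sum_constSec b
  have hS : ∀ i, SmoothNear (F := F) IB (constSec e (b i)) x := fun i =>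
    smoothNear_constSec _ _ hx
  have hf0 : ∀ i, f i x = 0 := by
    have h1 := hfs.self_of_nhds
    rw [h0] at h1
    have h2 := congrArg (e.continuousLinearMapAt ℝ x) h1
    rw [map_zero, map_sum] at h2
    have h3 : ∑ i, f i x • b i = 0 := by
      rw [h2]
      refine Finset.sum_congr rfl fun i _ => ?_
      rw [map_smul]
      exact congrArg _ (e.continuousLinearMapAt_symmL hx (b i)).symm
    exact Fintype.linearIndependent_iff.1 b.linearIndependent _ h3
  have h4 : SmoothNear (F := F) IB (fun y => ∑ i, f i y • constSec e (b i) y) x :=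
    hs.congr (hfs.mono fun _ h => h.symm)
  rw [curvSec_section_congr hc h4 hfs hX.mdifferentiableAt hY.mdifferentiableAt,
    curvSec_section_sum hc Finset.univ hf hS hX hY]
  exact Finset.sum_eq_zero fun i _ => by rw [hf0 i, zero_smul]

/-- The vector fields are exchanged by tensoriality, the second one after a swap. The two sections
differ by one that vanishes at `x`. -/
theorem curvSec_congr (hc : LocSmooth cov) (hs : SmoothNear (F := F) IB s x)
    (hs' : SmoothNear (F := F) IB s' x)
    (hX : SmoothNear (F := EB) IB X x) (hX' : SmoothNear (F := EB) IB X' x)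
    (hY : SmoothNear (F := EB) IB Y x) (hY' : SmoothNear (F := EB) IB Y' x)
    (eX : X x = X' x) (eY : Y x = Y' x) (es : s x = s' x) :
    curvSec cov X Y s x = curvSec cov X' Y' s' x := by
  have h1 : curvSec cov X Y s x = curvSec cov X' Y s x :=
    (tensorialAt_curvSec hc hs).pointwise hX.mdifferentiableAt
      hX'.mdifferentiableAt eX
  have h2 : curvSec cov Y X' s x = curvSec cov Y' X' s x :=
    (tensorialAt_curvSec hc hs).pointwise hY.mdifferentiableAt
      hY'.mdifferentiableAt eY
  rw [h1, curvSec_swap, h2, ← curvSec_swap]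
  have hd : SmoothNear (F := F) IB (fun y => s y - s' y) x := by
    filter_upwards [hs, hs'] with y a b using a.sub_section b
  have h3 := curvSec_eq_zero hc hd hX' hY' (by rw [es, sub_self])
  have h4 := curvSec_section_add hc hs' hd hX'.mdifferentiableAt hY'.mdifferentiableAt
  simp only [add_sub_cancel] at h4
  rw [h4, h3, add_zero]

/-- Frees the pointwise curvature from the particular extensions in its definition. -/
theorem curvature_eq_curvSec (hc : LocSmooth cov) (hs : SmoothNear (F := F) IB s x)
    (hX : SmoothNear (F := EB) IB X x) (hY : SmoothNear (F := EB) IB Y x) :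
    curvature cov x (X x) (Y x) (s x) = curvSec cov X Y s x :=
by
  refine Eq.trans ?_ (curvSec_congr hc (smoothNear_extend _) hs (smoothNear_extend _) hX (smoothNear_extend _) hY
    (FiberBundle.extend_apply_self _ _) (FiberBundle.extend_apply_self _ _)
    (FiberBundle.extend_apply_self _ _))
  simp only [curvSec, FiberBundle.extend_apply_self]
  rfl

/-- `constExt` is linear in the vector, so linearity of the pointwise curvature in each argument can
be read off from `curvSec`. -/
theorem curvature_eq_constExt (hc : LocSmooth cov) (u w : TangentSpace IB x) (v : V x) :
    curvature cov x u w v = curvSec cov (constExt EB u) (constExt EB w) (constExt F v) x := by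
  have h := curvature_eq_curvSec hc (smoothNear_constExt v)
    (smoothNear_constExt (IB := IB) (F := EB) u) (smoothNear_constExt (IB := IB) (F := EB) w)
  rwa [constExt_self, constExt_self, constExt_self] at h

theorem curvature_swap (hc : LocSmooth cov) (u w : TangentSpace IB x) (v : V x) :
    curvature cov x u w v = -curvature cov x w u v := by
  rw [curvature_eq_constExt hc, curvature_eq_constExt hc, curvSec_swap]

theorem curvature_add_left (hc : LocSmooth cov) (u u' w : TangentSpace IB x) (v : V x) :
    curvature cov x (u + u') w v = curvature cov x u w v + curvature cov x u' w v := by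
  rw [curvature_eq_constExt hc, curvature_eq_constExt hc, curvature_eq_constExt hc, constExt_add]
  exact (tensorialAt_curvSec hc (smoothNear_constExt v)).add
    (smoothNear_constExt (IB := IB) (F := EB) u).mdifferentiableAt
    (smoothNear_constExt (IB := IB) (F := EB) u').mdifferentiableAt

theorem curvature_smul_left (hc : LocSmooth cov) (c : ℝ) (u w : TangentSpace IB x) (v : V x) :
    curvature cov x (c • u) w v = c • curvature cov x u w v := by
  rw [curvature_eq_constExt hc, curvature_eq_constExt hc, constExt_smul]
  exact (tensorialAt_curvSec hc (smoothNear_constExt v)).smul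
    (f := fun _ => c) mdifferentiableAt_const
    (smoothNear_constExt (IB := IB) (F := EB) u).mdifferentiableAt

theorem curvature_add_right (hc : LocSmooth cov) (u w w' : TangentSpace IB x) (v : V x) :
    curvature cov x u (w + w') v = curvature cov x u w v + curvature cov x u w' v := by
  rw [curvature_swap hc, curvature_add_left hc, neg_add, ← curvature_swap hc, ← curvature_swap hc]

theorem curvature_smul_right (hc : LocSmooth cov) (c : ℝ) (u w : TangentSpace IB x) (v : V x) :
    curvature cov x u (c • w) v = c • curvature cov x u w v := by
  rw [curvature_swap hc, curvature_smul_left hc, ← smul_neg, ← curvature_swap hc]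

theorem curvature_section_add (hc : LocSmooth cov) (u w : TangentSpace IB x) (v v' : V x) :
    curvature cov x u w (v + v') = curvature cov x u w v + curvature cov x u w v' := by
  rw [curvature_eq_constExt hc, curvature_eq_constExt hc, curvature_eq_constExt hc, constExt_add]
  exact curvSec_section_add hc (smoothNear_constExt v) (smoothNear_constExt v')
    (smoothNear_constExt (IB := IB) (F := EB) u).mdifferentiableAt
    (smoothNear_constExt (IB := IB) (F := EB) w).mdifferentiableAt

theorem curvature_section_smul (hc : LocSmooth cov) (c : ℝ) (u w : TangentSpace IB x) (v : V x) :
    curvature cov x u w (c • v) = c • curvature cov x u w v := by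
  rw [curvature_eq_constExt hc, curvature_eq_constExt hc, constExt_smul]
  exact curvSec_section_smul (f := fun _ => c) hc
    (Filter.Eventually.of_forall fun _ => contMDiffAt_const) (smoothNear_constExt v)
    (smoothNear_constExt (IB := IB) (F := EB) u) (smoothNear_constExt (IB := IB) (F := EB) w)

/-- Near `x` the pointwise curvature agrees with `curvSec` for the given fields, which is composed
of covariant derivatives and a bracket; at order `∞` neither loses smoothness. -/
theorem smoothNear_curvature (hc : LocSmooth cov) (hs : SmoothNear (F := F) IB s x)
    (hX : SmoothNear (F := EB) IB X x) (hY : SmoothNear (F := EB) IB Y x) :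
    SmoothNear (F := F) IB (fun y => curvature cov y (X y) (Y y) (s y)) x := by
  have : CompleteSpace EB := FiniteDimensional.complete ℝ EB
  have : IsManifold IB (minSmoothness ℝ 2) B := by
    rw [minSmoothness_of_isRCLikeNormedField]
    exact IsManifold.of_le (n := ∞) ENat.LEInfty.out
  have : IsManifold IB (∞ + 1) B := ‹IsManifold IB ∞ B›
  have hb : SmoothNear (F := EB) IB (VectorField.mlieBracket IB X Y) x := by
    filter_upwards [hX, hY] with y h1 h2
    exact ContMDiffAt.mlieBracket_vectorField (m := ⊤) (n := ⊤) h1 h2 (by simp)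
  have h1 := hc.smoothNear_apply (hc.smoothNear_apply hs hY) hX
  have h2 := hc.smoothNear_apply (hc.smoothNear_apply hs hX) hY
  have h3 := hc.smoothNear_apply hs hb
  have h4 : SmoothNear (F := F) IB (fun y => curvSec cov X Y s y) x := by
    filter_upwards [h1, h2, h3] with y a b c using (a.sub_section b).sub_section c
  refine h4.congr ?_
  filter_upwards [hs.eventually, hX.eventually, hY.eventually] with y a b c
  exact curvature_eq_curvSec hc a b c

end Curvature

/-! ### Horizontal and vertical coordinates on the tangent bundle of the total space. -/

section LiftCoordinates

variable {E : Type*} [NormedAddCommGroup E] [NormedSpace ℝ E] [FiniteDimensional ℝ E]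
  {M : Type*} [TopologicalSpace M] [ChartedSpace E M] [IsManifold 𝓘(ℝ, E) ∞ M]
  {F : Type*} [NormedAddCommGroup F] [NormedSpace ℝ F] [FiniteDimensional ℝ F]
  {V : M → Type*} [TopologicalSpace (TotalSpace F V)] [∀ x, AddCommGroup (V x)]
  [∀ x, Module ℝ (V x)] [∀ x, TopologicalSpace (V x)] [∀ x, IsTopologicalAddGroup (V x)]
  [∀ x, ContinuousSMul ℝ (V x)] [FiberBundle F V] [VectorBundle ℝ F V]
  [ContMDiffVectorBundle ∞ F V 𝓘(ℝ, E)]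
  {G : Type*} [NormedAddCommGroup G] [NormedSpace ℝ G]
  {cov : CovariantDerivative 𝓘(ℝ, E) F V}

theorem cov_constSec_add (cov : CovariantDerivative 𝓘(ℝ, E) F V)
    (e : Trivialization F (π F V)) [MemTrivializationAtlas e] {x : M} (hx : x ∈ e.baseSet)
    (b b' : F) :
    cov (constSec e (b + b')) x = cov (constSec e b) x + cov (constSec e b') x := by
  rw [constSec_add]
  exact cov.isCovariantDerivativeOnUniv.add
    (smoothNear_constSec e b hx).mdifferentiableAt (smoothNear_constSec e b' hx).mdifferentiableAt

theorem cov_constSec_smul (cov : CovariantDerivative 𝓘(ℝ, E) F V)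
    (e : Trivialization F (π F V)) [MemTrivializationAtlas e] {x : M} (hx : x ∈ e.baseSet)
    (c : ℝ) (b : F) :
    cov (constSec e (c • b)) x = c • cov (constSec e b) x := by
  have h := cov.isCovariantDerivativeOnUniv.leibniz
    (smoothNear_constSec (IB := 𝓘(ℝ, E)) e b hx).mdifferentiableAt
    (mdifferentiableAt_const (c := c))
  rw [constSec_smul]
  refine Eq.trans h ?_
  rw [mvfderiv_const]
  ext u
  simp

/-- Lets `b` vary with the point of the fibre while only finitely many fixed sections are
differentiated. -/
theorem cov_constSec_eq_sum (cov : CovariantDerivative 𝓘(ℝ, E) F V)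
    (e : Trivialization F (π F V)) [MemTrivializationAtlas e] {x : M} (hx : x ∈ e.baseSet)
    {ι : Type*} [Fintype ι] (B : Module.Basis ι ℝ F) (b : F) :
    cov (constSec e b) x = ∑ i, B.repr b i • cov (constSec e (B i)) x := by
  let L : F →ₗ[ℝ] TangentSpace 𝓘(ℝ, E) x →L[ℝ] V x :=
    { toFun := fun b => cov (constSec e b) x
      map_add' := cov_constSec_add cov e hx
      map_smul' := cov_constSec_smul cov e hx }
  have h : L b = L (∑ i, B.repr b i • B i) := by rw [B.sum_repr]
  rw [map_sum] at h
  exact h.trans (Finset.sum_congr rfl fun i _ => map_smul L _ _)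

/-- The connection map `K : T_q V → V_x`, `x = π(q)`. -/
def connMap (cov : CovariantDerivative 𝓘(ℝ, E) F V) (q : TotalSpace F V) :
    TangentSpace (𝓘(ℝ, E).prod 𝓘(ℝ, F)) q →L[ℝ] V q.proj :=
  vertInv q ∘L (ContinuousLinearMap.id ℝ _ - horLift cov q ∘L projTangent q)

theorem projTangent_horLift (cov : CovariantDerivative 𝓘(ℝ, E) F V) (q : TotalSpace F V)
    (u : TangentSpace 𝓘(ℝ, E) q.proj) : projTangent q (horLift cov q u) = u :=
  congrArg (fun A : TangentSpace 𝓘(ℝ, E) q.proj →L[ℝ] TangentSpace 𝓘(ℝ, E) q.proj => A u)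
    (projTangent_comp_horLift cov q)

/-- Subtracting the horizontal lift of its projection makes `ξ` vertical, and on vertical vectors
`vertLift` inverts `vertInv`. -/
theorem horLift_add_vertLift (cov : CovariantDerivative 𝓘(ℝ, E) F V) (q : TotalSpace F V)
    (ξ : TangentSpace (𝓘(ℝ, E).prod 𝓘(ℝ, F)) q) :
    horLift cov q (projTangent q ξ) + vertLift q (connMap cov q ξ) = ξ := by
  have h : vertLift q (connMap cov q ξ) = ξ - horLift cov q (projTangent q ξ) := by
    refine vertLift_vertInv q (ξ - horLift cov q (projTangent q ξ)) ?_
    rw [map_sub, projTangent_horLift, sub_self]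
  rw [h]
  abel

theorem connMap_horLift (cov : CovariantDerivative 𝓘(ℝ, E) F V) (q : TotalSpace F V)
    (u : TangentSpace 𝓘(ℝ, E) q.proj) : connMap cov q (horLift cov q u) = 0 := by
  change vertInv q (horLift cov q u - horLift cov q (projTangent q (horLift cov q u))) = 0
  rw [projTangent_horLift, sub_self, map_zero]

theorem connMap_vertLift (cov : CovariantDerivative 𝓘(ℝ, E) F V) (q : TotalSpace F V)
    (b : V q.proj) : connMap cov q (vertLift q b) = b := by
  change vertInv q (vertLift q b - horLift cov q (projTangent q (vertLift q b))) = b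
  rw [projTangent_vertLift, map_zero, sub_zero, vertInv_vertLift]

theorem mdifferentiableAt_totalSpace_proj (q : TotalSpace F V) :
    MDifferentiableAt (𝓘(ℝ, E).prod 𝓘(ℝ, F)) 𝓘(ℝ, E) (π F V) q :=
  (contMDiffAt_proj V (n := 1)).mdifferentiableAt one_ne_zero

theorem mvfderiv_comp_proj {g : M → G} {q : TotalSpace F V}
    (hg : MDifferentiableAt 𝓘(ℝ, E) 𝓘(ℝ, G) g q.proj)
    (ξ : TangentSpace (𝓘(ℝ, E).prod 𝓘(ℝ, F)) q) :
    mvfderiv (𝓘(ℝ, E).prod 𝓘(ℝ, F)) (fun q : TotalSpace F V => g q.proj) q ξ =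
      mvfderiv 𝓘(ℝ, E) g q.proj (projTangent q ξ) :=
  congrArg (fun A : TangentSpace (𝓘(ℝ, E).prod 𝓘(ℝ, F)) q →L[ℝ] G => A ξ)
    (mfderiv_comp q hg (mdifferentiableAt_totalSpace_proj q))

theorem mvfderiv_congr_point {f : TotalSpace F V → G} {q q' : TotalSpace F V} (h : q' = q)
    (ξ : E × F) :
    (show E × F →L[ℝ] G from mvfderiv (𝓘(ℝ, E).prod 𝓘(ℝ, F)) f q') ξ =
      (show E × F →L[ℝ] G from mvfderiv (𝓘(ℝ, E).prod 𝓘(ℝ, F)) f q) ξ := by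
  subst h; rfl

variable (e : Trivialization F (π F V)) [MemTrivializationAtlas e]

theorem contMDiffAt_fibreCoord {q : TotalSpace F V} (hq : q.proj ∈ e.baseSet) :
    ContMDiffAt (𝓘(ℝ, E).prod 𝓘(ℝ, F)) 𝓘(ℝ, F) ∞ (fun q => (e q).2) q :=
  ((e.contMDiffAt_iff (n := ∞) (IB := 𝓘(ℝ, E)) (f := id) (e.mem_source.2 hq)).1 contMDiffAt_id).2

theorem mdifferentiableAt_fibreCoord {q : TotalSpace F V} (hq : q.proj ∈ e.baseSet) :
    MDifferentiableAt (𝓘(ℝ, E).prod 𝓘(ℝ, F)) 𝓘(ℝ, F) (fun q => (e q).2) q :=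
  (contMDiffAt_fibreCoord e hq).mdifferentiableAt (by simp)

theorem mvfderiv_fibreCoord_section {s : ∀ y, V y} {x : M} (hx : x ∈ e.baseSet)
    (hs : MDifferentiableAt 𝓘(ℝ, E) (𝓘(ℝ, E).prod 𝓘(ℝ, F))
      (fun z => (⟨z, s z⟩ : TotalSpace F V)) x) (u : TangentSpace 𝓘(ℝ, E) x) :
    mvfderiv (𝓘(ℝ, E).prod 𝓘(ℝ, F)) (fun q : TotalSpace F V => (e q).2) ⟨x, s x⟩
      (mfderiv 𝓘(ℝ, E) (𝓘(ℝ, E).prod 𝓘(ℝ, F)) (fun z => (⟨z, s z⟩ : TotalSpace F V)) x u) =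
    mvfderiv 𝓘(ℝ, E) (secCoord e s) x u := by
  have h1 := mfderiv_comp x (mdifferentiableAt_fibreCoord (E := E) e (q := ⟨x, s x⟩) hx) hs
  have h2 := mvfderiv_congr (IB := 𝓘(ℝ, E)) (secCoord_eventuallyEq e s hx)
  rw [h2]
  exact (congrArg (fun A : TangentSpace 𝓘(ℝ, E) x →L[ℝ] F => A u) h1).symm

/-- `vertLift` is defined in the chart at `q`, but it is the velocity of a line in the fibre, and
every trivialization of the atlas is linear on fibres. -/
theorem mvfderiv_fibreCoord_vertLift {q : TotalSpace F V} (hq : q.proj ∈ e.baseSet)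
    (b : V q.proj) :
    mvfderiv (𝓘(ℝ, E).prod 𝓘(ℝ, F)) (fun q : TotalSpace F V => (e q).2) q (vertLift q b) =
      e.continuousLinearMapAt ℝ q.proj b := by
  set c : ℝ → TotalSpace F V := fun t => ⟨q.proj, q.2 + t • b⟩ with hc
  have hc0 : c 0 = q := by simp [hc]
  have hec : (fun t => (e (c t)).2) = fun t => e.continuousLinearMapAt ℝ q.proj q.2 +
      t • e.continuousLinearMapAt ℝ q.proj b := by
    funext t
    rw [coord_eq e hq, map_add, map_smul]
  have hd : MDifferentiableAt 𝓘(ℝ, ℝ) (𝓘(ℝ, E).prod 𝓘(ℝ, F)) c 0 := by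
    rw [Trivialization.mdifferentiableAt_totalSpace_iff 𝓘(ℝ, E) e c (e.mem_source.2 hq)]
    refine ⟨mdifferentiableAt_const, ?_⟩
    rw [hec]
    exact DifferentiableAt.mdifferentiableAt (by fun_prop)
  have h1 := mfderiv_comp 0 (mdifferentiableAt_fibreCoord (E := E) e (q := c 0) hq) hd
  have h2 : HasFDerivAt (fun t => (e (c t)).2) ((ContinuousLinearMap.id ℝ ℝ).smulRight
        (e.continuousLinearMapAt ℝ q.proj b)) (0 : ℝ) := by
    rw [hec]
    exact ((hasFDerivAt_id _).smul_const _).const_add _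
  have h3 := h2.hasMFDerivAt.mfderiv
  rw [vertLift_eq_velocity]
  refine (mvfderiv_congr_point hc0 _).symm.trans ?_
  refine Eq.trans (congrArg (fun A : ℝ →L[ℝ] F => A 1) (h1.symm.trans h3)) ?_
  exact one_smul ℝ _

/-- The horizontal lift is the velocity of an extension of `q.2` minus the lift of its covariant
derivative. By `cov_eq_coord` the derivative of the coordinates of the extension occurs in both and
cancels, leaving the connection form. -/
theorem mvfderiv_fibreCoord_horLift {q : TotalSpace F V} (hq : q.proj ∈ e.baseSet)
    (u : TangentSpace 𝓘(ℝ, E) q.proj) :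
    mvfderiv (𝓘(ℝ, E).prod 𝓘(ℝ, F)) (fun q : TotalSpace F V => (e q).2) q (horLift cov q u) =
      -e.continuousLinearMapAt ℝ q.proj (cov (constSec e (e q).2) q.proj u) := by
  have hs : MDifferentiableAt 𝓘(ℝ, E) (𝓘(ℝ, E).prod 𝓘(ℝ, F))
      (fun y => (⟨y, FiberBundle.extend F q.2 y⟩ : TotalSpace F V)) q.proj :=
    (smoothNear_extend q.2).mdifferentiableAt
  have hv : (⟨q.proj, FiberBundle.extend F q.2 q.proj⟩ : TotalSpace F V) = q := by simp
  have h1 := mvfderiv_fibreCoord_section e hq hs u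
  have h2 := mvfderiv_fibreCoord_vertLift (E := E) e hq (cov (FiberBundle.extend F q.2) q.proj u)
  have h3 := congrArg (e.continuousLinearMapAt ℝ q.proj)
    (congrArg (fun A : TangentSpace 𝓘(ℝ, E) q.proj →L[ℝ] V q.proj => A u)
      (cov_eq_coord cov e hq hs))
  have h4 : secCoord e (FiberBundle.extend F q.2) q.proj = (e q).2 := by
    rw [secCoord, FiberBundle.extend_apply_self]
    exact (coord_eq e hq q.2).symm
  rw [h4] at h3
  have h5 := e.continuousLinearMapAt_symmL (R := ℝ) hq
    (mvfderiv 𝓘(ℝ, E) (secCoord e (FiberBundle.extend F q.2)) q.proj u)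
  have h6 := (mvfderiv_congr_point (E := E) (f := fun q : TotalSpace F V => (e q).2) hv
    (mfderiv 𝓘(ℝ, E) (𝓘(ℝ, E).prod 𝓘(ℝ, F))
    (fun y => (⟨y, FiberBundle.extend F q.2 y⟩ : TotalSpace F V)) q.proj u)).symm.trans h1
  have h7 := h3.trans ((map_add (e.continuousLinearMapAt ℝ q.proj) _ _).trans
    (congrArg (· + e.continuousLinearMapAt ℝ q.proj (cov (constSec e (e q).2) q.proj u)) h5))
  refine Eq.trans (map_sub (mvfderiv (𝓘(ℝ, E).prod 𝓘(ℝ, F)) (fun q : TotalSpace F V => (e q).2) q)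
    _ _) ?_
  refine Eq.trans (congrArg₂ (· - ·) h6 (h2.trans h7)) ?_
  abel

theorem mvfderiv_fibreCoord {q : TotalSpace F V} (hq : q.proj ∈ e.baseSet)
    (ξ : TangentSpace (𝓘(ℝ, E).prod 𝓘(ℝ, F)) q) :
    mvfderiv (𝓘(ℝ, E).prod 𝓘(ℝ, F)) (fun q : TotalSpace F V => (e q).2) q ξ =
      e.continuousLinearMapAt ℝ q.proj (connMap cov q ξ) -
        e.continuousLinearMapAt ℝ q.proj (cov (constSec e (e q).2) q.proj (projTangent q ξ)) := by
  conv_lhs => rw [← horLift_add_vertLift cov q ξ]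
  rw [map_add, mvfderiv_fibreCoord_horLift e hq, mvfderiv_fibreCoord_vertLift e hq]
  abel

/-- The chart of the total space at `p` consists of the chart of the base and the fibre coordinate
in the trivialization at `p.proj`; the two components are differentiated separately. -/
theorem continuousLinearMapAt_tangent_totalSpace {p q : TotalSpace F V}
    (hq : q.proj ∈ (trivializationAt F V p.proj).baseSet)
    (hq' : q.proj ∈ (chartAt E p.proj).source) (ξ : TangentSpace (𝓘(ℝ, E).prod 𝓘(ℝ, F)) q) :
    (trivializationAt (E × F) (TangentSpace (𝓘(ℝ, E).prod 𝓘(ℝ, F)) : TotalSpace F V → Type _)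
      p).continuousLinearMapAt ℝ q ξ =
    ((trivializationAt E (TangentSpace 𝓘(ℝ, E) : M → Type _) p.proj).continuousLinearMapAt ℝ
      q.proj (projTangent q ξ),
      mvfderiv (𝓘(ℝ, E).prod 𝓘(ℝ, F))
        (fun q : TotalSpace F V => (trivializationAt F V p.proj q).2) q ξ) := by
  set e := trivializationAt F V p.proj with he
  have hs : q ∈ (chartAt (ModelProd E F) p).source := by
    rw [FiberBundle.chartedSpace_chartAt]
    simp only [mfld_simps]
    refine ⟨e.mem_source.2 hq, ?_⟩
    rw [e.coe_fst (e.mem_source.2 hq)]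
    exact hq'
  rw [TangentBundle.continuousLinearMapAt_trivializationAt hs,
    TangentBundle.continuousLinearMapAt_trivializationAt hq']
  have h1 : extChartAt (𝓘(ℝ, E).prod 𝓘(ℝ, F)) p =ᶠ[𝓝 q]
      fun q => (extChartAt 𝓘(ℝ, E) p.proj q.proj, (e q).2) := by
    filter_upwards [(e.open_source).mem_nhds (e.mem_source.2 hq)] with z hz
    rw [FiberBundle.extChartAt]
    have h2 : (e z).1 = z.proj := e.coe_fst hz
    refine Prod.ext ?_ rfl
    exact congrArg (extChartAt 𝓘(ℝ, E) p.proj) h2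
  have hc : MDifferentiableAt 𝓘(ℝ, E) 𝓘(ℝ, E) (extChartAt 𝓘(ℝ, E) p.proj) q.proj :=
    mdifferentiableAt_extChartAt hq'
  have hd : MDifferentiableAt (𝓘(ℝ, E).prod 𝓘(ℝ, F)) 𝓘(ℝ, E × F)
    (extChartAt (𝓘(ℝ, E).prod 𝓘(ℝ, F)) p) q := mdifferentiableAt_extChartAt hs
  refine Prod.ext ?_ ?_
  · have h2 := mvfderiv_clm_comp (ContinuousLinearMap.fst ℝ E F) hd
    have h3 := mvfderiv_congr (IB := 𝓘(ℝ, E).prod 𝓘(ℝ, F)) (h1.mono fun z hz => congrArg Prod.fst hz)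
    refine Eq.trans ?_ (mvfderiv_comp_proj hc ξ)
    exact (h2 ξ).symm.trans (congrArg (fun A : E × F →L[ℝ] E => A ξ) h3)
  · have h2 := mvfderiv_clm_comp (ContinuousLinearMap.snd ℝ E F) hd
    have h3 := mvfderiv_congr (IB := 𝓘(ℝ, E).prod 𝓘(ℝ, F)) (h1.mono fun z hz => congrArg Prod.snd hz)
    exact (h2 ξ).symm.trans (congrArg (fun A : E × F →L[ℝ] F => A ξ) h3)

theorem contMDiffAt_connection_inCoordinates (hc : LocSmooth cov) {s : ∀ y, V y} {x : M}
    (hs : SmoothNear (F := F) 𝓘(ℝ, E) s x) :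
    ContMDiffAt 𝓘(ℝ, E) 𝓘(ℝ, E →L[ℝ] F) ∞ (fun y =>
      (trivializationAt F V x).continuousLinearMapAt ℝ y ∘L cov s y ∘L
        (trivializationAt E (TangentSpace 𝓘(ℝ, E) : M → Type _) x).symmL ℝ y) x :=
  (contMDiffAt_hom_bundle _).1 (hc s x hs) |>.2

/-- The coordinates of a vector field on the total space, up to a smooth shear, are the
coordinates of its projection and of its image under the connection map. -/
theorem exists_shear (hc : LocSmooth cov) (p : TotalSpace F V) :
    ∃ A : TotalSpace F V → E →L[ℝ] F,
      ContMDiffAt (𝓘(ℝ, E).prod 𝓘(ℝ, F)) 𝓘(ℝ, E →L[ℝ] F) ∞ A p ∧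
      ∀ Z : ∀ q : TotalSpace F V, TangentSpace (𝓘(ℝ, E).prod 𝓘(ℝ, F)) q,
        ∀ᶠ q in 𝓝 p, secCoord (trivializationAt (E × F)
          (TangentSpace (𝓘(ℝ, E).prod 𝓘(ℝ, F)) : TotalSpace F V → Type _) p) Z q =
        ((trivializationAt E (TangentSpace 𝓘(ℝ, E) : M → Type _) p.proj).continuousLinearMapAt ℝ
          q.proj (projTangent q (Z q)),
         (trivializationAt F V p.proj).continuousLinearMapAt ℝ q.proj (connMap cov q (Z q)) -
          A q ((trivializationAt E (TangentSpace 𝓘(ℝ, E) : M → Type _) p.proj).continuousLinearMapAt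
            ℝ q.proj (projTangent q (Z q)))) := by
  set e := trivializationAt F V p.proj with he
  set t := trivializationAt E (TangentSpace 𝓘(ℝ, E) : M → Type _) p.proj with ht
  have hp : p.proj ∈ e.baseSet := FiberBundle.mem_baseSet_trivializationAt F V p.proj
  let B := Module.finBasis ℝ F
  -- `A q` is the connection form contracted with the fibre coordinate of `q`. Expanding that
  -- coordinate in the basis `B` separates smooth coefficients from maps pulled back from the base,
  -- and makes the smoothness visible.
  refine ⟨fun q => ∑ i, LinearMap.toContinuousLinearMap (B.coord i) (e q).2 •
    (e.continuousLinearMapAt ℝ q.proj ∘L cov (constSec e (B i)) q.proj ∘L t.symmL ℝ q.proj),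
    ?_, ?_⟩
  · refine contMDiffAt_sum fun i => ?_
    have h1 := (LinearMap.toContinuousLinearMap (B.coord i)).contMDiff.contMDiffAt.comp p
        (contMDiffAt_fibreCoord (E := E) e hp)
    have h2 := (contMDiffAt_connection_inCoordinates hc
      (smoothNear_constSec e (B i) hp)).comp p (contMDiffAt_proj V)
    exact h1.smul h2
  · intro Z
    have hpt : p.proj ∈ t.baseSet := FiberBundle.mem_baseSet_trivializationAt E _ p.proj
    have hcont : ContinuousAt (π F V) p := (contMDiffAt_proj (IB := 𝓘(ℝ, E)) V (n := 1)).continuousAt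
    filter_upwards [hcont (e.open_baseSet.mem_nhds hp), hcont (t.open_baseSet.mem_nhds hpt)]
      with q hq hqt
    have hq' : q.proj ∈ (chartAt E p.proj).source := hqt
    rw [secCoord, continuousLinearMapAt_tangent_totalSpace hq hq',
      mvfderiv_fibreCoord (cov := cov) e hq, cov_constSec_eq_sum cov e hq B]
    refine Prod.ext rfl ?_
    have h1 : t.symmL ℝ q.proj (t.continuousLinearMapAt ℝ q.proj (projTangent q (Z q))) =
      projTangent q (Z q) := t.symmL_continuousLinearMapAt hqt _
    simp only [sum_apply, smul_apply, ContinuousLinearMap.comp_apply,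
      map_sum, map_smul]
    refine congrArg (_ - ·) (Finset.sum_congr rfl fun i _ => ?_)
    exact congrArg (fun u => B.repr (e q).2 i • e.continuousLinearMapAt ℝ q.proj
      (cov (constSec e (B i)) q.proj u)) h1.symm

/-- For families over the total space with values in a bundle over the base: the base component is
the projection, which is smooth, so only the fibre coordinate has to be tested. -/
theorem contMDiffAt_totalSpace_iff_coord {p : TotalSpace F V} {F' : Type*} [NormedAddCommGroup F']
    [NormedSpace ℝ F'] [FiniteDimensional ℝ F'] {V' : M → Type*} [TopologicalSpace (TotalSpace F' V')]
    [∀ x, AddCommGroup (V' x)] [∀ x, Module ℝ (V' x)] [∀ x, TopologicalSpace (V' x)]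
    [FiberBundle F' V'] [VectorBundle ℝ F' V'] [ContMDiffVectorBundle ∞ F' V' 𝓘(ℝ, E)]
    (e' : Trivialization F' (π F' V')) [MemTrivializationAtlas e'] (hp : p.proj ∈ e'.baseSet)
    (s : ∀ q : TotalSpace F V, V' q.proj) :
    ContMDiffAt (𝓘(ℝ, E).prod 𝓘(ℝ, F)) (𝓘(ℝ, E).prod 𝓘(ℝ, F')) ∞
      (fun q => (⟨q.proj, s q⟩ : TotalSpace F' V')) p ↔
    ContMDiffAt (𝓘(ℝ, E).prod 𝓘(ℝ, F)) 𝓘(ℝ, F') ∞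
      (fun q => e'.continuousLinearMapAt ℝ q.proj (s q)) p := by
  have hcont : ContinuousAt (π F V) p := (contMDiffAt_proj (IB := 𝓘(ℝ, E)) V (n := 1)).continuousAt
  have hev : (fun q : TotalSpace F V => (e' ⟨q.proj, s q⟩).2) =ᶠ[𝓝 p]
      fun q => e'.continuousLinearMapAt ℝ q.proj (s q) := by
    filter_upwards [hcont (e'.open_baseSet.mem_nhds hp)] with q hq
    exact coord_eq _ hq _
  rw [e'.contMDiffAt_iff (IB := 𝓘(ℝ, E)) (f := fun q : TotalSpace F V => ⟨q.proj, s q⟩)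
    (e'.mem_source.2 hp)]
  exact ⟨fun h => h.2.congr_of_eventuallyEq hev.symm,
    fun h => ⟨contMDiffAt_proj V, h.congr_of_eventuallyEq hev⟩⟩

theorem mdifferentiableAt_totalSpace_iff_coord {p : TotalSpace F V} {F' : Type*} [NormedAddCommGroup F']
    [NormedSpace ℝ F'] [FiniteDimensional ℝ F'] {V' : M → Type*} [TopologicalSpace (TotalSpace F' V')]
    [∀ x, AddCommGroup (V' x)] [∀ x, Module ℝ (V' x)] [∀ x, TopologicalSpace (V' x)]
    [FiberBundle F' V'] [VectorBundle ℝ F' V'] [ContMDiffVectorBundle ∞ F' V' 𝓘(ℝ, E)]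
    (e' : Trivialization F' (π F' V')) [MemTrivializationAtlas e'] (hp : p.proj ∈ e'.baseSet)
    (s : ∀ q : TotalSpace F V, V' q.proj) :
    MDifferentiableAt (𝓘(ℝ, E).prod 𝓘(ℝ, F)) (𝓘(ℝ, E).prod 𝓘(ℝ, F'))
      (fun q => (⟨q.proj, s q⟩ : TotalSpace F' V')) p ↔
    MDifferentiableAt (𝓘(ℝ, E).prod 𝓘(ℝ, F)) 𝓘(ℝ, F')
      (fun q => e'.continuousLinearMapAt ℝ q.proj (s q)) p := by
  have hcont : ContinuousAt (π F V) p := (contMDiffAt_proj (IB := 𝓘(ℝ, E)) V (n := 1)).continuousAt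
  have hev : (fun q : TotalSpace F V => (e' ⟨q.proj, s q⟩).2) =ᶠ[𝓝 p]
      fun q => e'.continuousLinearMapAt ℝ q.proj (s q) := by
    filter_upwards [hcont (e'.open_baseSet.mem_nhds hp)] with q hq
    exact coord_eq _ hq _
  rw [e'.mdifferentiableAt_totalSpace_iff 𝓘(ℝ, E) (fun q : TotalSpace F V => ⟨q.proj, s q⟩)
    (e'.mem_source.2 hp)]
  exact ⟨fun h => h.2.congr_of_eventuallyEq hev.symm,
    fun h => ⟨mdifferentiableAt_totalSpace_proj p, h.congr_of_eventuallyEq hev⟩⟩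

/-- A vector field on the total space is smooth if its projection and its image under the
connection map are. -/
theorem contMDiffAt_vectorField_iff (hc : LocSmooth cov) {p : TotalSpace F V}
    {Z : ∀ q : TotalSpace F V, TangentSpace (𝓘(ℝ, E).prod 𝓘(ℝ, F)) q} :
    ContMDiffAt (𝓘(ℝ, E).prod 𝓘(ℝ, F)) ((𝓘(ℝ, E).prod 𝓘(ℝ, F)).prod 𝓘(ℝ, E × F)) ∞
      (fun q => (⟨q, Z q⟩ : TangentBundle (𝓘(ℝ, E).prod 𝓘(ℝ, F)) (TotalSpace F V))) p ↔
    ContMDiffAt (𝓘(ℝ, E).prod 𝓘(ℝ, F)) (𝓘(ℝ, E).prod 𝓘(ℝ, E)) ∞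
      (fun q => (⟨q.proj, projTangent q (Z q)⟩ : TangentBundle 𝓘(ℝ, E) M)) p ∧
    ContMDiffAt (𝓘(ℝ, E).prod 𝓘(ℝ, F)) (𝓘(ℝ, E).prod 𝓘(ℝ, F)) ∞
      (fun q => (⟨q.proj, connMap cov q (Z q)⟩ : TotalSpace F V)) p := by
  obtain ⟨A, hA, h⟩ := exists_shear hc p
  rw [contMDiffAt_totalSpace_iff_coord (trivializationAt E (TangentSpace 𝓘(ℝ, E) : M → Type _) p.proj)
    (FiberBundle.mem_baseSet_trivializationAt _ _ p.proj)
    (fun q => projTangent q (Z q)), contMDiffAt_totalSpace_iff_coord (trivializationAt F V p.proj)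
    (FiberBundle.mem_baseSet_trivializationAt _ _ p.proj) (fun q => connMap cov q (Z q))]
  have hZ := h Z
  rw [← contMDiffAt_secCoord_iff (trivializationAt (E × F)
    (TangentSpace (𝓘(ℝ, E).prod 𝓘(ℝ, F)) : TotalSpace F V → Type _) p)
    (FiberBundle.mem_baseSet_trivializationAt _ _ p)]
  constructor
  · intro h1
    have h2 := h1.congr_of_eventuallyEq (hZ.mono fun _ h => h.symm)
    have h3 := (contDiff_fst (𝕜 := ℝ) (E := E) (F := F) (n := ∞)).contMDiff.contMDiffAt.comp p h2
    have h4 := (contDiff_snd (𝕜 := ℝ) (E := E) (F := F) (n := ∞)).contMDiff.contMDiffAt.comp p h2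
    refine ⟨h3, (h4.add (hA.clm_apply h3)).congr_of_eventuallyEq (Filter.Eventually.of_forall ?_)⟩
    intro q
    exact (sub_add_cancel _ _).symm
  · rintro ⟨h1, h2⟩
    exact (h1.prodMk_space (h2.sub (hA.clm_apply h1))).congr_of_eventuallyEq hZ

/-- The first-order version of the shear argument; the axioms of a connection ask only for
differentiability at the point. -/
theorem mdifferentiableAt_vectorField_iff (hc : LocSmooth cov) {p : TotalSpace F V}
    {Z : ∀ q : TotalSpace F V, TangentSpace (𝓘(ℝ, E).prod 𝓘(ℝ, F)) q} :
    MDifferentiableAt (𝓘(ℝ, E).prod 𝓘(ℝ, F)) ((𝓘(ℝ, E).prod 𝓘(ℝ, F)).prod 𝓘(ℝ, E × F))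
      (fun q => (⟨q, Z q⟩ : TangentBundle (𝓘(ℝ, E).prod 𝓘(ℝ, F)) (TotalSpace F V))) p ↔
    MDifferentiableAt (𝓘(ℝ, E).prod 𝓘(ℝ, F)) (𝓘(ℝ, E).prod 𝓘(ℝ, E))
      (fun q => (⟨q.proj, projTangent q (Z q)⟩ : TangentBundle 𝓘(ℝ, E) M)) p ∧
    MDifferentiableAt (𝓘(ℝ, E).prod 𝓘(ℝ, F)) (𝓘(ℝ, E).prod 𝓘(ℝ, F))
      (fun q => (⟨q.proj, connMap cov q (Z q)⟩ : TotalSpace F V)) p := by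
  obtain ⟨A, hA, h⟩ := exists_shear hc p
  have hA : MDifferentiableAt (𝓘(ℝ, E).prod 𝓘(ℝ, F)) 𝓘(ℝ, E →L[ℝ] F) A p :=
    hA.mdifferentiableAt (by simp)
  rw [mdifferentiableAt_totalSpace_iff_coord (trivializationAt E (TangentSpace 𝓘(ℝ, E) : M → Type _) p.proj)
    (FiberBundle.mem_baseSet_trivializationAt _ _ p.proj)
    (fun q => projTangent q (Z q)),
    mdifferentiableAt_totalSpace_iff_coord (trivializationAt F V p.proj)
    (FiberBundle.mem_baseSet_trivializationAt _ _ p.proj) (fun q => connMap cov q (Z q))]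
  have hZ := h Z
  rw [← mdifferentiableAt_secCoord_iff (trivializationAt (E × F)
    (TangentSpace (𝓘(ℝ, E).prod 𝓘(ℝ, F)) : TotalSpace F V → Type _) p)
    (FiberBundle.mem_baseSet_trivializationAt _ _ p)]
  constructor
  · intro h1
    have h2 := h1.congr_of_eventuallyEq (hZ.mono fun _ h => h.symm)
    have h3 := (ContinuousLinearMap.fst ℝ E F).mdifferentiableAt.comp p h2
    have h4 := (ContinuousLinearMap.snd ℝ E F).mdifferentiableAt.comp p h2
    refine ⟨h3, (h4.add (hA.clm_apply h3)).congr_of_eventuallyEq (Filter.Eventually.of_forall ?_)⟩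
    intro q
    exact (sub_add_cancel _ _).symm
  · rintro ⟨h1, h2⟩
    exact (h1.prodMk_space (h2.sub (hA.clm_apply h1))).congr_of_eventuallyEq hZ

end LiftCoordinates

/-! ### Construction of the lifted connection. -/

section LiftedConnection

variable {E : Type*} [NormedAddCommGroup E] [NormedSpace ℝ E] [FiniteDimensional ℝ E]
  {M : Type*} [TopologicalSpace M] [ChartedSpace E M] [IsManifold 𝓘(ℝ, E) ∞ M]
  {F : Type*} [NormedAddCommGroup F] [NormedSpace ℝ F] [FiniteDimensional ℝ F]
  {V : M → Type*} [TopologicalSpace (TotalSpace F V)] [∀ x, AddCommGroup (V x)]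
  [∀ x, Module ℝ (V x)] [∀ x, TopologicalSpace (V x)] [∀ x, IsTopologicalAddGroup (V x)]
  [∀ x, ContinuousSMul ℝ (V x)] [FiberBundle F V] [VectorBundle ℝ F V]
  [ContMDiffVectorBundle ∞ F V 𝓘(ℝ, E)]
  {F' : Type*} [NormedAddCommGroup F'] [NormedSpace ℝ F'] [FiniteDimensional ℝ F']
  {V' : M → Type*} [TopologicalSpace (TotalSpace F' V')] [∀ x, AddCommGroup (V' x)]
  [∀ x, Module ℝ (V' x)] [∀ x, TopologicalSpace (V' x)]
  [FiberBundle F' V'] [VectorBundle ℝ F' V']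
  [ContMDiffVectorBundle ∞ F' V' 𝓘(ℝ, E)]
  {cov : CovariantDerivative 𝓘(ℝ, E) F V}
  {Λ : CovariantDerivative 𝓘(ℝ, E) E (TangentSpace 𝓘(ℝ, E) : M → Type _)}

theorem contMDiffAt_comp_proj {s : ∀ y, V' y} {p : TotalSpace F V}
    (hs : ContMDiffAt 𝓘(ℝ, E) (𝓘(ℝ, E).prod 𝓘(ℝ, F')) ∞
      (fun y => (⟨y, s y⟩ : TotalSpace F' V')) p.proj) :
    ContMDiffAt (𝓘(ℝ, E).prod 𝓘(ℝ, F)) (𝓘(ℝ, E).prod 𝓘(ℝ, F')) ∞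
      (fun q : TotalSpace F V => (⟨q.proj, s q.proj⟩ : TotalSpace F' V')) p :=
  ContMDiffAt.comp (g := fun y => (⟨y, s y⟩ : TotalSpace F' V')) p hs (contMDiffAt_proj V)

theorem mdifferentiableAt_comp_proj {s : ∀ y, V' y} {p : TotalSpace F V}
    (hs : MDifferentiableAt 𝓘(ℝ, E) (𝓘(ℝ, E).prod 𝓘(ℝ, F'))
      (fun y => (⟨y, s y⟩ : TotalSpace F' V')) p.proj) :
    MDifferentiableAt (𝓘(ℝ, E).prod 𝓘(ℝ, F)) (𝓘(ℝ, E).prod 𝓘(ℝ, F'))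
      (fun q : TotalSpace F V => (⟨q.proj, s q.proj⟩ : TotalSpace F' V')) p :=
  MDifferentiableAt.comp (g := fun y => (⟨y, s y⟩ : TotalSpace F' V')) p hs
    (mdifferentiableAt_totalSpace_proj p)

variable (F' V') in
theorem contMDiffAt_zero_comp_proj (p : TotalSpace F V) :
    ContMDiffAt (𝓘(ℝ, E).prod 𝓘(ℝ, F)) (𝓘(ℝ, E).prod 𝓘(ℝ, F')) ∞
      (fun q : TotalSpace F V => (⟨q.proj, 0⟩ : TotalSpace F' V')) p := by
  refine (contMDiffAt_totalSpace_iff_coord (trivializationAt F' V' p.proj)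
    (FiberBundle.mem_baseSet_trivializationAt _ _ p.proj) (fun _ => 0)).2 ?_
  simp only [map_zero]
  exact contMDiffAt_const

/-- The definition of `horLift` uses a different extension at every point. The criterion through
projection and connection map avoids following these extensions as the point varies. -/
theorem contMDiffAt_horLift (hc : LocSmooth cov) {p : TotalSpace F V}
    {u : ∀ q : TotalSpace F V, TangentSpace 𝓘(ℝ, E) q.proj}
    (hu : ContMDiffAt (𝓘(ℝ, E).prod 𝓘(ℝ, F)) (𝓘(ℝ, E).prod 𝓘(ℝ, E)) ∞
      (fun q => (⟨q.proj, u q⟩ : TangentBundle 𝓘(ℝ, E) M)) p) :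
    ContMDiffAt (𝓘(ℝ, E).prod 𝓘(ℝ, F)) ((𝓘(ℝ, E).prod 𝓘(ℝ, F)).prod 𝓘(ℝ, E × F)) ∞
      (fun q => (⟨q, horLift cov q (u q)⟩ :
        TangentBundle (𝓘(ℝ, E).prod 𝓘(ℝ, F)) (TotalSpace F V))) p := by
  refine (contMDiffAt_vectorField_iff hc).2 ⟨?_, ?_⟩
  · simpa only [projTangent_horLift] using hu
  · simpa only [connMap_horLift] using contMDiffAt_zero_comp_proj F V p

theorem contMDiffAt_vertLift (hc : LocSmooth cov) {p : TotalSpace F V}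
    {b : ∀ q : TotalSpace F V, V q.proj}
    (hb : ContMDiffAt (𝓘(ℝ, E).prod 𝓘(ℝ, F)) (𝓘(ℝ, E).prod 𝓘(ℝ, F)) ∞
      (fun q => (⟨q.proj, b q⟩ : TotalSpace F V)) p) :
    ContMDiffAt (𝓘(ℝ, E).prod 𝓘(ℝ, F)) ((𝓘(ℝ, E).prod 𝓘(ℝ, F)).prod 𝓘(ℝ, E × F)) ∞
      (fun q => (⟨q, vertLift q (b q)⟩ :
        TangentBundle (𝓘(ℝ, E).prod 𝓘(ℝ, F)) (TotalSpace F V))) p := by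
  refine (contMDiffAt_vectorField_iff hc).2 ⟨?_, ?_⟩
  · simpa only [projTangent_vertLift] using
      contMDiffAt_zero_comp_proj E (TangentSpace 𝓘(ℝ, E) : M → Type _) p
  · simpa only [connMap_vertLift] using hb

theorem mdifferentiableAt_horLift (hc : LocSmooth cov) {p : TotalSpace F V}
    {u : ∀ q : TotalSpace F V, TangentSpace 𝓘(ℝ, E) q.proj}
    (hu : MDifferentiableAt (𝓘(ℝ, E).prod 𝓘(ℝ, F)) (𝓘(ℝ, E).prod 𝓘(ℝ, E))
      (fun q => (⟨q.proj, u q⟩ : TangentBundle 𝓘(ℝ, E) M)) p) :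
    MDifferentiableAt (𝓘(ℝ, E).prod 𝓘(ℝ, F)) ((𝓘(ℝ, E).prod 𝓘(ℝ, F)).prod 𝓘(ℝ, E × F))
      (fun q => (⟨q, horLift cov q (u q)⟩ :
        TangentBundle (𝓘(ℝ, E).prod 𝓘(ℝ, F)) (TotalSpace F V))) p := by
  refine (mdifferentiableAt_vectorField_iff hc).2 ⟨?_, ?_⟩
  · simpa only [projTangent_horLift] using hu
  · simpa only [connMap_horLift] using
      (contMDiffAt_zero_comp_proj F V p).mdifferentiableAt (by simp)

theorem mdifferentiableAt_vertLift (hc : LocSmooth cov) {p : TotalSpace F V}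
    {b : ∀ q : TotalSpace F V, V q.proj}
    (hb : MDifferentiableAt (𝓘(ℝ, E).prod 𝓘(ℝ, F)) (𝓘(ℝ, E).prod 𝓘(ℝ, F))
      (fun q => (⟨q.proj, b q⟩ : TotalSpace F V)) p) :
    MDifferentiableAt (𝓘(ℝ, E).prod 𝓘(ℝ, F)) ((𝓘(ℝ, E).prod 𝓘(ℝ, F)).prod 𝓘(ℝ, E × F))
      (fun q => (⟨q, vertLift q (b q)⟩ :
        TangentBundle (𝓘(ℝ, E).prod 𝓘(ℝ, F)) (TotalSpace F V))) p := by
  refine (mdifferentiableAt_vectorField_iff hc).2 ⟨?_, ?_⟩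
  · simpa only [projTangent_vertLift] using
      (contMDiffAt_zero_comp_proj E (TangentSpace 𝓘(ℝ, E) : M → Type _) p).mdifferentiableAt
        (by simp)
  · simpa only [connMap_vertLift] using hb

/-- The horizontal coordinates of a vector field on the total space near `p`. -/
def horCoord (p : TotalSpace F V)
    (Z : ∀ q : TotalSpace F V, TangentSpace (𝓘(ℝ, E).prod 𝓘(ℝ, F)) q) : TotalSpace F V → E :=
  fun q => (trivializationAt E (TangentSpace 𝓘(ℝ, E) : M → Type _) p.proj).continuousLinearMapAt ℝ
    q.proj (projTangent q (Z q))

/-- The vertical coordinates of a vector field on the total space near `p`. -/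
def vertCoord (cov : CovariantDerivative 𝓘(ℝ, E) F V) (p : TotalSpace F V)
    (Z : ∀ q : TotalSpace F V, TangentSpace (𝓘(ℝ, E).prod 𝓘(ℝ, F)) q) : TotalSpace F V → F :=
  fun q => (trivializationAt F V p.proj).continuousLinearMapAt ℝ q.proj (connMap cov q (Z q))

theorem mdifferentiableAt_horCoord (hc : LocSmooth cov) {p : TotalSpace F V}
    {Z : ∀ q : TotalSpace F V, TangentSpace (𝓘(ℝ, E).prod 𝓘(ℝ, F)) q}
    (hZ : MDifferentiableAt (𝓘(ℝ, E).prod 𝓘(ℝ, F)) ((𝓘(ℝ, E).prod 𝓘(ℝ, F)).prod 𝓘(ℝ, E × F))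
      (fun q => (⟨q, Z q⟩ : TangentBundle (𝓘(ℝ, E).prod 𝓘(ℝ, F)) (TotalSpace F V))) p) :
    MDifferentiableAt (𝓘(ℝ, E).prod 𝓘(ℝ, F)) 𝓘(ℝ, E) (horCoord p Z) p :=
  (mdifferentiableAt_totalSpace_iff_coord _ (FiberBundle.mem_baseSet_trivializationAt _ _ p.proj)
    _).1 ((mdifferentiableAt_vectorField_iff hc).1 hZ).1

theorem mdifferentiableAt_vertCoord (hc : LocSmooth cov) {p : TotalSpace F V}
    {Z : ∀ q : TotalSpace F V, TangentSpace (𝓘(ℝ, E).prod 𝓘(ℝ, F)) q}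
    (hZ : MDifferentiableAt (𝓘(ℝ, E).prod 𝓘(ℝ, F)) ((𝓘(ℝ, E).prod 𝓘(ℝ, F)).prod 𝓘(ℝ, E × F))
      (fun q => (⟨q, Z q⟩ : TangentBundle (𝓘(ℝ, E).prod 𝓘(ℝ, F)) (TotalSpace F V))) p) :
    MDifferentiableAt (𝓘(ℝ, E).prod 𝓘(ℝ, F)) 𝓘(ℝ, F) (vertCoord cov p Z) p :=
  (mdifferentiableAt_totalSpace_iff_coord _ (FiberBundle.mem_baseSet_trivializationAt _ _ p.proj)
    _).1 ((mdifferentiableAt_vectorField_iff hc).1 hZ).2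

theorem contMDiffAt_horCoord (hc : LocSmooth cov) {p q : TotalSpace F V}
    (hq : q.proj ∈ (trivializationAt E (TangentSpace 𝓘(ℝ, E) : M → Type _) p.proj).baseSet)
    {Z : ∀ q : TotalSpace F V, TangentSpace (𝓘(ℝ, E).prod 𝓘(ℝ, F)) q}
    (hZ : ContMDiffAt (𝓘(ℝ, E).prod 𝓘(ℝ, F)) ((𝓘(ℝ, E).prod 𝓘(ℝ, F)).prod 𝓘(ℝ, E × F)) ∞
      (fun q => (⟨q, Z q⟩ : TangentBundle (𝓘(ℝ, E).prod 𝓘(ℝ, F)) (TotalSpace F V))) q) :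
    ContMDiffAt (𝓘(ℝ, E).prod 𝓘(ℝ, F)) 𝓘(ℝ, E) ∞ (horCoord p Z) q :=
  (contMDiffAt_totalSpace_iff_coord _ hq _).1 ((contMDiffAt_vectorField_iff hc).1 hZ).1

theorem contMDiffAt_vertCoord (hc : LocSmooth cov) {p q : TotalSpace F V}
    (hq : q.proj ∈ (trivializationAt F V p.proj).baseSet)
    {Z : ∀ q : TotalSpace F V, TangentSpace (𝓘(ℝ, E).prod 𝓘(ℝ, F)) q}
    (hZ : ContMDiffAt (𝓘(ℝ, E).prod 𝓘(ℝ, F)) ((𝓘(ℝ, E).prod 𝓘(ℝ, F)).prod 𝓘(ℝ, E × F)) ∞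
      (fun q => (⟨q, Z q⟩ : TangentBundle (𝓘(ℝ, E).prod 𝓘(ℝ, F)) (TotalSpace F V))) q) :
    ContMDiffAt (𝓘(ℝ, E).prod 𝓘(ℝ, F)) 𝓘(ℝ, F) ∞ (vertCoord cov p Z) q :=
  (contMDiffAt_totalSpace_iff_coord _ hq _).1 ((contMDiffAt_vectorField_iff hc).1 hZ).2

/-- The values of the lifted connection. -/
def liftedDeriv (hc : LocSmooth cov)
    (Λ : CovariantDerivative 𝓘(ℝ, E) E (TangentSpace 𝓘(ℝ, E) : M → Type _))
    (Z : ∀ q : TotalSpace F V, TangentSpace (𝓘(ℝ, E).prod 𝓘(ℝ, F)) q) (p : TotalSpace F V) :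
    TangentSpace (𝓘(ℝ, E).prod 𝓘(ℝ, F)) p →L[ℝ] TangentSpace (𝓘(ℝ, E).prod 𝓘(ℝ, F)) p :=
  have : FiniteDimensional ℝ (TangentSpace (𝓘(ℝ, E).prod 𝓘(ℝ, F)) p) :=
    inferInstanceAs (FiniteDimensional ℝ (E × F))
  have : T2Space (TangentSpace (𝓘(ℝ, E).prod 𝓘(ℝ, F)) p) := inferInstanceAs (T2Space (E × F))
  let t := trivializationAt E (TangentSpace 𝓘(ℝ, E) : M → Type _) p.proj
  let e := trivializationAt F V p.proj
  -- The first two summands are the pullbacks of `Λ` and `cov` along the projection, acting on the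
  -- horizontal and on the vertical part of `Z`, each as derivative of coordinates plus connection
  -- form. The third is tensorial in `Z`, so it does not disturb the Leibniz rule.
  horLift cov p ∘L (t.symmL ℝ p.proj ∘L mvfderiv (𝓘(ℝ, E).prod 𝓘(ℝ, F)) (horCoord p Z) p +
      Λ (constSec t (horCoord p Z p)) p.proj ∘L projTangent p) +
    vertLift p ∘L (e.symmL ℝ p.proj ∘L mvfderiv (𝓘(ℝ, E).prod 𝓘(ℝ, F)) (vertCoord cov p Z) p +
      cov (constSec e (vertCoord cov p Z p)) p.proj ∘L projTangent p) -
    (1 / 2 : ℝ) • LinearMap.toContinuousLinearMap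
      { toFun := fun ξ => vertLift p
          (curvature cov p.proj (projTangent p ξ) (projTangent p (Z p)) p.2)
        map_add' := fun ξ η => by rw [map_add, curvature_add_left hc, map_add]
        map_smul' := fun c ξ => by rw [map_smul, curvature_smul_left hc, map_smul]; rfl }

theorem liftedDeriv_apply (hc : LocSmooth cov)
    (Λ : CovariantDerivative 𝓘(ℝ, E) E (TangentSpace 𝓘(ℝ, E) : M → Type _))
    (Z : ∀ q : TotalSpace F V, TangentSpace (𝓘(ℝ, E).prod 𝓘(ℝ, F)) q) (p : TotalSpace F V)
    (ξ : TangentSpace (𝓘(ℝ, E).prod 𝓘(ℝ, F)) p) :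
    liftedDeriv hc Λ Z p ξ =
      horLift cov p ((trivializationAt E (TangentSpace 𝓘(ℝ, E) : M → Type _) p.proj).symmL ℝ p.proj
          (mvfderiv (𝓘(ℝ, E).prod 𝓘(ℝ, F)) (horCoord p Z) p ξ) +
        Λ (constSec (trivializationAt E (TangentSpace 𝓘(ℝ, E) : M → Type _) p.proj)
          (horCoord p Z p)) p.proj (projTangent p ξ)) +
      vertLift p ((trivializationAt F V p.proj).symmL ℝ p.proj
          (mvfderiv (𝓘(ℝ, E).prod 𝓘(ℝ, F)) (vertCoord cov p Z) p ξ) +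
        cov (constSec (trivializationAt F V p.proj) (vertCoord cov p Z p)) p.proj
          (projTangent p ξ)) -
      (1 / 2 : ℝ) • vertLift p
          (curvature cov p.proj (projTangent p ξ) (projTangent p (Z p)) p.2) := rfl

theorem horCoord_add (p : TotalSpace F V)
    (Z Z' : ∀ q : TotalSpace F V, TangentSpace (𝓘(ℝ, E).prod 𝓘(ℝ, F)) q) :
    horCoord p (Z + Z') = horCoord p Z + horCoord p Z' :=
  funext fun q => by simp only [horCoord, Pi.add_apply, map_add]

theorem vertCoord_add (p : TotalSpace F V)
    (Z Z' : ∀ q : TotalSpace F V, TangentSpace (𝓘(ℝ, E).prod 𝓘(ℝ, F)) q) :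
    vertCoord cov p (Z + Z') = vertCoord cov p Z + vertCoord cov p Z' :=
  funext fun q => by simp only [vertCoord, Pi.add_apply, map_add]

theorem horCoord_smul (p : TotalSpace F V) (g : TotalSpace F V → ℝ)
    (Z : ∀ q : TotalSpace F V, TangentSpace (𝓘(ℝ, E).prod 𝓘(ℝ, F)) q) :
    horCoord p (g • Z) = g • horCoord p Z :=
  funext fun q => by simp only [horCoord, Pi.smul_apply', map_smul]

theorem vertCoord_smul (p : TotalSpace F V) (g : TotalSpace F V → ℝ)
    (Z : ∀ q : TotalSpace F V, TangentSpace (𝓘(ℝ, E).prod 𝓘(ℝ, F)) q) :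
    vertCoord cov p (g • Z) = g • vertCoord cov p Z :=
  funext fun q => by simp only [vertCoord, Pi.smul_apply', map_smul]

/-- The connection on the tangent bundle of the total space that is induced by a connection on the
bundle and a connection on the tangent bundle of the base. -/
def liftedConnection (hc : LocSmooth cov)
    (Λ : CovariantDerivative 𝓘(ℝ, E) E (TangentSpace 𝓘(ℝ, E) : M → Type _)) :
    CovariantDerivative (𝓘(ℝ, E).prod 𝓘(ℝ, F)) (E × F)
      (TangentSpace (𝓘(ℝ, E).prod 𝓘(ℝ, F)) : TotalSpace F V → Type _) where
  toFun := liftedDeriv hc Λ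
  isCovariantDerivativeOnUniv :=
    { add := by
        intro Z Z' p hZ hZ' _
        have ht := FiberBundle.mem_baseSet_trivializationAt E (TangentSpace 𝓘(ℝ, E) : M → Type _)
          p.proj
        have he := FiberBundle.mem_baseSet_trivializationAt F V p.proj
        have h1 := mvfderiv_add (mdifferentiableAt_horCoord hc hZ)
          (mdifferentiableAt_horCoord hc hZ')
        have h2 := mvfderiv_add (mdifferentiableAt_vertCoord hc hZ)
          (mdifferentiableAt_vertCoord hc hZ')
        refine ContinuousLinearMap.ext fun ξ => ?_
        rw [add_apply]
        simp only [liftedDeriv_apply, horCoord_add, vertCoord_add]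
        rw [h1, h2]
        simp only [Pi.add_apply, cov_constSec_add _ _ ht, cov_constSec_add _ _ he, add_apply,
          map_add, curvature_add_right hc, smul_add]
        abel
      leibniz := by
        intro Z g p hZ hg _
        have ht := FiberBundle.mem_baseSet_trivializationAt E (TangentSpace 𝓘(ℝ, E) : M → Type _)
          p.proj
        have he := FiberBundle.mem_baseSet_trivializationAt F V p.proj
        have h1 := mvfderiv_smul hg (mdifferentiableAt_horCoord hc hZ)
        have h2 := mvfderiv_smul hg (mdifferentiableAt_vertCoord hc hZ)
        have h3 : (trivializationAt E (TangentSpace 𝓘(ℝ, E) : M → Type _) p.proj).symmL ℝ p.proj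
          (horCoord p Z p) = projTangent p (Z p) := Trivialization.symmL_continuousLinearMapAt _ ht _
        have h4 : (trivializationAt F V p.proj).symmL ℝ p.proj
          (vertCoord cov p Z p) = connMap cov p (Z p) :=
          Trivialization.symmL_continuousLinearMapAt _ he _
        refine ContinuousLinearMap.ext fun ξ => ?_
        -- On the left the Leibniz term `dg ⊗ Z` appears already split into horizontal and vertical
        -- part, so `Z p` is split on the right as well.
        have h5 := horLift_add_vertLift cov p (Z p)
        simp only [add_apply, smul_apply, ContinuousLinearMap.smulRight_apply]
        conv_rhs => rw [← h5]
        simp only [liftedDeriv_apply, horCoord_smul, vertCoord_smul]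
        rw [h1, h2]
        simp only [Pi.smul_apply', cov_constSec_smul _ _ ht, cov_constSec_smul _ _ he, add_apply,
          smul_apply, ContinuousLinearMap.smulRight_apply, map_add, map_smul, h3, h4,
          curvature_smul_right hc]
        module }

end LiftedConnection

/-! ### Smoothness of every lifted connection and flatness along the fibres. -/

section LiftCharacterization

variable {E : Type*} [NormedAddCommGroup E] [NormedSpace ℝ E] [FiniteDimensional ℝ E]
  {M : Type*} [TopologicalSpace M] [ChartedSpace E M] [IsManifold 𝓘(ℝ, E) ∞ M]
  {F : Type*} [NormedAddCommGroup F] [NormedSpace ℝ F] [FiniteDimensional ℝ F]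
  {V : M → Type*} [TopologicalSpace (TotalSpace F V)] [∀ x, AddCommGroup (V x)]
  [∀ x, Module ℝ (V x)] [∀ x, TopologicalSpace (V x)] [∀ x, IsTopologicalAddGroup (V x)]
  [∀ x, ContinuousSMul ℝ (V x)] [FiberBundle F V] [VectorBundle ℝ F V]
  [ContMDiffVectorBundle ∞ F V 𝓘(ℝ, E)]
  {cov : CovariantDerivative 𝓘(ℝ, E) F V}
  {Λ : CovariantDerivative 𝓘(ℝ, E) E (TangentSpace 𝓘(ℝ, E) : M → Type _)}
  {D : CovariantDerivative (𝓘(ℝ, E).prod 𝓘(ℝ, F)) (E × F)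
      (TangentSpace (𝓘(ℝ, E).prod 𝓘(ℝ, F)) : TotalSpace F V → Type _)}

/-- `D` is the lift of `Λ` and `cov` to the total space. -/
def IsLift (Λ : CovariantDerivative 𝓘(ℝ, E) E (TangentSpace 𝓘(ℝ, E) : M → Type _))
    (cov : CovariantDerivative 𝓘(ℝ, E) F V)
    (D : CovariantDerivative (𝓘(ℝ, E).prod 𝓘(ℝ, F)) (E × F)
      (TangentSpace (𝓘(ℝ, E).prod 𝓘(ℝ, F)) : TotalSpace F V → Type _)) : Prop :=
  (∀ (Y : ∀ x : M, TangentSpace 𝓘(ℝ, E) x) (p : TotalSpace F V),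
    MDifferentiableAt 𝓘(ℝ, E) (𝓘(ℝ, E).prod 𝓘(ℝ, E))
      (fun y => (⟨y, Y y⟩ : TotalSpace E (TangentSpace 𝓘(ℝ, E) : M → Type _))) p.proj →
    (∀ u : TangentSpace 𝓘(ℝ, E) p.proj,
      D (fun q : TotalSpace F V => horLift cov q (Y q.proj)) p (horLift cov p u) =
        horLift cov p (Λ Y p.proj u) -
          (1 / 2 : ℝ) • vertLift p (curvature cov p.proj u (Y p.proj) p.2)) ∧
    ∀ b : V p.proj,
      D (fun q : TotalSpace F V => horLift cov q (Y q.proj)) p (vertLift p b) = 0) ∧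
  ∀ (β : ∀ x : M, V x) (p : TotalSpace F V),
    MDifferentiableAt 𝓘(ℝ, E) (𝓘(ℝ, E).prod 𝓘(ℝ, F))
      (fun y => (⟨y, β y⟩ : TotalSpace F V)) p.proj →
    (∀ u : TangentSpace 𝓘(ℝ, E) p.proj,
      D (fun q : TotalSpace F V => vertLift q (β q.proj)) p (horLift cov p u) =
        vertLift p (cov β p.proj u)) ∧
    ∀ b : V p.proj,
      D (fun q : TotalSpace F V => vertLift q (β q.proj)) p (vertLift p b) = 0

theorem curvature_zero_left (hc : LocSmooth cov) {x : M} (w : TangentSpace 𝓘(ℝ, E) x) (v : V x) :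
    curvature cov x 0 w v = 0 := by
  have h := curvature_smul_left hc 0 0 w v
  rwa [zero_smul, zero_smul] at h

theorem curvature_zero_right (hc : LocSmooth cov) {x : M} (u : TangentSpace 𝓘(ℝ, E) x) (v : V x) :
    curvature cov x u 0 v = 0 := by
  have h := curvature_smul_right hc 0 u 0 v
  rwa [zero_smul, zero_smul] at h

/-- The horizontal coordinates of `Y^h` are those of `Y`, pulled back from the base, and its
vertical coordinates vanish; `cov_eq_coord` reassembles the covariant derivative of `Y`. -/
theorem liftedConnection_horLift (hc : LocSmooth cov) {Y : ∀ x : M, TangentSpace 𝓘(ℝ, E) x}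
    {p : TotalSpace F V}
    (hY : MDifferentiableAt 𝓘(ℝ, E) (𝓘(ℝ, E).prod 𝓘(ℝ, E))
      (fun y => (⟨y, Y y⟩ : TotalSpace E (TangentSpace 𝓘(ℝ, E) : M → Type _))) p.proj)
    (ξ : TangentSpace (𝓘(ℝ, E).prod 𝓘(ℝ, F)) p) :
    liftedConnection hc Λ (fun q : TotalSpace F V => horLift cov q (Y q.proj)) p ξ =
      horLift cov p (Λ Y p.proj (projTangent p ξ)) - (1 / 2 : ℝ) • vertLift p
        (curvature cov p.proj (projTangent p ξ) (Y p.proj) p.2) := by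
  have ht := FiberBundle.mem_baseSet_trivializationAt E (TangentSpace 𝓘(ℝ, E) : M → Type _)
    p.proj
  have he := FiberBundle.mem_baseSet_trivializationAt F V p.proj
  set t := trivializationAt E (TangentSpace 𝓘(ℝ, E) : M → Type _) p.proj
  have h1 : horCoord p (fun q : TotalSpace F V => horLift cov q (Y q.proj)) =
      fun q => secCoord t Y q.proj :=
    funext fun q => congrArg (t.continuousLinearMapAt ℝ q.proj) (projTangent_horLift cov q _)
  have h2 : vertCoord cov p (fun q : TotalSpace F V => horLift cov q (Y q.proj)) = fun _ => 0 :=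
    funext fun q => (congrArg (_ : V q.proj →L[ℝ] F) (connMap_horLift cov q _)).trans (map_zero _)
  have h3 := mvfderiv_comp_proj ((mdifferentiableAt_secCoord_iff t ht).2 hY) ξ
  have h4 := congrArg (fun A : TangentSpace 𝓘(ℝ, E) p.proj →L[ℝ] TangentSpace 𝓘(ℝ, E) p.proj =>
    A (projTangent p ξ)) (cov_eq_coord Λ t ht hY)
  have h5 : cov (constSec (trivializationAt F V p.proj) 0) p.proj = 0 := by
    have h := cov_constSec_smul cov (trivializationAt F V p.proj) he 0 0
    rwa [zero_smul, zero_smul] at h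
  refine (liftedDeriv_apply hc Λ _ p ξ).trans ?_
  rw [h1, h2, h3, mvfderiv_const, h5, h4, projTangent_horLift]
  simp only [zero_apply, map_zero, add_zero]
  rfl

theorem liftedConnection_vertLift (hc : LocSmooth cov) {β : ∀ x : M, V x}
    {p : TotalSpace F V}
    (hβ : MDifferentiableAt 𝓘(ℝ, E) (𝓘(ℝ, E).prod 𝓘(ℝ, F))
      (fun y => (⟨y, β y⟩ : TotalSpace F V)) p.proj)
    (ξ : TangentSpace (𝓘(ℝ, E).prod 𝓘(ℝ, F)) p) :
    liftedConnection hc Λ (fun q : TotalSpace F V => vertLift q (β q.proj)) p ξ =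
      vertLift p (cov β p.proj (projTangent p ξ)) := by
  have ht := FiberBundle.mem_baseSet_trivializationAt E (TangentSpace 𝓘(ℝ, E) : M → Type _)
    p.proj
  have he := FiberBundle.mem_baseSet_trivializationAt F V p.proj
  set e := trivializationAt F V p.proj
  have h1 : horCoord p (fun q : TotalSpace F V => vertLift (E := E) q (β q.proj)) = fun _ => 0 :=
    funext fun q => (congrArg (_ : TangentSpace 𝓘(ℝ, E) q.proj →L[ℝ] E)
      (projTangent_vertLift q _)).trans (map_zero _)
  have h2 : vertCoord cov p (fun q : TotalSpace F V => vertLift q (β q.proj)) =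
      fun q => secCoord e β q.proj :=
    funext fun q => congrArg (e.continuousLinearMapAt ℝ q.proj) (connMap_vertLift cov q _)
  have h3 := mvfderiv_comp_proj ((mdifferentiableAt_secCoord_iff e he).2 hβ) ξ
  have h4 := congrArg (fun A : TangentSpace 𝓘(ℝ, E) p.proj →L[ℝ] V p.proj =>
    A (projTangent p ξ)) (cov_eq_coord cov e he hβ)
  have h5 : Λ (constSec (trivializationAt E (TangentSpace 𝓘(ℝ, E) : M → Type _) p.proj) 0)
      p.proj = 0 := by
    have h := cov_constSec_smul Λ _ ht 0 0
    rwa [zero_smul, zero_smul] at h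
  refine (liftedDeriv_apply hc Λ _ p ξ).trans ?_
  rw [h1, h2, h3, mvfderiv_const, h5, h4, projTangent_vertLift, curvature_zero_right hc]
  simp only [zero_apply, map_zero, add_zero, zero_add, smul_zero, sub_zero]
  rfl

theorem isLift_liftedConnection (hc : LocSmooth cov)
    (Λ : CovariantDerivative 𝓘(ℝ, E) E (TangentSpace 𝓘(ℝ, E) : M → Type _)) :
    IsLift Λ cov (liftedConnection hc Λ) := by
  refine ⟨fun Y p hY => ⟨fun u => ?_, fun b => ?_⟩, fun β p hβ => ⟨fun u => ?_, fun b => ?_⟩⟩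
  · rw [liftedConnection_horLift hc hY, projTangent_horLift]
  · rw [liftedConnection_horLift hc hY, projTangent_vertLift, curvature_zero_left hc]
    simp only [map_zero, smul_zero, sub_zero]
  · rw [liftedConnection_vertLift hc hβ, projTangent_horLift]
  · rw [liftedConnection_vertLift hc hβ, projTangent_vertLift]
    simp only [map_zero]

/-- A general direction is horizontal plus vertical, and the vertical part contributes nothing; so
the direction enters through its projection only. -/
theorem IsLift.apply_horLift (h : IsLift Λ cov D) {Y : ∀ x : M, TangentSpace 𝓘(ℝ, E) x}
    {p : TotalSpace F V}
    (hY : MDifferentiableAt 𝓘(ℝ, E) (𝓘(ℝ, E).prod 𝓘(ℝ, E))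
      (fun y => (⟨y, Y y⟩ : TotalSpace E (TangentSpace 𝓘(ℝ, E) : M → Type _))) p.proj)
    (ξ : TangentSpace (𝓘(ℝ, E).prod 𝓘(ℝ, F)) p) :
    D (fun q : TotalSpace F V => horLift cov q (Y q.proj)) p ξ =
      horLift cov p (Λ Y p.proj (projTangent p ξ)) - (1 / 2 : ℝ) • vertLift p
        (curvature cov p.proj (projTangent p ξ) (Y p.proj) p.2) := by
  conv_lhs => rw [← horLift_add_vertLift cov p ξ]
  rw [map_add, (h.1 Y p hY).1, (h.1 Y p hY).2, add_zero]

theorem IsLift.apply_vertLift (h : IsLift Λ cov D) {β : ∀ x : M, V x} {p : TotalSpace F V}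
    (hβ : MDifferentiableAt 𝓘(ℝ, E) (𝓘(ℝ, E).prod 𝓘(ℝ, F))
      (fun y => (⟨y, β y⟩ : TotalSpace F V)) p.proj)
    (ξ : TangentSpace (𝓘(ℝ, E).prod 𝓘(ℝ, F)) p) :
    D (fun q : TotalSpace F V => vertLift q (β q.proj)) p ξ =
      vertLift p (cov β p.proj (projTangent p ξ)) := by
  conv_lhs => rw [← horLift_add_vertLift cov p ξ]
  rw [map_add, (h.2 β p hβ).1, (h.2 β p hβ).2, add_zero]

/-- The sum of the horizontal lift of `Y` and the vertical lift of `β`. -/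
def liftField (cov : CovariantDerivative 𝓘(ℝ, E) F V) (Y : ∀ x : M, TangentSpace 𝓘(ℝ, E) x)
    (β : ∀ x : M, V x) (q : TotalSpace F V) : TangentSpace (𝓘(ℝ, E).prod 𝓘(ℝ, F)) q :=
  horLift cov q (Y q.proj) + vertLift q (β q.proj)

theorem mdifferentiableAt_liftField (hc : LocSmooth cov) {Y : ∀ x : M, TangentSpace 𝓘(ℝ, E) x}
    {β : ∀ x : M, V x} {p : TotalSpace F V}
    (hY : MDifferentiableAt 𝓘(ℝ, E) (𝓘(ℝ, E).prod 𝓘(ℝ, E))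
      (fun y => (⟨y, Y y⟩ : TotalSpace E (TangentSpace 𝓘(ℝ, E) : M → Type _))) p.proj)
    (hβ : MDifferentiableAt 𝓘(ℝ, E) (𝓘(ℝ, E).prod 𝓘(ℝ, F))
      (fun y => (⟨y, β y⟩ : TotalSpace F V)) p.proj) :
    MDifferentiableAt (𝓘(ℝ, E).prod 𝓘(ℝ, F)) ((𝓘(ℝ, E).prod 𝓘(ℝ, F)).prod 𝓘(ℝ, E × F))
      (fun q => (⟨q, liftField cov Y β q⟩ :
        TangentBundle (𝓘(ℝ, E).prod 𝓘(ℝ, F)) (TotalSpace F V))) p :=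
  mdifferentiableAt_add_section (mdifferentiableAt_horLift hc (mdifferentiableAt_comp_proj hY))
    (mdifferentiableAt_vertLift hc (mdifferentiableAt_comp_proj hβ))

theorem contMDiffAt_liftField (hc : LocSmooth cov) {Y : ∀ x : M, TangentSpace 𝓘(ℝ, E) x}
    {β : ∀ x : M, V x} {p : TotalSpace F V}
    (hY : ContMDiffAt 𝓘(ℝ, E) (𝓘(ℝ, E).prod 𝓘(ℝ, E)) ∞
      (fun y => (⟨y, Y y⟩ : TotalSpace E (TangentSpace 𝓘(ℝ, E) : M → Type _))) p.proj)
    (hβ : ContMDiffAt 𝓘(ℝ, E) (𝓘(ℝ, E).prod 𝓘(ℝ, F)) ∞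
      (fun y => (⟨y, β y⟩ : TotalSpace F V)) p.proj) :
    ContMDiffAt (𝓘(ℝ, E).prod 𝓘(ℝ, F)) ((𝓘(ℝ, E).prod 𝓘(ℝ, F)).prod 𝓘(ℝ, E × F)) ∞
      (fun q => (⟨q, liftField cov Y β q⟩ :
        TangentBundle (𝓘(ℝ, E).prod 𝓘(ℝ, F)) (TotalSpace F V))) p :=
  ContMDiffAt.add_section (contMDiffAt_horLift hc (contMDiffAt_comp_proj hY))
    (contMDiffAt_vertLift hc (contMDiffAt_comp_proj hβ))

theorem tendsto_totalSpace_proj (p : TotalSpace F V) : Filter.Tendsto (π F V) (𝓝 p) (𝓝 p.proj) :=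
  (FiberBundle.continuous_proj F V).continuousAt

theorem smoothNear_liftField (hc : LocSmooth cov) {Y : ∀ x : M, TangentSpace 𝓘(ℝ, E) x}
    {β : ∀ x : M, V x} {p : TotalSpace F V} (hY : SmoothNear (F := E) 𝓘(ℝ, E) Y p.proj)
    (hβ : SmoothNear (F := F) 𝓘(ℝ, E) β p.proj) :
    SmoothNear (F := E × F) (𝓘(ℝ, E).prod 𝓘(ℝ, F)) (liftField cov Y β) p := by
  filter_upwards [(tendsto_totalSpace_proj p).eventually hY,
    (tendsto_totalSpace_proj p).eventually hβ] with q h1 h2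
  exact contMDiffAt_liftField hc h1 h2

/-- The central point: both lift formulas see `ξ` only through its projection, and the curvature
term vanishes with it. Lifted fields thus form a frame that is parallel along the fibres, from which
both the flatness and the formula for the vertical derivative follow. -/
theorem IsLift.apply_liftField_of_vertical (h : IsLift Λ cov D) (hc : LocSmooth cov)
    {Y : ∀ x : M, TangentSpace 𝓘(ℝ, E) x} {β : ∀ x : M, V x} {p : TotalSpace F V}
    (hY : MDifferentiableAt 𝓘(ℝ, E) (𝓘(ℝ, E).prod 𝓘(ℝ, E))
      (fun y => (⟨y, Y y⟩ : TotalSpace E (TangentSpace 𝓘(ℝ, E) : M → Type _))) p.proj)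
    (hβ : MDifferentiableAt 𝓘(ℝ, E) (𝓘(ℝ, E).prod 𝓘(ℝ, F))
      (fun y => (⟨y, β y⟩ : TotalSpace F V)) p.proj)
    {ξ : TangentSpace (𝓘(ℝ, E).prod 𝓘(ℝ, F)) p} (hξ : projTangent p ξ = 0) :
    D (liftField cov Y β) p ξ = 0 := by
  have h1 := D.isCovariantDerivativeOnUniv.add
    (mdifferentiableAt_horLift hc (mdifferentiableAt_comp_proj hY))
    (mdifferentiableAt_vertLift hc (mdifferentiableAt_comp_proj hβ))
  refine (congrArg (fun A : E × F →L[ℝ] E × F => A ξ) h1).trans ?_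
  refine (congrArg₂ (· + ·) (h.apply_horLift hY ξ) (h.apply_vertLift hβ ξ)).trans ?_
  rw [hξ, curvature_zero_left hc]
  simp only [map_zero, smul_zero, sub_zero]
  exact add_zero (0 : E × F)

/-- The curvature is smooth along smooth maps. -/
theorem contMDiffAt_curvature_comp (hc : LocSmooth cov) {p : TotalSpace F V}
    {u : ∀ q : TotalSpace F V, TangentSpace 𝓘(ℝ, E) q.proj} {Y : ∀ x : M, TangentSpace 𝓘(ℝ, E) x}
    (hu : ContMDiffAt (𝓘(ℝ, E).prod 𝓘(ℝ, F)) (𝓘(ℝ, E).prod 𝓘(ℝ, E)) ∞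
      (fun q => (⟨q.proj, u q⟩ : TangentBundle 𝓘(ℝ, E) M)) p)
    (hY : SmoothNear (F := E) 𝓘(ℝ, E) Y p.proj) :
    ContMDiffAt (𝓘(ℝ, E).prod 𝓘(ℝ, F)) (𝓘(ℝ, E).prod 𝓘(ℝ, F)) ∞
      (fun q : TotalSpace F V =>
        (⟨q.proj, curvature cov q.proj (u q) (Y q.proj) q.2⟩ : TotalSpace F V)) p := by
  have ht := FiberBundle.mem_baseSet_trivializationAt E (TangentSpace 𝓘(ℝ, E) : M → Type _)
    p.proj
  have he := FiberBundle.mem_baseSet_trivializationAt F V p.proj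
  set t := trivializationAt E (TangentSpace 𝓘(ℝ, E) : M → Type _) p.proj
  set e := trivializationAt F V p.proj
  let b := Module.finBasis ℝ E
  let c := Module.finBasis ℝ F
  refine (contMDiffAt_totalSpace_iff_coord e he _).2 ?_
  have h1 : ContMDiffAt (𝓘(ℝ, E).prod 𝓘(ℝ, F)) 𝓘(ℝ, F) ∞ (fun q : TotalSpace F V =>
      ∑ i, ∑ k, (LinearMap.toContinuousLinearMap (b.coord i) (t.continuousLinearMapAt ℝ q.proj (u q)) *
        LinearMap.toContinuousLinearMap (c.coord k) (e q).2) •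
          secCoord e (fun y => curvature cov y (constSec t (b i) y) (Y y) (constSec e (c k) y))
            q.proj) p := by
    refine contMDiffAt_sum fun i => contMDiffAt_sum fun k => ?_
    have h2 := (LinearMap.toContinuousLinearMap (b.coord i)).contMDiff.contMDiffAt.comp p
      ((contMDiffAt_totalSpace_iff_coord t ht _).1 hu)
    have h3 := (LinearMap.toContinuousLinearMap (c.coord k)).contMDiff.contMDiffAt.comp p
      (contMDiffAt_fibreCoord (E := E) e he)
    have h4 := ((contMDiffAt_secCoord_iff e he).2 (smoothNear_curvature hc
      (smoothNear_constSec e (c k) he) (smoothNear_constSec t (b i) ht) hY).contMDiffAt).comp p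
      (contMDiffAt_proj V)
    exact (h2.mul h3).smul h4
  refine h1.congr_of_eventuallyEq ?_
  filter_upwards [(tendsto_totalSpace_proj p).eventually (t.open_baseSet.mem_nhds ht),
    (tendsto_totalSpace_proj p).eventually (e.open_baseSet.mem_nhds he)] with q hqt hqe
  -- With `Y` fixed, the curvature is bilinear in the direction and in the point of the fibre.
  -- Expanding both in constant frames leaves smooth coefficients times curvature sections pulled
  -- back from `M`.
  let R : TangentSpace 𝓘(ℝ, E) q.proj →ₗ[ℝ] V q.proj →ₗ[ℝ] V q.proj :=
    LinearMap.mk₂ ℝ (fun u v => curvature cov q.proj u (Y q.proj) v)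
      (fun u u' v => curvature_add_left hc u u' _ v) (fun a u v => curvature_smul_left hc a u _ v)
      (fun u v v' => curvature_section_add hc u _ v v')
      (fun a u v => curvature_section_smul hc a u _ v)
  have h5 : u q = ∑ i, b.repr (t.continuousLinearMapAt ℝ q.proj (u q)) i • constSec t (b i) q.proj := by
    conv_lhs => rw [← t.symmL_continuousLinearMapAt (R := ℝ) hqt (u q),
      ← b.sum_repr (t.continuousLinearMapAt ℝ q.proj (u q)), map_sum]
    exact Finset.sum_congr rfl fun i _ => map_smul _ _ _
  have h6 : q.2 = ∑ k, c.repr (e q).2 k • constSec e (c k) q.proj := by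
    conv_lhs => rw [← constSec_of_coord hqe q.2]
    refine (congrArg (e.symmL ℝ q.proj) (c.sum_repr (e q).2).symm).trans ?_
    rw [map_sum]
    exact Finset.sum_congr rfl fun i _ => map_smul _ _ _
  have h7 : curvature cov q.proj (u q) (Y q.proj) q.2 = R (u q) q.2 := rfl
  rw [h7]
  conv_lhs => rw [h5, h6]
  simp only [map_sum, LinearMap.sum_apply, map_smul, LinearMap.smul_apply, Finset.smul_sum,
    smul_smul]
  rw [Finset.sum_comm]
  refine Finset.sum_congr rfl fun i _ => Finset.sum_congr rfl fun k _ => ?_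
  rw [mul_comm]
  rfl

/-- `IsLift.apply_horLift` expresses the derivative in every direction by lifts of fields that
depend smoothly on the point of the total space. -/
theorem IsLift.contMDiffAt_cov_horLift (h : IsLift Λ cov D) (hc : LocSmooth cov) (hΛ : LocSmooth Λ)
    {Y : ∀ x : M, TangentSpace 𝓘(ℝ, E) x} {p : TotalSpace F V}
    (hY : SmoothNear (F := E) 𝓘(ℝ, E) Y p.proj) :
    ContMDiffAt (𝓘(ℝ, E).prod 𝓘(ℝ, F)) ((𝓘(ℝ, E).prod 𝓘(ℝ, F)).prod 𝓘(ℝ, E × F →L[ℝ] E × F)) ∞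
      (fun q => (⟨q, D (fun q : TotalSpace F V => horLift cov q (Y q.proj)) q⟩ :
        TotalSpace (E × F →L[ℝ] E × F) (fun q : TotalSpace F V =>
          TangentSpace (𝓘(ℝ, E).prod 𝓘(ℝ, F)) q →L[ℝ] TangentSpace (𝓘(ℝ, E).prod 𝓘(ℝ, F)) q))) p := by
  refine contMDiffAt_hom_of_constSec fun a => ?_
  set Z := constSec (trivializationAt (E × F) (TangentSpace (𝓘(ℝ, E).prod 𝓘(ℝ, F)) :
    TotalSpace F V → Type _) p) a
  have hZ := ((contMDiffAt_vectorField_iff hc).1 (smoothNear_constSec (IB := 𝓘(ℝ, E).prod 𝓘(ℝ, F))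
    _ a (FiberBundle.mem_baseSet_trivializationAt (E × F) (TangentSpace (𝓘(ℝ, E).prod 𝓘(ℝ, F)) :
    TotalSpace F V → Type _) p)).contMDiffAt).1
  have h1 := contMDiffAt_horLift hc (ContMDiffAt.clm_bundle_apply
    (contMDiffAt_comp_proj (hΛ Y p.proj hY)) hZ)
  have h2 := contMDiffAt_vertLift hc (contMDiffAt_curvature_comp hc hZ hY)
  refine (h1.sub_section (contMDiffAt_const (c := (1 / 2 : ℝ)) |>.smul_section h2)).congr_of_eventuallyEq ?_
  filter_upwards [(tendsto_totalSpace_proj p).eventually hY] with q hq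
  exact congrArg (TotalSpace.mk q) (h.apply_horLift (hq.mdifferentiableAt (by simp)) _)

theorem IsLift.contMDiffAt_cov_vertLift (h : IsLift Λ cov D) (hc : LocSmooth cov)
    {β : ∀ x : M, V x} {p : TotalSpace F V} (hβ : SmoothNear (F := F) 𝓘(ℝ, E) β p.proj) :
    ContMDiffAt (𝓘(ℝ, E).prod 𝓘(ℝ, F)) ((𝓘(ℝ, E).prod 𝓘(ℝ, F)).prod 𝓘(ℝ, E × F →L[ℝ] E × F)) ∞
      (fun q => (⟨q, D (fun q : TotalSpace F V => vertLift q (β q.proj)) q⟩ :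
        TotalSpace (E × F →L[ℝ] E × F) (fun q : TotalSpace F V =>
          TangentSpace (𝓘(ℝ, E).prod 𝓘(ℝ, F)) q →L[ℝ] TangentSpace (𝓘(ℝ, E).prod 𝓘(ℝ, F)) q))) p := by
  refine contMDiffAt_hom_of_constSec fun a => ?_
  have hZ := ((contMDiffAt_vectorField_iff hc).1 (smoothNear_constSec (IB := 𝓘(ℝ, E).prod 𝓘(ℝ, F))
    _ a (FiberBundle.mem_baseSet_trivializationAt (E × F) (TangentSpace (𝓘(ℝ, E).prod 𝓘(ℝ, F)) :
    TotalSpace F V → Type _) p)).contMDiffAt).1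
  have h1 := contMDiffAt_vertLift hc (ContMDiffAt.clm_bundle_apply
    (contMDiffAt_comp_proj (hc β p.proj hβ)) hZ)
  refine h1.congr_of_eventuallyEq ?_
  filter_upwards [(tendsto_totalSpace_proj p).eventually hβ] with q hq
  exact congrArg (TotalSpace.mk q) (h.apply_vertLift (hq.mdifferentiableAt (by simp)) _)

/-- Every lifted connection is smooth. -/
theorem IsLift.locSmooth (h : IsLift Λ cov D) (hc : LocSmooth cov) (hΛ : LocSmooth Λ) :
    LocSmooth D := by
  intro Z p hZ
  have ht := FiberBundle.mem_baseSet_trivializationAt E (TangentSpace 𝓘(ℝ, E) : M → Type _)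
    p.proj
  have he := FiberBundle.mem_baseSet_trivializationAt F V p.proj
  set t := trivializationAt E (TangentSpace 𝓘(ℝ, E) : M → Type _) p.proj with htdef
  set e := trivializationAt F V p.proj with hedef
  let b := Module.finBasis ℝ E
  let c := Module.finBasis ℝ F
  -- The lifts of constant sections over `M` frame the tangent spaces near `p`, and the defining
  -- formulas give the derivatives of these lifts.
  refine contMDiffAt_cov_of_frame D
    (s := Sum.elim (fun i q => horLift cov q (constSec t (b i) q.proj))
      (fun k q => vertLift q (constSec e (c k) q.proj)))
    (f := Sum.elim (fun i q => LinearMap.toContinuousLinearMap (b.coord i) (horCoord p Z q))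
      (fun k q => LinearMap.toContinuousLinearMap (c.coord k) (vertCoord cov p Z q)))
    ?_ ?_ ?_ ?_
  · rintro (i | k)
    · filter_upwards [(tendsto_totalSpace_proj p).eventually (t.open_baseSet.mem_nhds ht)] with q hq
      exact contMDiffAt_horLift hc (contMDiffAt_comp_proj (contMDiffAt_constSec t (b i) hq))
    · filter_upwards [(tendsto_totalSpace_proj p).eventually (e.open_baseSet.mem_nhds he)] with q hq
      exact contMDiffAt_vertLift hc (contMDiffAt_comp_proj (contMDiffAt_constSec e (c k) hq))
  · rintro (i | k)
    · filter_upwards [(tendsto_totalSpace_proj p).eventually (t.open_baseSet.mem_nhds ht), hZ]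
        with q hq hZq
      exact (LinearMap.toContinuousLinearMap (b.coord i)).contMDiff.contMDiffAt.comp q
        (contMDiffAt_horCoord hc hq hZq)
    · filter_upwards [(tendsto_totalSpace_proj p).eventually (e.open_baseSet.mem_nhds he), hZ]
        with q hq hZq
      exact (LinearMap.toContinuousLinearMap (c.coord k)).contMDiff.contMDiffAt.comp q
        (contMDiffAt_vertCoord hc hq hZq)
  · filter_upwards [(tendsto_totalSpace_proj p).eventually (t.open_baseSet.mem_nhds ht),
      (tendsto_totalSpace_proj p).eventually (e.open_baseSet.mem_nhds he)] with q hqt hqe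
    have h5 : projTangent q (Z q) = ∑ i, b.repr (horCoord p Z q) i • constSec t (b i) q.proj := by
      conv_lhs => rw [← t.symmL_continuousLinearMapAt (R := ℝ) hqt (projTangent q (Z q))]
      refine (congrArg (t.symmL ℝ q.proj) (b.sum_repr (horCoord p Z q)).symm).trans ?_
      rw [map_sum]
      exact Finset.sum_congr rfl fun i _ => map_smul _ _ _
    have h6 : connMap cov q (Z q) = ∑ k, c.repr (vertCoord cov p Z q) k • constSec e (c k) q.proj := by
      conv_lhs => rw [← e.symmL_continuousLinearMapAt (R := ℝ) hqe (connMap cov q (Z q))]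
      refine (congrArg (e.symmL ℝ q.proj) (c.sum_repr (vertCoord cov p Z q)).symm).trans ?_
      rw [map_sum]
      exact Finset.sum_congr rfl fun i _ => map_smul _ _ _
    conv_lhs => rw [← horLift_add_vertLift cov q (Z q), h5, h6, map_sum, map_sum]
    rw [Fintype.sum_sum_type]
    refine congrArg₂ (· + ·) (Finset.sum_congr rfl fun i _ => ?_) (Finset.sum_congr rfl fun i _ => ?_)
    · exact map_smul (horLift cov q) _ _
    · exact map_smul (vertLift q) _ _
  · rintro (i | k)
    · exact h.contMDiffAt_cov_horLift hc hΛ (smoothNear_constSec t (b i) ht)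
    · exact h.contMDiffAt_cov_vertLift hc (smoothNear_constSec e (c k) he)

/-- Vertical fields annihilate functions pulled back from `M`, hence so does their bracket. Taking
the chart of `M` as the function, whose differential is injective, shows that the projection
vanishes. -/
theorem projTangent_mlieBracket_of_vertical {X Y : ∀ q : TotalSpace F V,
      TangentSpace (𝓘(ℝ, E).prod 𝓘(ℝ, F)) q} {p : TotalSpace F V}
    (hX : MDifferentiableAt (𝓘(ℝ, E).prod 𝓘(ℝ, F)) ((𝓘(ℝ, E).prod 𝓘(ℝ, F)).prod 𝓘(ℝ, E × F))
      (fun q => (⟨q, X q⟩ : TangentBundle (𝓘(ℝ, E).prod 𝓘(ℝ, F)) (TotalSpace F V))) p)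
    (hY : MDifferentiableAt (𝓘(ℝ, E).prod 𝓘(ℝ, F)) ((𝓘(ℝ, E).prod 𝓘(ℝ, F)).prod 𝓘(ℝ, E × F))
      (fun q => (⟨q, Y q⟩ : TangentBundle (𝓘(ℝ, E).prod 𝓘(ℝ, F)) (TotalSpace F V))) p)
    (hX0 : ∀ q, projTangent q (X q) = 0) (hY0 : ∀ q, projTangent q (Y q) = 0) :
    projTangent p (VectorField.mlieBracket (𝓘(ℝ, E).prod 𝓘(ℝ, F)) X Y p) = 0 := by
  let f : M → E := extChartAt 𝓘(ℝ, E) p.proj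
  have hf : ContMDiffAt 𝓘(ℝ, E) 𝓘(ℝ, E) ∞ f p.proj := contMDiffAt_extChartAt
  have hfp : ContMDiffAt (𝓘(ℝ, E).prod 𝓘(ℝ, F)) 𝓘(ℝ, E) ∞ (fun q : TotalSpace F V => f q.proj) p :=
    hf.comp p (contMDiffAt_proj V)
  have hev : ∀ Z : ∀ q : TotalSpace F V, TangentSpace (𝓘(ℝ, E).prod 𝓘(ℝ, F)) q,
      (∀ q, projTangent q (Z q) = 0) →
      (fun q => mvfderiv (𝓘(ℝ, E).prod 𝓘(ℝ, F)) (fun q : TotalSpace F V => f q.proj) q (Z q))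
        =ᶠ[𝓝 p] fun _ => 0 := by
    intro Z hZ
    filter_upwards [(tendsto_totalSpace_proj p).eventually
      ((chartAt E p.proj).open_source.mem_nhds (mem_chart_source E p.proj))] with q hq
    rw [mvfderiv_comp_proj (mdifferentiableAt_extChartAt hq), hZ, map_zero]
  have h0 : ∀ Z : ∀ q : TotalSpace F V, TangentSpace (𝓘(ℝ, E).prod 𝓘(ℝ, F)) q,
      (∀ q, projTangent q (Z q) = 0) → MDifferentiableAt (𝓘(ℝ, E).prod 𝓘(ℝ, F)) 𝓘(ℝ, E)
        (fun q => mvfderiv (𝓘(ℝ, E).prod 𝓘(ℝ, F)) (fun q : TotalSpace F V => f q.proj) q (Z q)) p :=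
    fun Z hZ => mdifferentiableAt_const.congr_of_eventuallyEq (hev Z hZ)
  have h1 := mvfderiv_mlieBracket hfp hX hY (h0 X hX0) (h0 Y hY0)
  rw [mvfderiv_congr (hev X hX0), mvfderiv_congr (hev Y hY0), mvfderiv_const,
    mvfderiv_comp_proj (hf.mdifferentiableAt (by simp))] at h1
  have h2 : Function.Injective (mfderiv 𝓘(ℝ, E) 𝓘(ℝ, E) (extChartAt 𝓘(ℝ, E) p.proj) p.proj) :=
    (isInvertible_mfderiv_extChartAt (mem_extChartAt_source p.proj)).injective
  exact h2 (h1.trans ((sub_self (0 : E)).trans (map_zero (mfderiv 𝓘(ℝ, E) 𝓘(ℝ, E)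
    (extChartAt 𝓘(ℝ, E) p.proj) p.proj)).symm))

/-- Every lifted connection is flat along the fibres. -/
theorem IsLift.curvature_eq_zero (h : IsLift Λ cov D) (hc : LocSmooth cov) (hΛ : LocSmooth Λ)
    {p : TotalSpace F V} {ξ η ζ : TangentSpace (𝓘(ℝ, E).prod 𝓘(ℝ, F)) p}
    (hξ : projTangent p ξ = 0) (hη : projTangent p η = 0) : curvature D p ξ η ζ = 0 := by
  have hD := h.locSmooth hc hΛ
  -- `ζ` is extended to a lifted field, which is parallel in vertical directions on a whole
  -- neighbourhood, and `ξ`, `η` to vertical fields. Each of the three curvature terms then vanishes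
  -- separately.
  let Z := liftField cov (constExt E (projTangent p ζ)) (constExt F (connMap cov p ζ))
  let X : ∀ q : TotalSpace F V, TangentSpace (𝓘(ℝ, E).prod 𝓘(ℝ, F)) q :=
    fun q => vertLift q (constExt F (vertInv p ξ) q.proj)
  let Y : ∀ q : TotalSpace F V, TangentSpace (𝓘(ℝ, E).prod 𝓘(ℝ, F)) q :=
    fun q => vertLift q (constExt F (vertInv p η) q.proj)
  have hZs : SmoothNear (F := E × F) (𝓘(ℝ, E).prod 𝓘(ℝ, F)) Z p :=
    smoothNear_liftField hc (smoothNear_constExt _) (smoothNear_constExt _)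
  have hv : ∀ b : V p.proj, SmoothNear (F := E × F) (𝓘(ℝ, E).prod 𝓘(ℝ, F))
      (fun q : TotalSpace F V => vertLift (E := E) q (constExt F b q.proj)) p := by
    intro b
    filter_upwards [(tendsto_totalSpace_proj p).eventually
      (smoothNear_constExt (IB := 𝓘(ℝ, E)) (F := F) b)] with q hq
    exact contMDiffAt_vertLift hc (contMDiffAt_comp_proj hq)
  have hXs : SmoothNear (F := E × F) (𝓘(ℝ, E).prod 𝓘(ℝ, F)) X p := hv _
  have hYs : SmoothNear (F := E × F) (𝓘(ℝ, E).prod 𝓘(ℝ, F)) Y p := hv _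
  have hX1 : X p = ξ := by
    simp only [X, constExt_self]
    exact vertLift_vertInv p ξ hξ
  have hY1 : Y p = η := by
    simp only [Y, constExt_self]
    exact vertLift_vertInv p η hη
  have hZ1 : Z p = ζ := by
    simp only [Z, liftField, constExt_self]
    exact horLift_add_vertLift cov p ζ
  have hX0 : ∀ q, projTangent q (X q) = 0 := fun q => projTangent_vertLift q _
  have hY0 : ∀ q, projTangent q (Y q) = 0 := fun q => projTangent_vertLift q _
  have hDZ : ∀ᶠ q in 𝓝 p, ∀ θ : TangentSpace (𝓘(ℝ, E).prod 𝓘(ℝ, F)) q, projTangent q θ = 0 →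
      D Z q θ = 0 := by
    filter_upwards [(tendsto_totalSpace_proj p).eventually (smoothNear_constExt (IB := 𝓘(ℝ, E))
      (F := E) (projTangent p ζ)), (tendsto_totalSpace_proj p).eventually
      (smoothNear_constExt (IB := 𝓘(ℝ, E)) (F := F) (connMap cov p ζ))] with q h1 h2 θ hθ
    exact h.apply_liftField_of_vertical hc (h1.mdifferentiableAt (by simp))
      (h2.mdifferentiableAt (by simp)) hθ
  have h1 := curvature_eq_curvSec hD hZs hXs hYs
  rw [hX1, hY1, hZ1] at h1
  rw [h1, curvSec, hDZ.self_of_nhds _ (projTangent_mlieBracket_of_vertical hXs.mdifferentiableAt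
    hYs.mdifferentiableAt hX0 hY0)]
  have h2 : ∀ W : ∀ q : TotalSpace F V, TangentSpace (𝓘(ℝ, E).prod 𝓘(ℝ, F)) q,
      (∀ q, projTangent q (W q) = 0) → D (fun q => D Z q (W q)) p = 0 := by
    intro W hW
    have h3 : ∀ᶠ q in 𝓝 p, (0 : ∀ q : TotalSpace F V, TangentSpace (𝓘(ℝ, E).prod 𝓘(ℝ, F)) q) q =
        D Z q (W q) := by
      filter_upwards [hDZ] with q hq using (hq _ (hW q)).symm
    -- The zero field is a constant section, which supplies the differentiability that locality
    -- requires.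
    have h0 : constSec (trivializationAt (E × F) (TangentSpace (𝓘(ℝ, E).prod 𝓘(ℝ, F)) :
        TotalSpace F V → Type _) p) 0 = 0 := funext fun q => map_zero _
    have h4 := (smoothNear_constSec (IB := 𝓘(ℝ, E).prod 𝓘(ℝ, F)) (trivializationAt (E × F)
      (TangentSpace (𝓘(ℝ, E).prod 𝓘(ℝ, F)) : TotalSpace F V → Type _) p) 0
      (FiberBundle.mem_baseSet_trivializationAt _ _ p)).mdifferentiableAt
    rw [h0] at h4
    rw [← cov_congr D h4 h3]
    exact congrFun D.zero p
  rw [h2 X hX0, h2 Y hY0]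
  simp

end LiftCharacterization

/-! ### Forms along a single fibre, in the frame of lifts. -/

section VerticalDerivative

variable {E : Type*} [NormedAddCommGroup E] [NormedSpace ℝ E] [FiniteDimensional ℝ E]
  {M : Type*} [TopologicalSpace M] [ChartedSpace E M] [IsManifold 𝓘(ℝ, E) ∞ M]
  {F : Type*} [NormedAddCommGroup F] [NormedSpace ℝ F] [FiniteDimensional ℝ F]
  {V : M → Type*} [TopologicalSpace (TotalSpace F V)] [∀ x, AddCommGroup (V x)]
  [∀ x, Module ℝ (V x)] [∀ x, TopologicalSpace (V x)] [∀ x, IsTopologicalAddGroup (V x)]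
  [∀ x, ContinuousSMul ℝ (V x)] [FiberBundle F V] [VectorBundle ℝ F V]
  [ContMDiffVectorBundle ∞ F V 𝓘(ℝ, E)]
  {cov : CovariantDerivative 𝓘(ℝ, E) F V} {l : ℕ}

/-- The point of the fibre over `x` with coordinates `w` in the trivialization at `x`. -/
abbrev fibrePoint (x : M) (w : F) : TotalSpace F V :=
  ⟨x, (trivializationAt F V x).symmL ℝ x w⟩

theorem fibreCoord_fibrePoint (x : M) (w : F) :
    (trivializationAt F V x (fibrePoint x w)).2 = w :=
  constSec_coord (FiberBundle.mem_baseSet_trivializationAt F V x) w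

theorem exists_eq_fibrePoint (p : TotalSpace F V) : ∃ x w, p = fibrePoint x w :=
  ⟨p.proj, (trivializationAt F V p.proj p).2, congrArg (TotalSpace.mk p.proj)
    (constSec_of_coord (FiberBundle.mem_baseSet_trivializationAt F V p.proj) p.2).symm⟩

theorem contMDiff_fibrePoint (x : M) :
    ContMDiff 𝓘(ℝ, F) (𝓘(ℝ, E).prod 𝓘(ℝ, F)) ∞ (fibrePoint (F := F) (V := V) x) := by
  intro w
  have hx := FiberBundle.mem_baseSet_trivializationAt F V x
  refine ((trivializationAt F V x).contMDiffAt_iff (n := ∞) (IB := 𝓘(ℝ, E))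
    ((trivializationAt F V x).mem_source.2 hx)).2 ⟨contMDiffAt_const, ?_⟩
  exact contMDiffAt_id.congr_of_eventuallyEq
    (Filter.Eventually.of_forall fun w => fibreCoord_fibrePoint x w)

/-- The derivative is vertical because the projection is constant along the fibre, and a vertical
vector is determined by the derivative of the fibre coordinate, which inverts `fibrePoint`. -/
theorem mfderiv_fibrePoint (x : M) (w b : F) :
    mfderiv 𝓘(ℝ, F) (𝓘(ℝ, E).prod 𝓘(ℝ, F)) (fibrePoint (F := F) (V := V) x) w b =
      vertLift (E := E) (fibrePoint x w) ((trivializationAt F V x).symmL ℝ x b) := by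
  have hx := FiberBundle.mem_baseSet_trivializationAt F V x
  have h1 : MDifferentiableAt 𝓘(ℝ, F) (𝓘(ℝ, E).prod 𝓘(ℝ, F)) (fibrePoint (F := F) (V := V) x) w :=
    (contMDiff_fibrePoint x w).mdifferentiableAt (by simp)
  set ξ := mfderiv 𝓘(ℝ, F) (𝓘(ℝ, E).prod 𝓘(ℝ, F)) (fibrePoint (F := F) (V := V) x) w b with hξ
  have h2 : projTangent (fibrePoint x w) ξ = 0 := by
    have h3 := mfderiv_comp w (mdifferentiableAt_totalSpace_proj (E := E) (fibrePoint x w)) h1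
    have h4 : π F V ∘ fibrePoint (F := F) (V := V) x = fun _ => x := rfl
    rw [h4, mfderiv_const] at h3
    exact (congrArg (fun A : F →L[ℝ] E => A b) h3).symm
  have h3 := mfderiv_comp w (mdifferentiableAt_fibreCoord (E := E) (trivializationAt F V x)
    (q := fibrePoint x w) hx) h1
  have h4 : (fun q : TotalSpace F V => (trivializationAt F V x q).2) ∘
      fibrePoint (F := F) (V := V) x = id := funext fun w => fibreCoord_fibrePoint x w
  rw [h4, mfderiv_id] at h3
  have h5 : b = mvfderiv (𝓘(ℝ, E).prod 𝓘(ℝ, F))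
      (fun q : TotalSpace F V => (trivializationAt F V x q).2) (fibrePoint x w) ξ :=
    congrArg (fun A : F →L[ℝ] F => A b) h3
  rw [← vertLift_vertInv (fibrePoint x w) ξ h2, mvfderiv_fibreCoord_vertLift _ hx] at h5
  rw [h5, (trivializationAt F V x).symmL_continuousLinearMapAt hx]
  exact (vertLift_vertInv (fibrePoint x w) ξ h2).symm

/-- The splitting of the tangent space at `q` into horizontal and vertical vectors, in the
trivializations at the base point. -/
def frameMap (cov : CovariantDerivative 𝓘(ℝ, E) F V) (q : TotalSpace F V) :
    E × F →L[ℝ] TangentSpace (𝓘(ℝ, E).prod 𝓘(ℝ, F)) q :=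
  horLift cov q ∘L (trivializationAt E (TangentSpace 𝓘(ℝ, E) : M → Type _) q.proj).symmL ℝ q.proj ∘L
      ContinuousLinearMap.fst ℝ E F +
    vertLift q ∘L (trivializationAt F V q.proj).symmL ℝ q.proj ∘L ContinuousLinearMap.snd ℝ E F

/-- The inverse of `frameMap`. -/
def coframeMap (cov : CovariantDerivative 𝓘(ℝ, E) F V) (q : TotalSpace F V) :
    TangentSpace (𝓘(ℝ, E).prod 𝓘(ℝ, F)) q →L[ℝ] E × F :=
  ((trivializationAt E (TangentSpace 𝓘(ℝ, E) : M → Type _) q.proj).continuousLinearMapAt ℝ q.proj ∘L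
    projTangent q).prod ((trivializationAt F V q.proj).continuousLinearMapAt ℝ q.proj ∘L
    connMap cov q)

theorem frameMap_apply (q : TotalSpace F V) (a : E × F) :
    frameMap cov q a =
      horLift cov q ((trivializationAt E (TangentSpace 𝓘(ℝ, E) : M → Type _) q.proj).symmL ℝ
        q.proj a.1) + vertLift q ((trivializationAt F V q.proj).symmL ℝ q.proj a.2) := rfl

/-- This order of composition is the one that appears when `vertDeriv` is iterated. -/
theorem coframeMap_frameMap (q : TotalSpace F V) (a : E × F) :
    coframeMap cov q (frameMap cov q a) = a := by
  have h1 : projTangent q (frameMap cov q a) =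
      (trivializationAt E (TangentSpace 𝓘(ℝ, E) : M → Type _) q.proj).symmL ℝ q.proj a.1 := by
    rw [frameMap_apply, map_add, projTangent_horLift, projTangent_vertLift, add_zero]
  have h2 : connMap cov q (frameMap cov q a) =
      (trivializationAt F V q.proj).symmL ℝ q.proj a.2 := by
    rw [frameMap_apply, map_add, connMap_horLift, connMap_vertLift, zero_add]
  refine Prod.ext ?_ ?_
  · exact (congrArg _ h1).trans ((trivializationAt E (TangentSpace 𝓘(ℝ, E) : M → Type _)
      q.proj).continuousLinearMapAt_symmL (R := ℝ)
      (FiberBundle.mem_baseSet_trivializationAt E _ q.proj) a.1)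
  · exact (congrArg _ h2).trans ((trivializationAt F V q.proj).continuousLinearMapAt_symmL (R := ℝ)
      (FiberBundle.mem_baseSet_trivializationAt F V q.proj) a.2)

/-- The coordinates on the right do not involve `w`: in the adapted frame, lifted fields are
constant along the fibre. -/
theorem liftField_fibrePoint (Y : ∀ x : M, TangentSpace 𝓘(ℝ, E) x) (β : ∀ x : M, V x) (x : M)
    (w : F) : liftField cov Y β (fibrePoint x w) = frameMap cov (fibrePoint x w)
      ((trivializationAt E (TangentSpace 𝓘(ℝ, E) : M → Type _) x).continuousLinearMapAt ℝ x (Y x),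
        (trivializationAt F V x).continuousLinearMapAt ℝ x (β x)) := by
  have h1 := (trivializationAt E (TangentSpace 𝓘(ℝ, E) : M → Type _)
    x).symmL_continuousLinearMapAt (R := ℝ)
    (FiberBundle.mem_baseSet_trivializationAt E _ x) (Y x)
  have h2 := (trivializationAt F V x).symmL_continuousLinearMapAt (R := ℝ)
    (FiberBundle.mem_baseSet_trivializationAt F V x) (β x)
  exact (congrArg₂ (fun u b => horLift cov (fibrePoint x w) u + vertLift (fibrePoint x w) b)
    h1 h2).symm

/-- The form `α` along the fibre over `x`, in the adapted frame. -/
def fibreForm (cov : CovariantDerivative 𝓘(ℝ, E) F V)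
    (α : ∀ q : TotalSpace F V, Forms (𝓘(ℝ, E).prod 𝓘(ℝ, F)) l q) (x : M) (w : F) :
    (E × F) [⋀^Fin l]→L[ℝ] ℝ :=
  (show TangentSpace (𝓘(ℝ, E).prod 𝓘(ℝ, F)) (fibrePoint (F := F) (V := V) x w) [⋀^Fin l]→L[ℝ] ℝ
    from α (fibrePoint x w)).compContinuousLinearMap (frameMap cov (fibrePoint x w))

theorem form_liftField_fibrePoint
    (α : ∀ q : TotalSpace F V, Forms (𝓘(ℝ, E).prod 𝓘(ℝ, F)) l q)
    (Y : Fin l → ∀ x : M, TangentSpace 𝓘(ℝ, E) x) (β : Fin l → ∀ x : M, V x) (x : M) (w : F) :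
    (show ℝ from α (fibrePoint x w) fun i => liftField cov (Y i) (β i) (fibrePoint x w)) =
      fibreForm cov α x w fun i =>
        ((trivializationAt E (TangentSpace 𝓘(ℝ, E) : M → Type _) x).continuousLinearMapAt ℝ x
          (Y i x), (trivializationAt F V x).continuousLinearMapAt ℝ x (β i x)) :=
  congrArg (fun y => (show ℝ from α (fibrePoint x w) y))
    (funext fun i => liftField_fibrePoint (Y i) (β i) x w)

/-- A fixed vector of `E × F` corresponds to the lift of constant sections, which is smooth on the
total space; the rest is restriction to the fibre by the smooth map `fibrePoint`. -/
theorem contDiff_fibreForm (hc : LocSmooth cov)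
    {α : ∀ q : TotalSpace F V, Forms (𝓘(ℝ, E).prod 𝓘(ℝ, F)) l q}
    (hα : ContMDiff (𝓘(ℝ, E).prod 𝓘(ℝ, F))
      ((𝓘(ℝ, E).prod 𝓘(ℝ, F)).prod 𝓘(ℝ, (E × F) [⋀^Fin l]→L[ℝ] ℝ)) ∞
      (fun q => (⟨q, α q⟩ : TotalSpace ((E × F) [⋀^Fin l]→L[ℝ] ℝ)
        (fun q : TotalSpace F V => Forms (𝓘(ℝ, E).prod 𝓘(ℝ, F)) l q)))) (x : M) :
    ContDiff ℝ ∞ (fibreForm cov α x) := by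
  rw [← contMDiff_iff_contDiff]
  intro w
  refine contMDiffAt_alternating_of_apply fun a => ?_
  have ht := FiberBundle.mem_baseSet_trivializationAt E (TangentSpace 𝓘(ℝ, E) : M → Type _) x
  have he := FiberBundle.mem_baseSet_trivializationAt F V x
  have h1 := contMDiffAt_form_apply (hα (fibrePoint x w)) (Y := fun i => liftField cov
    (constSec (trivializationAt E (TangentSpace 𝓘(ℝ, E) : M → Type _) x) (a i).1)
    (constSec (trivializationAt F V x) (a i).2)) fun i => contMDiffAt_liftField hc
      (contMDiffAt_constSec _ _ ht) (contMDiffAt_constSec _ _ he)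
  refine (h1.comp w (contMDiff_fibrePoint x w)).congr_of_eventuallyEq
    (Filter.Eventually.of_forall fun w => ?_)
  rfl

/-- Along the fibre the arguments are constant in the frame, so only the form itself is
differentiated. -/
theorem mvfderiv_form_liftField (hc : LocSmooth cov)
    {α : ∀ q : TotalSpace F V, Forms (𝓘(ℝ, E).prod 𝓘(ℝ, F)) l q}
    (hα : ContMDiff (𝓘(ℝ, E).prod 𝓘(ℝ, F))
      ((𝓘(ℝ, E).prod 𝓘(ℝ, F)).prod 𝓘(ℝ, (E × F) [⋀^Fin l]→L[ℝ] ℝ)) ∞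
      (fun q => (⟨q, α q⟩ : TotalSpace ((E × F) [⋀^Fin l]→L[ℝ] ℝ)
        (fun q : TotalSpace F V => Forms (𝓘(ℝ, E).prod 𝓘(ℝ, F)) l q))))
    {Y : Fin l → ∀ x : M, TangentSpace 𝓘(ℝ, E) x} {β : Fin l → ∀ x : M, V x} {x : M}
    (hY : ∀ i, MDifferentiableAt 𝓘(ℝ, E) (𝓘(ℝ, E).prod 𝓘(ℝ, E))
      (fun y => (⟨y, Y i y⟩ : TotalSpace E (TangentSpace 𝓘(ℝ, E) : M → Type _))) x)
    (hβ : ∀ i, MDifferentiableAt 𝓘(ℝ, E) (𝓘(ℝ, E).prod 𝓘(ℝ, F))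
      (fun y => (⟨y, β i y⟩ : TotalSpace F V)) x) (w b : F) :
    mvfderiv (𝓘(ℝ, E).prod 𝓘(ℝ, F))
        (fun q => (show ℝ from α q fun i => liftField cov (Y i) (β i) q)) (fibrePoint x w)
        (vertLift (fibrePoint x w) ((trivializationAt F V x).symmL ℝ x b)) =
      fderiv ℝ (fibreForm cov α x) w b fun i =>
        ((trivializationAt E (TangentSpace 𝓘(ℝ, E) : M → Type _) x).continuousLinearMapAt ℝ x
          (Y i x), (trivializationAt F V x).continuousLinearMapAt ℝ x (β i x)) := by
  set c : Fin l → E × F := fun i =>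
        ((trivializationAt E (TangentSpace 𝓘(ℝ, E) : M → Type _) x).continuousLinearMapAt ℝ x
          (Y i x), (trivializationAt F V x).continuousLinearMapAt ℝ x (β i x)) with hcdef
  have h1 := mdifferentiableAt_form_apply ((hα (fibrePoint x w)).mdifferentiableAt (by simp))
    (Y := fun i => liftField cov (Y i) (β i))
    fun i => mdifferentiableAt_liftField hc (hY i) (hβ i)
  have h2 := mfderiv_comp w h1 ((contMDiff_fibrePoint (E := E) x w).mdifferentiableAt (by simp))
  have h3 : (fun q : TotalSpace F V => (show ℝ from α q fun i => liftField cov (Y i) (β i) q)) ∘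
      fibrePoint (F := F) (V := V) x = fun w => fibreForm cov α x w c :=
    funext fun w => form_liftField_fibrePoint α Y β x w
  rw [h3] at h2
  have h4 : HasFDerivAt (fibreForm cov α x) (fderiv ℝ (fibreForm cov α x) w) w :=
    (((contDiff_fibreForm hc hα x).differentiable (by simp)) w).hasFDerivAt
  have h5 := ((ContinuousAlternatingMap.apply ℝ (E × F) ℝ c).hasFDerivAt.comp w
    h4).hasMFDerivAt.mfderiv
  have h6 := congrArg (fun A : F →L[ℝ] ℝ => A b) (h2.symm.trans h5)
  rw [← mfderiv_fibrePoint]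
  exact h6

end VerticalDerivative

/-! ### The vertical differential, its square, and its relation to the lifted connection. -/

section VerticalDifferential

variable {E : Type*} [NormedAddCommGroup E] [NormedSpace ℝ E] [FiniteDimensional ℝ E]
  {M : Type*} [TopologicalSpace M] [ChartedSpace E M] [IsManifold 𝓘(ℝ, E) ∞ M]
  {F : Type*} [NormedAddCommGroup F] [NormedSpace ℝ F] [FiniteDimensional ℝ F]
  {V : M → Type*} [TopologicalSpace (TotalSpace F V)] [∀ x, AddCommGroup (V x)]
  [∀ x, Module ℝ (V x)] [∀ x, TopologicalSpace (V x)] [∀ x, IsTopologicalAddGroup (V x)]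
  [∀ x, ContinuousSMul ℝ (V x)] [FiberBundle F V] [VectorBundle ℝ F V]
  [ContMDiffVectorBundle ∞ F V 𝓘(ℝ, E)]
  {cov : CovariantDerivative 𝓘(ℝ, E) F V} {l : ℕ}
  {S : ∀ x : M, V x →ₗ[ℝ] V x}
  {α α' : ∀ q : TotalSpace F V, Forms (𝓘(ℝ, E).prod 𝓘(ℝ, F)) l q}

/-- The form `α` is smooth. -/
def SmoothForm (α : ∀ q : TotalSpace F V, Forms (𝓘(ℝ, E).prod 𝓘(ℝ, F)) l q) : Prop :=
  ContMDiff (𝓘(ℝ, E).prod 𝓘(ℝ, F)) ((𝓘(ℝ, E).prod 𝓘(ℝ, F)).prod 𝓘(ℝ, (E × F) [⋀^Fin l]→L[ℝ] ℝ)) ∞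
    (fun q => (⟨q, α q⟩ : TotalSpace ((E × F) [⋀^Fin l]→L[ℝ] ℝ)
      (fun q : TotalSpace F V => Forms (𝓘(ℝ, E).prod 𝓘(ℝ, F)) l q)))

/-- The vertical part of a vector, mapped by `S`, in the trivialization at `x`. -/
def verticalCoord (S : ∀ x : M, V x →ₗ[ℝ] V x) (x : M) : E × F →L[ℝ] F :=
  LinearMap.toContinuousLinearMap (((trivializationAt F V x).continuousLinearMapAt ℝ x).toLinearMap ∘ₗ
    S x ∘ₗ ((trivializationAt F V x).symmL ℝ x).toLinearMap) ∘L ContinuousLinearMap.snd ℝ E F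

/-- The exterior derivative in the vertical directions in the image of `S`. -/
def vertDeriv (cov : CovariantDerivative 𝓘(ℝ, E) F V) (S : ∀ x : M, V x →ₗ[ℝ] V x)
    (α : ∀ q : TotalSpace F V, Forms (𝓘(ℝ, E).prod 𝓘(ℝ, F)) l q) (p : TotalSpace F V) :
    Forms (𝓘(ℝ, E).prod 𝓘(ℝ, F)) (l + 1) p :=
  show TangentSpace (𝓘(ℝ, E).prod 𝓘(ℝ, F)) p [⋀^Fin (l + 1)]→L[ℝ] ℝ from
    (ContinuousAlternatingMap.alternatizeUncurryFin
      (fderiv ℝ (fibreForm cov α p.proj) (trivializationAt F V p.proj p).2 ∘L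
        verticalCoord S p.proj)).compContinuousLinearMap (coframeMap cov p)

/-- Frame and coframe cancel. So, for each fixed `x`, the vertical derivative is an operation on
functions on the vector space `F`, with constant coefficients. -/
theorem fibreForm_vertDeriv (x : M) (w : F) :
    fibreForm cov (vertDeriv cov S α) x w = ContinuousAlternatingMap.alternatizeUncurryFin
      (fderiv ℝ (fibreForm cov α x) w ∘L verticalCoord S x) := by
  ext a
  have h1 : (fun i => coframeMap cov (fibrePoint x w) (frameMap cov (fibrePoint x w) (a i))) = a :=
    funext fun i => coframeMap_frameMap (fibrePoint x w) (a i)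
  have h2 := fibreCoord_fibrePoint (F := F) (V := V) x w
  change ContinuousAlternatingMap.alternatizeUncurryFin
      (fderiv ℝ (fibreForm cov α x) (trivializationAt F V x (fibrePoint x w)).2 ∘L
        verticalCoord S x)
      (fun i => coframeMap cov (fibrePoint x w) (frameMap cov (fibrePoint x w) (a i))) = _
  rw [h1, h2]

/-- The map `verticalCoord S` is constant along the fibre, so the second application differentiates
only `Dφ`. The outcome alternates a symmetric bilinear expression. No property of `S` beyond
linearity is used; it need not be a projection. -/
theorem vertDeriv_vertDeriv (hc : LocSmooth cov) (hα : SmoothForm α) :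
    vertDeriv cov S (vertDeriv cov S α) = 0 := by
  funext p
  have h0 : ContDiff ℝ ∞ (fibreForm cov α p.proj) := contDiff_fibreForm hc hα p.proj
  have h1 : fibreForm cov (vertDeriv cov S α) p.proj = fun w =>
      ContinuousAlternatingMap.alternatizeUncurryFinCLM ℝ (E × F) ℝ
        (fderiv ℝ (fibreForm cov α p.proj) w ∘L verticalCoord S p.proj) :=
    funext fun w => fibreForm_vertDeriv p.proj w
  set w := (trivializationAt F V p.proj p).2 with hw
  set φ := fibreForm cov α p.proj with hφ
  set P := verticalCoord (E := E) (F := F) S p.proj with hP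
  have h2 : HasFDerivAt (fderiv ℝ φ) (fderiv ℝ (fderiv ℝ φ) w) w :=
    ((h0.fderiv_right (m := 1) (by norm_num; exact ENat.LEInfty.out)).differentiable (by simp) w).hasFDerivAt
  let R : (F →L[ℝ] (E × F) [⋀^Fin l]→L[ℝ] ℝ) →L[ℝ] (E × F →L[ℝ] (E × F) [⋀^Fin l]→L[ℝ] ℝ) :=
    (ContinuousLinearMap.compL ℝ (E × F) F ((E × F) [⋀^Fin l]→L[ℝ] ℝ)).flip P
  -- The alternation and the precomposition `R` with `P` are fixed continuous linear maps, so the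
  -- chain rule moves the derivative inside.
  have h3 : fderiv ℝ (fibreForm cov (vertDeriv cov S α) p.proj) w =
      ContinuousAlternatingMap.alternatizeUncurryFinCLM ℝ (E × F) ℝ ∘L R ∘L
        fderiv ℝ (fderiv ℝ φ) w := by
    rw [h1]
    let L := ContinuousAlternatingMap.alternatizeUncurryFinCLM ℝ (E × F) ℝ (n := l) ∘L R
    have hL : HasFDerivAt L L (fderiv ℝ φ w) := ContinuousLinearMap.hasFDerivAt _
    refine HasFDerivAt.fderiv ?_
    exact HasFDerivAt.comp (𝕜 := ℝ) (F := F →L[ℝ] (E × F) [⋀^Fin l]→L[ℝ] ℝ)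
      (G := (E × F) [⋀^Fin (l + 1)]→L[ℝ] ℝ) w hL h2
  have h4 : IsSymmSndFDerivAt ℝ φ w := h0.contDiffAt.isSymmSndFDerivAt
    (by rw [minSmoothness_of_isRCLikeNormedField]; exact ENat.LEInfty.out)
  have h5 : ContinuousAlternatingMap.alternatizeUncurryFin
      (fderiv ℝ (fibreForm cov (vertDeriv cov S α) p.proj) w ∘L P) = 0 := by
    rw [h3]
    -- Twofold alternation kills bilinear maps that are symmetric. Inserting `P` in both arguments
    -- keeps the second derivative symmetric.
    refine ContinuousAlternatingMap.alternatizeUncurryFin_alternatizeUncurryFinCLM_comp_of_symmetric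
      (f := R ∘L fderiv ℝ (fderiv ℝ φ) w ∘L P) fun a b => ?_
    exact h4 (P a) (P b)
  refine ContinuousAlternatingMap.ext fun y => ?_
  exact congrArg (fun A : (E × F) [⋀^Fin (l + 1 + 1)]→L[ℝ] ℝ => A fun i => coframeMap cov p (y i)) h5

/-- The vertical derivative in terms of derivatives of functions. -/
theorem vertDeriv_liftField (hc : LocSmooth cov) (hα : SmoothForm α)
    {Y : Fin (l + 1) → ∀ x : M, TangentSpace 𝓘(ℝ, E) x} {β : Fin (l + 1) → ∀ x : M, V x}
    {p : TotalSpace F V}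
    (hY : ∀ i, MDifferentiableAt 𝓘(ℝ, E) (𝓘(ℝ, E).prod 𝓘(ℝ, E))
      (fun y => (⟨y, Y i y⟩ : TotalSpace E (TangentSpace 𝓘(ℝ, E) : M → Type _))) p.proj)
    (hβ : ∀ i, MDifferentiableAt 𝓘(ℝ, E) (𝓘(ℝ, E).prod 𝓘(ℝ, F))
      (fun y => (⟨y, β i y⟩ : TotalSpace F V)) p.proj) :
    (show ℝ from vertDeriv cov S α p fun i => liftField cov (Y i) (β i) p) =
      ∑ j : Fin (l + 1), (-1) ^ (j : ℕ) * mvfderiv (𝓘(ℝ, E).prod 𝓘(ℝ, F))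
        (fun q => (show ℝ from α q fun i => liftField cov (j.removeNth Y i) (j.removeNth β i) q)) p
        (vertLift p (S p.proj (β j p.proj))) := by
  obtain ⟨x, w, rfl⟩ := exists_eq_fibrePoint p
  have he := FiberBundle.mem_baseSet_trivializationAt F V x
  rw [form_liftField_fibrePoint, fibreForm_vertDeriv,
    ContinuousAlternatingMap.alternatizeUncurryFin_apply]
  refine Finset.sum_congr rfl fun j _ => ?_
  have h1 := mvfderiv_form_liftField hc hα (Y := j.removeNth Y) (β := j.removeNth β) (x := x)
    (fun i => hY _) (fun i => hβ _) w
    ((trivializationAt F V x).continuousLinearMapAt ℝ x (S x (β j x)))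
  have h2 : (trivializationAt F V x).symmL ℝ x ((trivializationAt F V x).continuousLinearMapAt ℝ x
      (S x (β j x))) = S x (β j x) := (trivializationAt F V x).symmL_continuousLinearMapAt he _
  rw [h2] at h1
  have h3 : (trivializationAt F V x).symmL ℝ x ((trivializationAt F V x).continuousLinearMapAt ℝ x
      (β j x)) = β j x := (trivializationAt F V x).symmL_continuousLinearMapAt he _
  have h4 : verticalCoord S x ((trivializationAt E (TangentSpace 𝓘(ℝ, E) : M → Type _)
      x).continuousLinearMapAt ℝ x (Y j x), (trivializationAt F V x).continuousLinearMapAt ℝ x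
      (β j x)) = (trivializationAt F V x).continuousLinearMapAt ℝ x (S x (β j x)) :=
    congrArg (fun b => (trivializationAt F V x).continuousLinearMapAt ℝ x (S x b)) h3
  rw [ContinuousLinearMap.comp_apply, h4]
  refine (zsmul_eq_mul _ _).trans ?_
  refine congrArg₂ (· * ·) (by push_cast; rfl) ?_
  exact h1.symm

theorem vertDeriv_add (hc : LocSmooth cov) (hα : SmoothForm α) (hα' : SmoothForm α') :
    vertDeriv cov S (α + α') = vertDeriv cov S α + vertDeriv cov S α' := by
  funext p
  have h1 : fibreForm cov (α + α') p.proj = fibreForm cov α p.proj + fibreForm cov α' p.proj := rfl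
  have h2 : ∀ {α : ∀ q : TotalSpace F V, Forms (𝓘(ℝ, E).prod 𝓘(ℝ, F)) l q}, SmoothForm α → ∀ w,
      DifferentiableAt ℝ (fibreForm cov α p.proj) w := fun h w =>
    (contDiff_fibreForm hc h p.proj).differentiable (by simp) w
  have h3 := fderiv_add (h2 hα (trivializationAt F V p.proj p).2)
    (h2 hα' (trivializationAt F V p.proj p).2)
  refine ContinuousAlternatingMap.ext fun y => ?_
  have h4 : ContinuousAlternatingMap.alternatizeUncurryFinCLM ℝ (E × F) ℝ
      (fderiv ℝ (fibreForm cov (α + α') p.proj) (trivializationAt F V p.proj p).2 ∘L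
        verticalCoord S p.proj) =
      ContinuousAlternatingMap.alternatizeUncurryFinCLM ℝ (E × F) ℝ
      (fderiv ℝ (fibreForm cov α p.proj) (trivializationAt F V p.proj p).2 ∘L
        verticalCoord S p.proj) +
      ContinuousAlternatingMap.alternatizeUncurryFinCLM ℝ (E × F) ℝ
      (fderiv ℝ (fibreForm cov α' p.proj) (trivializationAt F V p.proj p).2 ∘L
        verticalCoord S p.proj) := by
    rw [h1, h3, ContinuousLinearMap.add_comp, map_add]
  exact congrArg (fun A : (E × F) [⋀^Fin (l + 1)]→L[ℝ] ℝ => A fun i => coframeMap cov p (y i)) h4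

theorem vertDeriv_smul (c : ℝ) : vertDeriv cov S (c • α) = c • vertDeriv cov S α := by
  funext p
  have h1 : fibreForm cov (c • α) p.proj = c • fibreForm cov α p.proj := rfl
  have h3 := fderiv_const_smul_field (𝕜 := ℝ) (f := fibreForm cov α p.proj) c
  refine ContinuousAlternatingMap.ext fun y => ?_
  have h4 : ContinuousAlternatingMap.alternatizeUncurryFinCLM ℝ (E × F) ℝ
      (fderiv ℝ (fibreForm cov (c • α) p.proj) (trivializationAt F V p.proj p).2 ∘L
        verticalCoord S p.proj) =
      c • ContinuousAlternatingMap.alternatizeUncurryFinCLM ℝ (E × F) ℝ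
      (fderiv ℝ (fibreForm cov α p.proj) (trivializationAt F V p.proj p).2 ∘L
        verticalCoord S p.proj) := by
    rw [h1, h3, Pi.smul_apply, ContinuousLinearMap.smul_comp, map_smul]
  exact congrArg (fun A : (E × F) [⋀^Fin (l + 1)]→L[ℝ] ℝ => A fun i => coframeMap cov p (y i)) h4

/-- A form is smooth if it is smooth on the horizontal and vertical lifts of frames. -/
theorem contMDiffAt_form_of_liftField (hc : LocSmooth cov) {p : TotalSpace F V}
    (h : ∀ a : Fin l → E × F, ContMDiffAt (𝓘(ℝ, E).prod 𝓘(ℝ, F)) 𝓘(ℝ, ℝ) ∞ (fun q =>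
      (show ℝ from α q fun i => liftField cov
        (constSec (trivializationAt E (TangentSpace 𝓘(ℝ, E) : M → Type _) p.proj) (a i).1)
        (constSec (trivializationAt F V p.proj) (a i).2) q)) p) :
    ContMDiffAt (𝓘(ℝ, E).prod 𝓘(ℝ, F))
      ((𝓘(ℝ, E).prod 𝓘(ℝ, F)).prod 𝓘(ℝ, (E × F) [⋀^Fin l]→L[ℝ] ℝ)) ∞
      (fun q => (⟨q, α q⟩ : TotalSpace ((E × F) [⋀^Fin l]→L[ℝ] ℝ)
      (fun q : TotalSpace F V => Forms (𝓘(ℝ, E).prod 𝓘(ℝ, F)) l q))) p := by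
  have ht := FiberBundle.mem_baseSet_trivializationAt E (TangentSpace 𝓘(ℝ, E) : M → Type _)
    p.proj
  have he := FiberBundle.mem_baseSet_trivializationAt F V p.proj
  set t := trivializationAt E (TangentSpace 𝓘(ℝ, E) : M → Type _) p.proj with htdef
  set e := trivializationAt F V p.proj with hedef
  -- This frame uses the trivializations at `p.proj` for all `q`, whereas `frameMap` uses those at
  -- the base point of `q`, which need not vary smoothly with `q`.
  let θ : ∀ q : TotalSpace F V, E × F →ₗ[ℝ] TangentSpace (𝓘(ℝ, E).prod 𝓘(ℝ, F)) q := fun q =>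
    ((horLift cov q ∘L t.symmL ℝ q.proj) : E →L[ℝ] _).toLinearMap ∘ₗ LinearMap.fst ℝ E F +
      ((vertLift q ∘L e.symmL ℝ q.proj) : F →L[ℝ] _).toLinearMap ∘ₗ LinearMap.snd ℝ E F
  have hθ : ∀ (a : E × F) q, θ q a = liftField cov (constSec t a.1) (constSec e a.2) q :=
    fun a q => rfl
  refine contMDiffAt_alternating_of_constSec fun b => ?_
  let Z : Fin l → ∀ q : TotalSpace F V, TangentSpace (𝓘(ℝ, E).prod 𝓘(ℝ, F)) q := fun i =>
    constSec (trivializationAt (E × F) (TangentSpace (𝓘(ℝ, E).prod 𝓘(ℝ, F)) :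
      TotalSpace F V → Type _) p) (b i)
  have hZ : ∀ i, ContMDiffAt (𝓘(ℝ, E).prod 𝓘(ℝ, F)) ((𝓘(ℝ, E).prod 𝓘(ℝ, F)).prod 𝓘(ℝ, E × F)) ∞
      (fun q => (⟨q, Z i q⟩ : TangentBundle (𝓘(ℝ, E).prod 𝓘(ℝ, F)) (TotalSpace F V))) p := fun i =>
    contMDiffAt_constSec _ _ (FiberBundle.mem_baseSet_trivializationAt _ _ p)
  let C : Module.Basis (Fin (Module.finrank ℝ (E × F))) ℝ (E × F) := Module.finBasis ℝ (E × F)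
  have h1 : ContMDiffAt (𝓘(ℝ, E).prod 𝓘(ℝ, F)) 𝓘(ℝ, ℝ) ∞ (fun q =>
      ∑ k : Fin l → Fin (Module.finrank ℝ (E × F)),
        (∏ i, LinearMap.toContinuousLinearMap (C.coord (k i))
          (horCoord p (Z i) q, vertCoord cov p (Z i) q)) *
        (show ℝ from α q fun i => θ q (C (k i)))) p := by
    refine contMDiffAt_sum fun k => ContMDiffAt.mul ?_ (h fun i => C (k i))
    have h2 : ∀ i, ContMDiffAt (𝓘(ℝ, E).prod 𝓘(ℝ, F)) 𝓘(ℝ, ℝ) ∞ (fun q =>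
        LinearMap.toContinuousLinearMap (C.coord (k i))
          (horCoord p (Z i) q, vertCoord cov p (Z i) q)) p := fun i =>
      (LinearMap.toContinuousLinearMap (C.coord (k i))).contMDiff.contMDiffAt.comp p
        ((contMDiffAt_horCoord hc ht (hZ i)).prodMk_space (contMDiffAt_vertCoord hc he (hZ i)))
    exact (contDiff_prod fun i _ => contDiff_apply ℝ ℝ i).contMDiff.contMDiffAt.comp p
      (contMDiffAt_pi_space.2 h2)
  refine (contMDiffAt_section _).2 (h1.congr_of_eventuallyEq ?_)
  filter_upwards [(tendsto_totalSpace_proj p).eventually (t.open_baseSet.mem_nhds ht),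
    (tendsto_totalSpace_proj p).eventually (e.open_baseSet.mem_nhds he)] with q hqt hqe
  have h2 : ∀ i, Z i q = ∑ k, C.repr (horCoord p (Z i) q, vertCoord cov p (Z i) q) k • θ q (C k) := by
    intro i
    have h3 : θ q (horCoord p (Z i) q, vertCoord cov p (Z i) q) = Z i q := by
      refine Eq.trans ?_ (horLift_add_vertLift cov q (Z i q))
      exact congrArg₂ (fun u b => horLift cov q u + vertLift q b)
        (t.symmL_continuousLinearMapAt (R := ℝ) hqt _) (e.symmL_continuousLinearMapAt (R := ℝ) hqe _)
    rw [← h3]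
    conv_lhs => rw [← C.sum_repr (horCoord p (Z i) q, vertCoord cov p (Z i) q), map_sum]
    exact Finset.sum_congr rfl fun k _ => map_smul _ _ _
  have h4 : (fun i => Z i q) = fun i => ∑ k, C.repr (horCoord p (Z i) q, vertCoord cov p (Z i) q) k •
    θ q (C k) := funext h2
  change (show ℝ from α q fun i => Z i q) = _
  rw [h4]
  refine (MultilinearMap.map_sum (show TangentSpace (𝓘(ℝ, E).prod 𝓘(ℝ, F)) q [⋀^Fin l]→L[ℝ] ℝ
    from α q).toMultilinearMap _).trans ?_
  refine Finset.sum_congr rfl fun k _ => ?_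
  exact MultilinearMap.map_smul_univ (show TangentSpace (𝓘(ℝ, E).prod 𝓘(ℝ, F)) q [⋀^Fin l]→L[ℝ] ℝ
    from α q).toMultilinearMap _ _

/-- The definition works in each fibre with its own trivialization, which hides smoothness across
fibres. On lifts of constant sections the values are derivatives of smooth functions along the
vertical lifts of `S (β j)`, and there smoothness of `S` is needed. -/
theorem smoothForm_vertDeriv (hc : LocSmooth cov) (hα : SmoothForm α)
    (hS : ∀ (β : ∀ x : M, V x) (x : M), ContMDiffAt 𝓘(ℝ, E) (𝓘(ℝ, E).prod 𝓘(ℝ, F)) ∞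
      (fun y => (⟨y, β y⟩ : TotalSpace F V)) x → ContMDiffAt 𝓘(ℝ, E) (𝓘(ℝ, E).prod 𝓘(ℝ, F)) ∞
      (fun y => (⟨y, S y (β y)⟩ : TotalSpace F V)) x) :
    SmoothForm (vertDeriv cov S α) := by
  intro p
  refine contMDiffAt_form_of_liftField hc fun a => ?_
  have ht := FiberBundle.mem_baseSet_trivializationAt E (TangentSpace 𝓘(ℝ, E) : M → Type _)
    p.proj
  have he := FiberBundle.mem_baseSet_trivializationAt F V p.proj
  set t := trivializationAt E (TangentSpace 𝓘(ℝ, E) : M → Type _) p.proj with htdef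
  set e := trivializationAt F V p.proj with hedef
  let Y : Fin (l + 1) → ∀ x : M, TangentSpace 𝓘(ℝ, E) x := fun i => constSec t (a i).1
  let β : Fin (l + 1) → ∀ x : M, V x := fun i => constSec e (a i).2
  have h1 : ContMDiffAt (𝓘(ℝ, E).prod 𝓘(ℝ, F)) 𝓘(ℝ, ℝ) ∞ (fun q : TotalSpace F V =>
      ∑ j : Fin (l + 1), (-1) ^ (j : ℕ) * mvfderiv (𝓘(ℝ, E).prod 𝓘(ℝ, F))
        (fun q => (show ℝ from α q fun i => liftField cov (j.removeNth Y i) (j.removeNth β i) q)) q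
        (vertLift q (S q.proj (β j q.proj)))) p := by
    refine contMDiffAt_sum fun j => contMDiffAt_const.mul ?_
    refine contMDiffAt_mvfderiv_apply ?_ (contMDiffAt_vertLift hc (contMDiffAt_comp_proj
      (s := fun y => S y (β j y)) (hS _ _ (contMDiffAt_constSec _ _ he))))
    exact contMDiffAt_form_apply (hα p) fun i => contMDiffAt_liftField hc
      (contMDiffAt_constSec _ _ ht) (contMDiffAt_constSec _ _ he)
  refine h1.congr_of_eventuallyEq ?_
  filter_upwards [(tendsto_totalSpace_proj p).eventually (t.open_baseSet.mem_nhds ht),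
    (tendsto_totalSpace_proj p).eventually (e.open_baseSet.mem_nhds he)] with q hqt hqe
  exact vertDeriv_liftField hc hα (Y := Y) (β := β)
    (fun i => (smoothNear_constSec t _ hqt).mdifferentiableAt)
    (fun i => (smoothNear_constSec e _ hqe).mdifferentiableAt)

variable {Λ : CovariantDerivative 𝓘(ℝ, E) E (TangentSpace 𝓘(ℝ, E) : M → Type _)}
  {D : CovariantDerivative (𝓘(ℝ, E).prod 𝓘(ℝ, F)) (E × F)
      (TangentSpace (𝓘(ℝ, E).prod 𝓘(ℝ, F)) : TotalSpace F V → Type _)}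
  {covF : CovariantDerivative (𝓘(ℝ, E).prod 𝓘(ℝ, F)) ((E × F) [⋀^Fin l]→L[ℝ] ℝ)
    (fun q : TotalSpace F V => Forms (𝓘(ℝ, E).prod 𝓘(ℝ, F)) l q)}

/-- The lift induces on forms the plain derivative in vertical directions. -/
theorem IsFormConnection.apply_vertical (hF : IsFormConnection l D covF) (h : IsLift Λ cov D)
    (hc : LocSmooth cov) (hα : SmoothForm α)
    {Y : Fin l → ∀ x : M, TangentSpace 𝓘(ℝ, E) x} {β : Fin l → ∀ x : M, V x} {p : TotalSpace F V}
    (hY : ∀ i, MDifferentiableAt 𝓘(ℝ, E) (𝓘(ℝ, E).prod 𝓘(ℝ, E))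
      (fun y => (⟨y, Y i y⟩ : TotalSpace E (TangentSpace 𝓘(ℝ, E) : M → Type _))) p.proj)
    (hβ : ∀ i, MDifferentiableAt 𝓘(ℝ, E) (𝓘(ℝ, E).prod 𝓘(ℝ, F))
      (fun y => (⟨y, β i y⟩ : TotalSpace F V)) p.proj)
    {ξ : TangentSpace (𝓘(ℝ, E).prod 𝓘(ℝ, F)) p} (hξ : projTangent p ξ = 0) :
    (show ℝ from covF α p ξ fun i => liftField cov (Y i) (β i) p) =
      mvfderiv (𝓘(ℝ, E).prod 𝓘(ℝ, F))
        (fun q => (show ℝ from α q fun i => liftField cov (Y i) (β i) q)) p ξ := by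
  have h1 := hF α (fun i => liftField cov (Y i) (β i)) p ((hα p).mdifferentiableAt (by simp))
    (fun i => mdifferentiableAt_liftField hc (hY i) (hβ i)) ξ
  refine h1.trans ((congrArg (_ - ·) (Finset.sum_eq_zero fun i _ => ?_)).trans (sub_zero _))
  rw [h.apply_liftField_of_vertical hc (hY i) (hβ i) hξ]
  exact (show TangentSpace (𝓘(ℝ, E).prod 𝓘(ℝ, F)) p [⋀^Fin l]→L[ℝ] ℝ from α p).map_coord_zero i
    (Function.update_self _ _ _)

/-- Every tangent vector at `p` is the value of a lifted field. For such fields the covariant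
derivative of the form in a vertical direction is the plain derivative, so the two alternating sums
agree term by term, and no frame remains in the formula. -/
theorem vertDeriv_eq_sum (hF : IsFormConnection l D covF) (h : IsLift Λ cov D)
    (hc : LocSmooth cov) (hα : SmoothForm α) (p : TotalSpace F V)
    (y : Fin (l + 1) → TangentSpace (𝓘(ℝ, E).prod 𝓘(ℝ, F)) p) :
    (show ℝ from vertDeriv cov S α p y) = ∑ j : Fin (l + 1), (-1) ^ (j : ℕ) *
      (show ℝ from covF α p (vertLift p (S p.proj (connMap cov p (y j)))) (j.removeNth y)) := by
  let Y : Fin (l + 1) → ∀ x : M, TangentSpace 𝓘(ℝ, E) x := fun i => constExt E (projTangent p (y i))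
  let β : Fin (l + 1) → ∀ x : M, V x := fun i => constExt F (connMap cov p (y i))
  have hy : ∀ i, liftField cov (Y i) (β i) p = y i := by
    intro i
    simp only [liftField, Y, β, constExt_self]
    exact horLift_add_vertLift cov p (y i)
  have hY : ∀ i, MDifferentiableAt 𝓘(ℝ, E) (𝓘(ℝ, E).prod 𝓘(ℝ, E))
      (fun y => (⟨y, Y i y⟩ : TotalSpace E (TangentSpace 𝓘(ℝ, E) : M → Type _))) p.proj :=
    fun i => (smoothNear_constExt _).mdifferentiableAt
  have hβ : ∀ i, MDifferentiableAt 𝓘(ℝ, E) (𝓘(ℝ, E).prod 𝓘(ℝ, F))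
      (fun y => (⟨y, β i y⟩ : TotalSpace F V)) p.proj :=
    fun i => (smoothNear_constExt _).mdifferentiableAt
  have h1 := vertDeriv_liftField (S := S) hc hα hY hβ
  have h2 : (fun i => liftField cov (Y i) (β i) p) = y := funext hy
  rw [h2] at h1
  refine h1.trans (Finset.sum_congr rfl fun j _ => congrArg _ ?_)
  have h3 := hF.apply_vertical h hc hα (Y := j.removeNth Y) (β := j.removeNth β)
    (fun i => hY _) (fun i => hβ _) (projTangent_vertLift p (S p.proj (β j p.proj)))
  have h4 : (fun i => liftField cov (j.removeNth Y i) (j.removeNth β i) p) = j.removeNth y :=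
    funext fun i => hy _
  rw [h4] at h3
  rw [← h3]
  simp only [β, constExt_self]

end VerticalDifferential

/-! ### Independence of the basis and of the chosen connection. -/

section VerticalDifferential

variable {E : Type*} [NormedAddCommGroup E] [NormedSpace ℝ E] [FiniteDimensional ℝ E]
  {M : Type*} [TopologicalSpace M] [ChartedSpace E M] [IsManifold 𝓘(ℝ, E) ∞ M]
  {F : Type*} [NormedAddCommGroup F] [NormedSpace ℝ F] [FiniteDimensional ℝ F]
  {V : M → Type*} [TopologicalSpace (TotalSpace F V)] [∀ x, AddCommGroup (V x)]
  [∀ x, Module ℝ (V x)] [∀ x, TopologicalSpace (V x)] [∀ x, IsTopologicalAddGroup (V x)]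
  [∀ x, ContinuousSMul ℝ (V x)] [FiberBundle F V] [VectorBundle ℝ F V]
  [ContMDiffVectorBundle ∞ F V 𝓘(ℝ, E)]
  {cov cov' : CovariantDerivative 𝓘(ℝ, E) F V} {l : ℕ}
  {S : ∀ x : M, V x →ₗ[ℝ] V x}
  {α : ∀ q : TotalSpace F V, Forms (𝓘(ℝ, E).prod 𝓘(ℝ, F)) l q}
  {Λ : CovariantDerivative 𝓘(ℝ, E) E (TangentSpace 𝓘(ℝ, E) : M → Type _)}
  {D : CovariantDerivative (𝓘(ℝ, E).prod 𝓘(ℝ, F)) (E × F)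
      (TangentSpace (𝓘(ℝ, E).prod 𝓘(ℝ, F)) : TotalSpace F V → Type _)}
  {covF : CovariantDerivative (𝓘(ℝ, E).prod 𝓘(ℝ, F)) ((E × F) [⋀^Fin l]→L[ℝ] ℝ)
    (fun q : TotalSpace F V => Forms (𝓘(ℝ, E).prod 𝓘(ℝ, F)) l q)}

/-- The horizontal lift applies the connection only to the standard extension of a vector, which is
differentiable. -/
theorem horLift_congr (h : ∀ {σ : ∀ x : M, V x} {x : M},
      MDifferentiableAt 𝓘(ℝ, E) (𝓘(ℝ, E).prod 𝓘(ℝ, F)) (fun y => (⟨y, σ y⟩ : TotalSpace F V)) x →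
        cov σ x = cov' σ x) (p : TotalSpace F V) : horLift cov p = horLift cov' p := by
  unfold horLift
  rw [h (FiberBundle.mdifferentiableAt_extend 𝓘(ℝ, E) F p.2)]

/-- The vertical derivative depends on the connection only through its horizontal lifts. -/
theorem vertDeriv_congr (h : ∀ p : TotalSpace F V, horLift cov p = horLift cov' p) :
    vertDeriv cov S α = vertDeriv cov' S α := by
  have h1 : ∀ p : TotalSpace F V, frameMap cov p = frameMap cov' p := fun p => by
    rw [frameMap, frameMap, h]
  have h2 : ∀ p : TotalSpace F V, coframeMap cov p = coframeMap cov' p := fun p => by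
    rw [coframeMap, coframeMap, connMap, connMap, h]
  have h3 : fibreForm cov α = fibreForm cov' α := by
    funext x w
    unfold fibreForm
    rw [h1]
  funext p
  unfold vertDeriv
  rw [h2, h3]

/-- The vertical derivative in terms of a basis of a summand `W_x` of `V_x`. -/
theorem vertDeriv_eq_sum_wedgeOne {W : M → Type*} [∀ x, AddCommGroup (W x)]
    [∀ x, Module ℝ (W x)] (inc : ∀ x, W x →ₗ[ℝ] V x) (pr : ∀ x, V x →ₗ[ℝ] W x)
    (hF : IsFormConnection l D covF) (h : IsLift Λ cov D) (hc : LocSmooth cov) (hα : SmoothForm α)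
    (p : TotalSpace F V) {ι : Type*} [Fintype ι] (f : Module.Basis ι ℝ (W p.proj))
    (y : Fin (l + 1) → TangentSpace (𝓘(ℝ, E).prod 𝓘(ℝ, F)) p) :
    (show ℝ from vertDeriv cov (fun x => inc x ∘ₗ pr x) α p y) =
      ∑ m, wedgeOne (f.coord m ∘ₗ pr p.proj ∘ₗ (connMap cov p).toLinearMap)
        (covF α p (vertLift p (inc p.proj (f m)))) y := by
  rw [vertDeriv_eq_sum hF h hc hα p y]
  simp only [wedgeOne]
  rw [Finset.sum_comm]
  refine Finset.sum_congr rfl fun j _ => ?_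
  let L : W p.proj →ₗ[ℝ] ℝ :=
    { toFun := fun b => (show ℝ from covF α p (vertLift p (inc p.proj b)) (j.removeNth y))
      map_add' := fun b b' => by
        rw [map_add, map_add, map_add]
        rfl
      map_smul' := fun c b => by
        rw [map_smul, map_smul, map_smul]
        rfl }
  change (-1) ^ (j : ℕ) * L (pr p.proj (connMap cov p (y j))) =
    ∑ m, (-1) ^ (j : ℕ) * f.coord m (pr p.proj (connMap cov p (y j))) * L (f m)
  -- The expansion `∑ f^m(b) L(f_m) = L(b)` absorbs the sum over the basis; this is why the choice
  -- of basis does not matter.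
  conv_lhs => rw [← f.sum_repr (pr p.proj (connMap cov p (y j))), map_sum, Finset.mul_sum]
  refine Finset.sum_congr rfl fun m _ => ?_
  rw [map_smul, smul_eq_mul, ← mul_assoc]
  rfl

/-- The vertical derivative as a linear map on smooth forms. -/
def vertDerivLinear (hc : LocSmooth cov)
    (hS : ∀ (β : ∀ x : M, V x) (x : M), ContMDiffAt 𝓘(ℝ, E) (𝓘(ℝ, E).prod 𝓘(ℝ, F)) ∞
      (fun y => (⟨y, β y⟩ : TotalSpace F V)) x → ContMDiffAt 𝓘(ℝ, E) (𝓘(ℝ, E).prod 𝓘(ℝ, F)) ∞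
      (fun y => (⟨y, S y (β y)⟩ : TotalSpace F V)) x) (l : ℕ) :
    SmoothForms (𝓘(ℝ, E).prod 𝓘(ℝ, F)) (TotalSpace F V) l →ₗ[ℝ]
      SmoothForms (𝓘(ℝ, E).prod 𝓘(ℝ, F)) (TotalSpace F V) (l + 1) where
  toFun α := ⟨vertDeriv cov S fun q => α q, smoothForm_vertDeriv hc α.contMDiff hS⟩
  map_add' α α' := ContMDiffSection.ext fun p =>
    congrFun (vertDeriv_add hc α.contMDiff α'.contMDiff) p
  map_smul' c _ := ContMDiffSection.ext fun p => congrFun (vertDeriv_smul c) p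

theorem vertDerivLinear_vertDerivLinear (hc : LocSmooth cov)
    (hS : ∀ (β : ∀ x : M, V x) (x : M), ContMDiffAt 𝓘(ℝ, E) (𝓘(ℝ, E).prod 𝓘(ℝ, F)) ∞
      (fun y => (⟨y, β y⟩ : TotalSpace F V)) x → ContMDiffAt 𝓘(ℝ, E) (𝓘(ℝ, E).prod 𝓘(ℝ, F)) ∞
      (fun y => (⟨y, S y (β y)⟩ : TotalSpace F V)) x) (l : ℕ)
    (α : SmoothForms (𝓘(ℝ, E).prod 𝓘(ℝ, F)) (TotalSpace F V) l) :
    vertDerivLinear hc hS (l + 1) (vertDerivLinear hc hS l α) = 0 :=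
  ContMDiffSection.ext fun p => congrFun (vertDeriv_vertDeriv hc α.contMDiff) p

end VerticalDifferential

/-! ### The vertical differentials on the phase space. -/

section Phase

variable {E : Type*} [NormedAddCommGroup E] [NormedSpace ℝ E] [FiniteDimensional ℝ E]
  {M : Type*} [TopologicalSpace M] [ChartedSpace E M] [IsManifold 𝓘(ℝ, E) ∞ M]
  {F : Type*} [NormedAddCommGroup F] [NormedSpace ℝ F] [FiniteDimensional ℝ F]
  {V : M → Type*} [TopologicalSpace (TotalSpace F V)] [∀ x, AddCommGroup (V x)]
  [∀ x, Module ℝ (V x)] [∀ x, TopologicalSpace (V x)] [∀ x, IsTopologicalAddGroup (V x)]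
  [∀ x, ContinuousSMul ℝ (V x)] [FiberBundle F V] [VectorBundle ℝ F V]
  [ContMDiffVectorBundle ∞ F V 𝓘(ℝ, E)]
  {Γ : CovariantDerivative 𝓘(ℝ, E) F V}
  {Λ : CovariantDerivative 𝓘(ℝ, E) E (TangentSpace 𝓘(ℝ, E) : M → Type _)}

/-- The endomorphism keeps the first two components and replaces the third by zero, so smoothness
can be checked componentwise. -/
theorem contMDiffAt_vqInclusion_vqProjection (β : ∀ x : M, PhaseFibre Γ x) (x : M)
    (hβ : ContMDiffAt 𝓘(ℝ, E) (phaseModel E F) ∞ (fun y => (⟨y, β y⟩ : Phase Γ)) x) :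
    ContMDiffAt 𝓘(ℝ, E) (phaseModel E F) ∞
      (fun y => (⟨y, (vqInclusion Γ y ∘ₗ vqProjection Γ y) (β y)⟩ : Phase Γ)) x := by
  obtain ⟨h1, h2, -⟩ := contMDiffAt_phase_iff.1 hβ
  have h3 : ContMDiffAt 𝓘(ℝ, E) (𝓘(ℝ, E).prod 𝓘(ℝ, VolModel E)) ∞
      (fun y => (⟨y, 0⟩ : TotalSpace (VolModel E) (fun x : M => VolForm E x))) x :=
    (contMDiff_zeroSection ℝ (fun x : M => VolForm E x)).contMDiffAt
  refine contMDiffAt_phase_iff.2 ⟨?_, ?_, ?_⟩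
  · refine h1.congr_of_eventuallyEq (.of_forall fun y => ?_)
    exact congrArg (fun v => (⟨y, v⟩ : TotalSpace F V))
      (phaseFst_phaseMk (Γ := Γ) y (phaseFst Γ y (β y)) (phaseSnd Γ y (β y)) 0)
  · refine h2.congr_of_eventuallyEq (.of_forall fun y => ?_)
    exact congrArg (fun v => (⟨y, v⟩ : TotalSpace ((E →L[ℝ] F) →L[ℝ] VolModel E) (LinFibre E V)))
      (phaseSnd_phaseMk (Γ := Γ) y (phaseFst Γ y (β y)) (phaseSnd Γ y (β y)) 0)
  · refine h3.congr_of_eventuallyEq (.of_forall fun y => ?_)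
    exact congrArg (fun v => (⟨y, v⟩ : TotalSpace (VolModel E) (fun x : M => VolForm E x)))

      (phaseTrd_phaseMk (Γ := Γ) y (phaseFst Γ y (β y)) (phaseSnd Γ y (β y)) 0)

/-- The vertical differential in the directions of a summand of the phase bundle. -/
theorem exists_isVerticalDerivative (hΓ : LocSmooth Γ) (hΛ : LocSmooth Λ) {W : M → Type*}
    [∀ x, AddCommGroup (W x)] [∀ x, Module ℝ (W x)]
    (inc : ∀ x, W x →ₗ[ℝ] PhaseFibre Γ x) (pr : ∀ x, PhaseFibre Γ x →ₗ[ℝ] W x)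
    (hS : ∀ (β : ∀ x : M, PhaseFibre Γ x) (x : M),
      ContMDiffAt 𝓘(ℝ, E) (phaseModel E F) ∞ (fun y => (⟨y, β y⟩ : Phase Γ)) x →
      ContMDiffAt 𝓘(ℝ, E) (phaseModel E F) ∞
        (fun y => (⟨y, (inc y ∘ₗ pr y) (β y)⟩ : Phase Γ)) x) :
    ∃ dV : ∀ l : ℕ, SmoothForms (phaseModel E F) (Phase Γ) l →ₗ[ℝ]
        SmoothForms (phaseModel E F) (Phase Γ) (l + 1),
      (∀ covP D, IsPhaseConnection Γ Λ covP → IsLiftedConnection Γ Λ covP D →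
        ∀ Dst, (∀ l, IsFormConnection l D (Dst l)) →
          IsVerticalDerivative Γ covP inc pr Dst dV) ∧
      ∀ l α, dV (l + 1) (dV l α) = 0 := by
  -- The operator has to be chosen before the phase connection is given. It is built from one phase
  -- connection; any other has the same horizontal lifts and therefore the same vertical derivative.
  obtain ⟨cov₀, h₀⟩ := exists_isPhaseConnection Γ Λ
  have hc₀ := h₀.locSmooth hΓ hΛ
  refine ⟨vertDerivLinear hc₀ hS, fun covP D hP hD Dst hDst l α p ι _ f y => ?_,
    vertDerivLinear_vertDerivLinear hc₀ hS⟩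
  have h1 : ∀ q : Phase Γ, horLift cov₀ q = horLift covP q :=
    horLift_congr fun hσ => h₀.eq_of_mdifferentiableAt hP hσ
  have h2 := vertDeriv_eq_sum_wedgeOne inc pr (hDst l) hD (hP.locSmooth hΓ hΛ) α.contMDiff p f y
  refine Eq.trans ?_ h2
  exact congrArg (fun A : ∀ q : Phase Γ, Forms (phaseModel E F) (l + 1) q => (show ℝ from A p y))
    (vertDeriv_congr h1)

end Phase

end PhaseSpace

end

theorem mainTheorem2
    {E : Type*} [NormedAddCommGroup E] [NormedSpace ℝ E] [FiniteDimensional ℝ E]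
    {M : Type*} [TopologicalSpace M] [T2Space M] [ChartedSpace E M] [IsManifold 𝓘(ℝ, E) ∞ M]
    {F : Type*} [NormedAddCommGroup F] [NormedSpace ℝ F] [FiniteDimensional ℝ F]
    {V : M → Type*} [TopologicalSpace (TotalSpace F V)] [∀ x, AddCommGroup (V x)]
    [∀ x, Module ℝ (V x)] [∀ x, TopologicalSpace (V x)] [∀ x, IsTopologicalAddGroup (V x)]
    [∀ x, ContinuousSMul ℝ (V x)] [FiberBundle F V] [VectorBundle ℝ F V]
    [ContMDiffVectorBundle ∞ F V 𝓘(ℝ, E)]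
    (Γ : CovariantDerivative 𝓘(ℝ, E) F V) (hΓ : CovariantDerivative.ContMDiffCovariantDerivative Γ ∞)
    (Λ : CovariantDerivative 𝓘(ℝ, E) E (TangentSpace 𝓘(ℝ, E) : M → Type _))
    (hΛ : CovariantDerivative.ContMDiffCovariantDerivative Λ ∞) :
    (∃ covP, IsPhaseConnection Γ Λ covP) ∧
    (∀ covP, IsPhaseConnection Γ Λ covP →
      (∃ D, IsLiftedConnection Γ Λ covP D) ∧
      ∀ D, IsLiftedConnection Γ Λ covP D →
        CovariantDerivative.ContMDiffCovariantDerivative D ∞ ∧ IsFlatAlongFibres Γ D ∧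
        ∀ l, ∃ Dst, IsFormConnection l D Dst) ∧
    (∃ dV : ∀ l : ℕ, SmoothForms (phaseModel E F) (Phase Γ) l →ₗ[ℝ]
        SmoothForms (phaseModel E F) (Phase Γ) (l + 1),
      (∀ covP D, IsPhaseConnection Γ Λ covP → IsLiftedConnection Γ Λ covP D →
        ∀ Dst, (∀ l, IsFormConnection l D (Dst l)) →
          IsVerticalDerivative Γ covP (vqInclusion Γ) (vqProjection Γ) Dst dV) ∧
      ∀ l α, dV (l + 1) (dV l α) = 0) ∧
    (∃ dV : ∀ l : ℕ, SmoothForms (phaseModel E F) (Phase Γ) l →ₗ[ℝ]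
        SmoothForms (phaseModel E F) (Phase Γ) (l + 1),
      (∀ covP D, IsPhaseConnection Γ Λ covP → IsLiftedConnection Γ Λ covP D →
        ∀ Dst, (∀ l, IsFormConnection l D (Dst l)) →
          IsVerticalDerivative Γ covP (fun _ => LinearMap.id) (fun _ => LinearMap.id) Dst dV) ∧
      ∀ l α, dV (l + 1) (dV l α) = 0) := by
  have hΓ' := locSmooth_of_contMDiffCovariantDerivative hΓ
  have hΛ' := locSmooth_of_contMDiffCovariantDerivative hΛ
  refine ⟨exists_isPhaseConnection Γ Λ, fun covP hP => ?_,
    exists_isVerticalDerivative hΓ' hΛ' (vqInclusion Γ) (vqProjection Γ)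
      contMDiffAt_vqInclusion_vqProjection,
    exists_isVerticalDerivative hΓ' hΛ' (fun _ => LinearMap.id) (fun _ => LinearMap.id)
      fun _ _ h => h⟩
  have hc := hP.locSmooth hΓ' hΛ'
  refine ⟨⟨liftedConnection hc Λ, isLift_liftedConnection hc Λ⟩, fun D hD => ?_⟩
  -- For the bundle `P` the two notions of lifted connection agree by definition, so the results for
  -- general vector bundles apply.
  have hD' : IsLift Λ covP D := hD
  exact ⟨(hD'.locSmooth hc hΛ').contMDiffCovariantDerivative,
    fun _ _ _ _ hξ hη => hD'.curvature_eq_zero hc hΛ' hξ hη,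
    fun l => ⟨formConnection l D, exists_isFormConnection D⟩⟩
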